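/- Let $0<\alpha<1$ and write $z=x+iy=re^{i\theta}$ for points of $\mathbf R^2$. Let $P_\alpha=(\tfrac1i\nabla-\vec A)^2$ with $\vec A=-\alpha\left(-\tfrac{y}{x^2+y^2},\tfrac{x}{x^2+y^2}\right)$, acting on $C_c^\infty(\mathbf R^2\setminus\{0\})\subset L^2(\mathbf R^2)$; let $\mathcal D(\bar P_\alpha)$ be the domain of its closure in the graph norm, let $P_\alpha$ also denote its Friedrichs extension, and let $\mathcal D_{2,\alpha}$ be the domain of the Friedrichs extension, with the graph norm. Let $\mathcal D_{-2,\alpha}$ be the dual of $\mathcal D_{2,\alpha}$ with respect to the sesquilinear $L^2$ product: its elements $F$ are the continuous antilinear functionals $v\mapsto(F,v)$ on $\mathcal D_{2,\alpha}$, where $(f,v)=\int f\bar v\,dx\,dy$ for $f\in L^2$; put $F(u)=\overline{(F,u)}$, which is linear in $u$. Say that $F\in\mathcal D_{-2,\alpha}$ is supported at $0$ if for all $u\in\mathcal D_{2,\alpha}$ and all $\varphi\in C_c^\infty(\mathbf R^2\setminus\{0\})$ one has $\varphi u\in\mathcal D_{2,\alpha}$ and $(F,\varphi u)=0$. There are (unique)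 $L_0,L_{-1}\in\mathcal D_{-2,\alpha}$ such that, for every smooth cutoff $\rho$ with $\rho(r)=1$ for $r\le1$ and $\rho(r)=0$ for large $r$, every $u\in\mathcal D_{2,\alpha}$ has exactly one expansion $$u=\left(c_{-1}r^{1-\alpha}e^{-i\theta}+c_0r^{\alpha}\right)\rho(r)+v,\qquad c_0,c_{-1}\in\mathbf C,\ v\in\mathcal D(\bar P_\alpha),$$ and its coefficients are $c_0=L_0(u)$ and $c_{-1}=L_{-1}(u)$. Let $T_x=\partial_x-i\alpha\frac{y}{x^2+y^2}$ and $T_y=\partial_y+i\alpha\frac{x}{x^2+y^2}$, and let $Q=aT_x+bT_y$ with $a,b\in\mathbf R$. Then on $\mathbf R^2\setminus\{0\}$ $$Q=e^{-i\alpha\theta}\left(X_z\partial_z+X_{\bar z}\partial_{\bar z}\right)e^{i\alpha\theta}$$ for some $X_z,X_{\bar z}\in\mathbf C$, for every local branch of $\theta$. Moreover $Q$, taken in the sense of distributions on $\mathbf R^2\setminus\{0\}$, maps $\mathcal D_{2,\alpha}$ continuously to $L^2(\mathbf R^2)$. For every $u\in\mathcal D_{2,\alpha}$ let $[Q,P_\alpha]u\in\mathcal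 D_{-2,\alpha}$ be the commutator $QP_\alpha u-P_\alpha Qu$, where $Q$ and $P_\alpha$ act from $L^2$ to $\mathcal D_{-2,\alpha}$ by duality, so that $$([Q,P_\alpha]u,v)=-(P_\alpha u,Qv)-(Qu,P_\alpha v),\qquad v\in\mathcal D_{2,\alpha}.$$ Then $[Q,P_\alpha]u$ is supported at $0$, and for any such $X_z,X_{\bar z}$ $$[Q,P_\alpha]u=-4\pi\alpha(1-\alpha)\left(X_z\,L_0(u)\,L_{-1}+X_{\bar z}\,L_{-1}(u)\,L_0\right).$$ -/

import Mathlib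

open scoped ContDiff ComplexConjugate InnerProductSpace Topology
open MeasureTheory Filter

noncomputable section

namespace AharonovBohm

/-! ## Differential operators on the punctured plane

The plane is identified with `ℂ` through `z = x + i y`; its standard volume is Lebesgue measure. -/

/-- `∂ₓ f`. -/
def dx (f : ℂ → ℂ) (z : ℂ) : ℂ := fderiv ℝ f z 1

/-- `∂_y f`. -/
def dy (f : ℂ → ℂ) (z : ℂ) : ℂ := fderiv ℝ f z Complex.I

/-- `∂_z = (∂ₓ - i ∂_y) / 2`. -/
def dz (f : ℂ → ℂ) (z : ℂ) : ℂ := (1 / 2) * (dx f z - Complex.I * dy f z)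

/-- `∂_z̄ = (∂ₓ + i ∂_y) / 2`. -/
def dzbar (f : ℂ → ℂ) (z : ℂ) : ℂ := (1 / 2) * (dx f z + Complex.I * dy f z)

/-- The first component of the vector potential `A = -α (-y / (x² + y²), x / (x² + y²))`. -/
def potX (α : ℝ) (z : ℂ) : ℝ := -α * (-z.im / (z.re ^ 2 + z.im ^ 2))

/-- The second component of the vector potential. -/
def potY (α : ℝ) (z : ℂ) : ℝ := -α * (z.re / (z.re ^ 2 + z.im ^ 2))

/-- The first component of `(1/i) ∇ - A`. -/
def momX (α : ℝ) (f : ℂ → ℂ) (z : ℂ) : ℂ := (1 / Complex.I) * dx f z - potX α z * f z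

/-- The second component of `(1/i) ∇ - A`. -/
def momY (α : ℝ) (f : ℂ → ℂ) (z : ℂ) : ℂ := (1 / Complex.I) * dy f z - potY α z * f z

/-- The Aharonov-Bohm differential expression `P_α = ((1/i) ∇ - A)²`. -/
def hamiltonian (α : ℝ) (f : ℂ → ℂ) (z : ℂ) : ℂ :=
  momX α (momX α f) z + momY α (momY α f) z

/-- The twisted translation `T_x = ∂ₓ - i α y / (x² + y²)`. -/
def twistX (α : ℝ) (f : ℂ → ℂ) (z : ℂ) : ℂ :=
  dx f z - Complex.I * (α * (z.im / (z.re ^ 2 + z.im ^ 2)) : ℝ) * f z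

/-- The twisted translation `T_y = ∂_y + i α x / (x² + y²)`. -/
def twistY (α : ℝ) (f : ℂ → ℂ) (z : ℂ) : ℂ :=
  dy f z + Complex.I * (α * (z.re / (z.re ^ 2 + z.im ^ 2)) : ℝ) * f z

/-- The operator `Q = a T_x + b T_y`. -/
def twist (α a b : ℝ) (f : ℂ → ℂ) (z : ℂ) : ℂ := a * twistX α f z + b * twistY α f z

/-- `ϑ` is a branch of the polar angle in a neighbourhood of `z`. -/
def IsAngleNear (ϑ : ℂ → ℝ) (z : ℂ) : Prop :=
  ∀ᶠ w in 𝓝 z, ContinuousAt ϑ w ∧ w = ‖w‖ * Complex.exp (Complex.I * ϑ w)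

/-- `a T_x + b T_y = e^{-iαθ} (X_z ∂_z + X_z̄ ∂_z̄) e^{iαθ}` on the punctured plane, where `θ` may be
any local branch of the polar angle. -/
def HasComplexForm (α a b : ℝ) (Xz Xzbar : ℂ) : Prop :=
  ∀ (f : ℂ → ℂ) (z : ℂ) (ϑ : ℂ → ℝ), z ≠ 0 → DifferentiableAt ℝ f z → IsAngleNear ϑ z →
    twist α a b f z = Complex.exp (-(Complex.I * α * ϑ z)) *
      (Xz * dz (fun w => Complex.exp (Complex.I * α * ϑ w) * f w) z +
        Xzbar * dzbar (fun w => Complex.exp (Complex.I * α * ϑ w) * f w) z)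

/-! ## Test functions -/

/-- The space `C_c^∞(ℝ² ∖ {0})`, its elements being extended by `0` to the plane. -/
def Test : Submodule ℂ (ℂ → ℂ) where
  carrier := {f | ContDiff ℝ ∞ f ∧ HasCompactSupport f ∧ (0 : ℂ) ∉ tsupport f}
  zero_mem' := ⟨contDiff_const, HasCompactSupport.zero, by simp [tsupport]⟩
  add_mem' := by
    rintro f g ⟨hf, hf', hf0⟩ ⟨hg, hg', hg0⟩
    exact ⟨hf.add hg, hf'.add hg', fun h => (tsupport_add f g h).elim hf0 hg0⟩
  smul_mem' := by
    rintro c f ⟨hf, hf', hf0⟩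
    exact ⟨contDiff_const.smul hf, hf'.mono (Function.support_const_smul_subset c f),
      fun h => hf0 (closure_mono (Function.support_const_smul_subset c f) h)⟩

theorem Test.dir {f : ℂ → ℂ} (hf : f ∈ Test) (v : ℂ) : (fun z => fderiv ℝ f z v) ∈ Test := by
  obtain ⟨h1, h2, h3⟩ := hf
  have hs : Function.support (fun z => fderiv ℝ f z v) ⊆ tsupport f := by
    intro z hz
    by_contra hz'
    exact hz (by simp [fderiv_of_notMem_tsupport ℝ hz'])
  refine ⟨(h1.fderiv_right (m := ∞) (by simp)).clm_apply contDiff_const, ?_, fun h => h3 ?_⟩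
  · exact h2.mono' hs
  · exact closure_minimal hs (isClosed_tsupport f) h

theorem Test.mul {f : ℂ → ℂ} (hf : f ∈ Test) {g : ℂ → ℂ}
    (hg : ∀ z, z ≠ 0 → ContDiffAt ℝ ∞ g z) : (fun z => g z * f z) ∈ Test := by
  obtain ⟨h1, h2, h3⟩ := hf
  have hs : Function.support (fun z => g z * f z) ⊆ Function.support f := by
    intro z hz hz'
    exact hz (by simp [hz'])
  refine ⟨contDiff_iff_contDiffAt.2 fun z => ?_, h2.mono hs, fun h => h3 (closure_mono hs h)⟩
  by_cases hz : z = 0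
  · subst hz
    have : (fun z => g z * f z) =ᶠ[𝓝 0] fun _ => 0 := by
      filter_upwards [notMem_tsupport_iff_eventuallyEq.1 h3] with z hz
      simp [hz]
    exact contDiffAt_const.congr_of_eventuallyEq this
  · exact (hg z hz).mul h1.contDiffAt

theorem normSq_ne {z : ℂ} (hz : z ≠ 0) : z.re ^ 2 + z.im ^ 2 ≠ 0 := by
  intro h
  apply hz
  apply Complex.ext <;> simp <;> nlinarith [sq_nonneg z.re, sq_nonneg z.im]

theorem contDiffAt_im_div {z : ℂ} (hz : z ≠ 0) :
    ContDiffAt ℝ ∞ (fun z : ℂ => z.im / (z.re ^ 2 + z.im ^ 2)) z := by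
  have h1 : ContDiffAt ℝ ∞ (fun z : ℂ => z.re) z := Complex.reCLM.contDiff.contDiffAt
  have h2 : ContDiffAt ℝ ∞ (fun z : ℂ => z.im) z := Complex.imCLM.contDiff.contDiffAt
  exact h2.div ((h1.pow 2).add (h2.pow 2)) (normSq_ne hz)

theorem contDiffAt_re_div {z : ℂ} (hz : z ≠ 0) :
    ContDiffAt ℝ ∞ (fun z : ℂ => z.re / (z.re ^ 2 + z.im ^ 2)) z := by
  have h1 : ContDiffAt ℝ ∞ (fun z : ℂ => z.re) z := Complex.reCLM.contDiff.contDiffAt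
  have h2 : ContDiffAt ℝ ∞ (fun z : ℂ => z.im) z := Complex.imCLM.contDiff.contDiffAt
  exact h1.div ((h1.pow 2).add (h2.pow 2)) (normSq_ne hz)

theorem contDiffAt_ofReal {g : ℂ → ℝ} {z : ℂ} (hg : ContDiffAt ℝ ∞ g z) :
    ContDiffAt ℝ ∞ (fun z => (g z : ℂ)) z :=
  Complex.ofRealCLM.contDiff.contDiffAt.comp z hg

theorem contDiffAt_potX (α : ℝ) {z : ℂ} (hz : z ≠ 0) : ContDiffAt ℝ ∞ (potX α) z := by
  have : potX α = fun z : ℂ => α * (z.im / (z.re ^ 2 + z.im ^ 2)) := by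
    funext z; simp only [potX]; ring
  rw [this]
  exact contDiffAt_const.mul (contDiffAt_im_div hz)

theorem contDiffAt_potY (α : ℝ) {z : ℂ} (hz : z ≠ 0) : ContDiffAt ℝ ∞ (potY α) z :=
  contDiffAt_const.mul (contDiffAt_re_div hz)

theorem Test.momX {α : ℝ} {f : ℂ → ℂ} (hf : f ∈ Test) : momX α f ∈ Test :=
  Test.sub_mem (Test.smul_mem (1 / Complex.I) (Test.dir hf 1))
    (Test.mul hf fun _ hz => contDiffAt_ofReal (contDiffAt_potX α hz))

theorem Test.momY {α : ℝ} {f : ℂ → ℂ} (hf : f ∈ Test) : momY α f ∈ Test :=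
  Test.sub_mem (Test.smul_mem (1 / Complex.I) (Test.dir hf Complex.I))
    (Test.mul hf fun _ hz => contDiffAt_ofReal (contDiffAt_potY α hz))

theorem Test.hamiltonian {α : ℝ} {f : ℂ → ℂ} (hf : f ∈ Test) : hamiltonian α f ∈ Test :=
  Test.add_mem (Test.momX (Test.momX hf)) (Test.momY (Test.momY hf))

theorem Test.twistX {α : ℝ} {f : ℂ → ℂ} (hf : f ∈ Test) : twistX α f ∈ Test :=
  Test.sub_mem (Test.dir hf 1) (Test.mul hf fun _ hz =>
    contDiffAt_const.mul (contDiffAt_ofReal (contDiffAt_const.mul (contDiffAt_im_div hz))))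

theorem Test.twistY {α : ℝ} {f : ℂ → ℂ} (hf : f ∈ Test) : twistY α f ∈ Test :=
  Test.add_mem (Test.dir hf Complex.I) (Test.mul hf fun _ hz =>
    contDiffAt_const.mul (contDiffAt_ofReal (contDiffAt_const.mul (contDiffAt_re_div hz))))

theorem Test.twist {α a b : ℝ} {f : ℂ → ℂ} (hf : f ∈ Test) : twist α a b f ∈ Test :=
  Test.add_mem (Test.smul_mem (a : ℂ) (Test.twistX hf)) (Test.smul_mem (b : ℂ) (Test.twistY hf))

theorem Test.differentiableAt {f : ℂ → ℂ} (hf : f ∈ Test) (z : ℂ) : DifferentiableAt ℝ f z :=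
  hf.1.differentiable (by simp) z

theorem momX_add (α : ℝ) {f g : ℂ → ℂ} (hf : f ∈ Test) (hg : g ∈ Test) :
    momX α (f + g) = momX α f + momX α g := by
  funext z
  simp only [AharonovBohm.momX, dx, Pi.add_apply,
    fderiv_add (Test.differentiableAt hf z) (Test.differentiableAt hg z),
    _root_.add_apply]
  ring

theorem momY_add (α : ℝ) {f g : ℂ → ℂ} (hf : f ∈ Test) (hg : g ∈ Test) :
    momY α (f + g) = momY α f + momY α g := by
  funext z
  simp only [AharonovBohm.momY, dy, Pi.add_apply,
    fderiv_add (Test.differentiableAt hf z) (Test.differentiableAt hg z),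
    _root_.add_apply]
  ring

theorem momX_smul (α : ℝ) (c : ℂ) {f : ℂ → ℂ} (hf : f ∈ Test) :
    momX α (c • f) = c • momX α f := by
  funext z
  simp only [AharonovBohm.momX, dx, Pi.smul_apply, smul_eq_mul,
    fderiv_const_smul (Test.differentiableAt hf z) c, _root_.smul_apply]
  ring

theorem momY_smul (α : ℝ) (c : ℂ) {f : ℂ → ℂ} (hf : f ∈ Test) :
    momY α (c • f) = c • momY α f := by
  funext z
  simp only [AharonovBohm.momY, dy, Pi.smul_apply, smul_eq_mul,
    fderiv_const_smul (Test.differentiableAt hf z) c, _root_.smul_apply]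
  ring

/-- `P_α` as a linear operator on `C_c^∞(ℝ² ∖ {0})`. -/
def ham (α : ℝ) : Test →ₗ[ℂ] Test where
  toFun φ := ⟨hamiltonian α φ, Test.hamiltonian φ.2⟩
  map_add' φ ψ := by
    ext z
    change momX α (momX α (φ + ψ : ℂ → ℂ)) z + momY α (momY α (φ + ψ : ℂ → ℂ)) z = _
    rw [momX_add α φ.2 ψ.2, momY_add α φ.2 ψ.2,
      momX_add α (Test.momX φ.2) (Test.momX ψ.2), momY_add α (Test.momY φ.2) (Test.momY ψ.2)]
    simp only [hamiltonian, Submodule.coe_add, Pi.add_apply]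
    ring
  map_smul' c φ := by
    ext z
    change momX α (momX α (c • (φ : ℂ → ℂ))) z + momY α (momY α (c • (φ : ℂ → ℂ))) z = _
    rw [momX_smul α c φ.2, momY_smul α c φ.2,
      momX_smul α c (Test.momX φ.2), momY_smul α c (Test.momY φ.2)]
    simp [hamiltonian, mul_add]

/-- `Q = a T_x + b T_y` as a map on `C_c^∞(ℝ² ∖ {0})`. -/
def twistTest (α a b : ℝ) (φ : Test) : Test := ⟨twist α a b φ, Test.twist φ.2⟩

/-! ## The Friedrichs extension -/

/-- `L²(ℝ²)`. The inner product `⟪f, g⟫_ℂ = ∫ conj f * g` is antilinear in the first variable. -/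
abbrev L2 : Type := Lp ℂ 2 (volume : Measure ℂ)

theorem Test.memLp (φ : Test) : MemLp (φ : ℂ → ℂ) 2 (volume : Measure ℂ) :=
  φ.2.1.continuous.memLp_of_hasCompactSupport φ.2.2.1

/-- The inclusion of `C_c^∞(ℝ² ∖ {0})` in `L²(ℝ²)`. -/
def toL2 : Test →ₗ[ℂ] L2 where
  toFun φ := MemLp.toLp φ (Test.memLp φ)
  map_add' φ ψ := MemLp.toLp_add (Test.memLp φ) (Test.memLp ψ)
  map_smul' c φ := MemLp.toLp_const_smul c (Test.memLp φ)

/-- The graph of the operator `P_α` with domain `C_c^∞(ℝ² ∖ {0})`. -/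
def minGraph (α : ℝ) : Submodule ℂ (L2 × L2) :=
  LinearMap.range (toL2.prod (toL2 ∘ₗ ham α))

/-- The domain of the closure of `P_α` in the graph norm. -/
def closureDomain (α : ℝ) : Set L2 :=
  {u | ∃ f, (u, f) ∈ (minGraph α).topologicalClosure}

/-- The quadratic form `q(φ, φ) = (P_α φ, φ)` on `C_c^∞(ℝ² ∖ {0})`; it is real and nonnegative. -/
def form (α : ℝ) (φ : Test) : ℝ := (⟪toL2 (ham α φ), toL2 φ⟫_ℂ).re

theorem inner_toL2 (φ ψ : Test) :
    ⟪toL2 φ, toL2 ψ⟫_ℂ = ∫ z, conj ((φ : ℂ → ℂ) z) * (ψ : ℂ → ℂ) z := by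
  rw [L2.inner_def]
  apply integral_congr_ae
  filter_upwards [MemLp.coeFn_toLp (Test.memLp φ), MemLp.coeFn_toLp (Test.memLp ψ)] with z h1 h2
  change ⟪MemLp.toLp _ (Test.memLp φ) z, MemLp.toLp _ (Test.memLp ψ) z⟫_ℂ = _
  rw [h1, h2, RCLike.inner_apply, mul_comm]

theorem integral_dir_eq_zero {f : ℂ → ℂ} (hf : f ∈ Test) (v : ℂ) :
    ∫ z, fderiv ℝ f z v = 0 := by
  have hi : Integrable (fun z => fderiv ℝ f z v) (volume : Measure ℂ) :=
    (Test.dir hf v).1.continuous.integrable_of_hasCompactSupport (Test.dir hf v).2.1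
  have hi' : Integrable f (volume : Measure ℂ) :=
    hf.1.continuous.integrable_of_hasCompactSupport hf.2.1
  have h := integral_bilinear_fderiv_right_eq_neg_left_of_integrable
    (μ := (volume : Measure ℂ)) (f := fun _ : ℂ => (1 : ℂ)) (g := f) (v := v)
    (B := ContinuousLinearMap.mul ℝ ℂ) (by simp) (by simpa using hi) (by simpa using hi')
    (fun _ _ => by fun_prop) (fun z _ => Test.differentiableAt hf z)
  simpa using h

theorem Test.conj_mul {f g : ℂ → ℂ} (hf : f ∈ Test) (hg : g ∈ Test) :
    (fun z => conj (f z) * g z) ∈ Test :=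
  Test.mul hg fun z _ =>
    (Complex.conjCLE.toContinuousLinearMap.contDiff.contDiffAt).comp z hf.1.contDiffAt

theorem integrable_conj_mul {f g : ℂ → ℂ} (hf : f ∈ Test) (hg : g ∈ Test) :
    Integrable (fun z => conj (f z) * g z) (volume : Measure ℂ) :=
  (Test.conj_mul hf hg).1.continuous.integrable_of_hasCompactSupport (Test.conj_mul hf hg).2.1

theorem fderiv_conj_mul {f g : ℂ → ℂ} (hf : f ∈ Test) (hg : g ∈ Test) (z v : ℂ) :
    fderiv ℝ (fun z => conj (f z) * g z) z v =
      conj (fderiv ℝ f z v) * g z + conj (f z) * fderiv ℝ g z v := by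
  have h1 : HasFDerivAt (fun z => conj (f z))
      (Complex.conjCLE.toContinuousLinearMap.comp (fderiv ℝ f z)) z :=
    Complex.conjCLE.toContinuousLinearMap.hasFDerivAt.comp z
      (Test.differentiableAt hf z).hasFDerivAt
  have h2 : HasFDerivAt (fun z => conj (f z) * g z) _ z :=
    h1.mul (Test.differentiableAt hg z).hasFDerivAt
  rw [h2.fderiv]
  simp
  ring

theorem momX_symm (α : ℝ) {f g : ℂ → ℂ} (hf : f ∈ Test) (hg : g ∈ Test) :
    ∫ z, conj (momX α f z) * g z = ∫ z, conj (f z) * momX α g z := by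
  rw [← sub_eq_zero, ← integral_sub (integrable_conj_mul (Test.momX hf) hg)
    (integrable_conj_mul hf (Test.momX hg))]
  have h := integral_dir_eq_zero (Test.conj_mul hf hg) 1
  rw [← mul_eq_zero_of_right Complex.I h, ← integral_const_mul]
  congr 1
  funext z
  rw [fderiv_conj_mul hf hg]
  simp only [AharonovBohm.momX, dx, map_sub, map_mul, map_neg, Complex.conj_I,
    Complex.conj_ofReal, one_div, Complex.inv_I]
  ring

theorem momY_symm (α : ℝ) {f g : ℂ → ℂ} (hf : f ∈ Test) (hg : g ∈ Test) :
    ∫ z, conj (momY α f z) * g z = ∫ z, conj (f z) * momY α g z := by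
  rw [← sub_eq_zero, ← integral_sub (integrable_conj_mul (Test.momY hf) hg)
    (integrable_conj_mul hf (Test.momY hg))]
  have h := integral_dir_eq_zero (Test.conj_mul hf hg) Complex.I
  rw [← mul_eq_zero_of_right Complex.I h, ← integral_const_mul]
  congr 1
  funext z
  rw [fderiv_conj_mul hf hg]
  simp only [AharonovBohm.momY, dy, map_sub, map_mul, map_neg, Complex.conj_I,
    Complex.conj_ofReal, one_div, Complex.inv_I]
  ring

theorem form_eq (α : ℝ) (φ : Test) :
    form α φ = ‖toL2 ⟨momX α φ, Test.momX φ.2⟩‖ ^ 2 + ‖toL2 ⟨momY α φ, Test.momY φ.2⟩‖ ^ 2 := by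
  have h : ⟪toL2 (ham α φ), toL2 φ⟫_ℂ =
      ⟪toL2 ⟨momX α φ, Test.momX φ.2⟩, toL2 ⟨momX α φ, Test.momX φ.2⟩⟫_ℂ +
      ⟪toL2 ⟨momY α φ, Test.momY φ.2⟩, toL2 ⟨momY α φ, Test.momY φ.2⟩⟫_ℂ := by
    have h1 : ham α φ = (⟨momX α (momX α φ), Test.momX (Test.momX φ.2)⟩ : Test) +
        ⟨momY α (momY α φ), Test.momY (Test.momY φ.2)⟩ := rfl
    rw [h1, map_add, inner_add_left]
    simp only [inner_toL2]
    rw [momX_symm α (Test.momX φ.2) φ.2, momY_symm α (Test.momY φ.2) φ.2]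
  rw [form, h, Complex.add_re]
  simp only [inner_self_eq_norm_sq_to_K]
  norm_cast

theorem form_nonneg (α : ℝ) (φ : Test) : 0 ≤ form α φ := by
  rw [form_eq]; positivity

theorem form_add_le (α : ℝ) (φ ψ : Test) : form α (φ + ψ) ≤ 2 * form α φ + 2 * form α ψ := by
  have h := form_nonneg α (φ - ψ)
  simp only [form, map_add, map_sub, inner_add_left, inner_add_right, inner_sub_left,
    inner_sub_right, Complex.add_re, Complex.sub_re] at h ⊢
  linarith

theorem form_smul (α : ℝ) (c : ℂ) (φ : Test) : form α (c • φ) = ‖c‖ ^ 2 * form α φ := by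
  simp only [form, map_smul, inner_smul_left, inner_smul_right]
  rw [← mul_assoc, Complex.mul_conj', ← Complex.ofReal_pow, Complex.re_ofReal_mul]

/-- The form domain `D(P_α^{1/2})`: the completion of `C_c^∞(ℝ² ∖ {0})`, inside `L²(ℝ²)`, in the norm
`(‖φ‖² + q(φ, φ))^{1/2}`. -/
def formDomain (α : ℝ) : Submodule ℂ L2 where
  carrier := {u | ∃ φ : ℕ → Test, Tendsto (fun n => toL2 (φ n)) atTop (𝓝 u) ∧
    Tendsto (fun p : ℕ × ℕ => form α (φ p.1 - φ p.2)) atTop (𝓝 0)}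
  zero_mem' := ⟨fun _ => 0, by simp, by simp [form]⟩
  add_mem' := by
    rintro u v ⟨φ, h1, h2⟩ ⟨ψ, h3, h4⟩
    refine ⟨fun n => φ n + ψ n, by simpa using h1.add h3, ?_⟩
    refine squeeze_zero (fun p => form_nonneg α _) (fun p => ?_)
      (by simpa using (h2.const_mul 2).add (h4.const_mul 2))
    rw [add_sub_add_comm]
    exact form_add_le α _ _
  smul_mem' := by
    rintro c u ⟨φ, h1, h2⟩
    refine ⟨fun n => c • φ n, by simpa using h1.const_smul c, ?_⟩
    have h3 : (fun p : ℕ × ℕ => form α (c • φ p.1 - c • φ p.2)) =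
        fun p => ‖c‖ ^ 2 * form α (φ p.1 - φ p.2) :=
      funext fun p => by
        rw [← form_smul, ← (smul_sub c (φ p.1) (φ p.2) : c • (φ p.1 - φ p.2) = _)]
    rw [h3]
    simpa only [mul_zero] using h2.const_mul (‖c‖ ^ 2)

/-- The graph of the adjoint of `P_α` on `C_c^∞(ℝ² ∖ {0})`: the pairs `(u, f)` in `L² × L²` with
`P_α u = f` in the sense of distributions on `ℝ² ∖ {0}`. -/
def maxGraph (α : ℝ) : Submodule ℂ (L2 × L2) where
  carrier := {p | ∀ φ : Test, ⟪toL2 φ, p.2⟫_ℂ = ⟪toL2 (ham α φ), p.1⟫_ℂ}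
  zero_mem' := by simp
  add_mem' := by
    intro p q hp hq φ
    simp [inner_add_right, hp φ, hq φ]
  smul_mem' := by
    intro c p hp φ
    simp [inner_smul_right, hp φ]

/-- The Friedrichs extension of `P_α`: the restriction of the adjoint to the form domain. The
Friedrichs domain `D_{2,α}` with its graph norm is represented by the graph, that is, by the pairs
`(u, P_α u)` with `u` in the domain. -/
def D2 (α : ℝ) : Submodule ℂ (L2 × L2) :=
  maxGraph α ⊓ (formDomain α).comap (LinearMap.fst ℂ L2 L2)

/-- The inclusion `u ↦ u` of the Friedrichs domain in `L²`. -/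
def incl (α : ℝ) : D2 α →L[ℂ] L2 := (ContinuousLinearMap.fst ℂ L2 L2).comp (D2 α).subtypeL

/-- The Friedrichs extension `u ↦ P_α u` as a map from its domain to `L²`. -/
def P (α : ℝ) : D2 α →L[ℂ] L2 := (ContinuousLinearMap.snd ℂ L2 L2).comp (D2 α).subtypeL

/-! ## The dual space and the commutator -/

/-- The dual `D_{-2,α}` of `D_{2,α}` with respect to the sesquilinear product: `F` stands for the
functional `v ↦ (F, v)`, where `(f, v) = ∫ f * conj v` when `f` is in `L²`. -/
abbrev Dminus2 (α : ℝ) : Type := D2 α →L⋆[ℂ] ℂ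

/-- The value `⟨L, u⟩`, linear in `u` and antilinear in `L`. -/
def pairing {α : ℝ} (L : Dminus2 α) (u : D2 α) : ℂ := conj (L u)

/-- The functional `v ↦ (f, B v)` in `D_{-2,α}`: the transpose of `B : D_{2,α} → L²` at `f`. -/
def transpose {α : ℝ} (B : D2 α →L[ℂ] L2) (f : L2) : Dminus2 α :=
  ((innerSL ℂ : L2 →L⋆[ℂ] L2 →L[ℂ] ℂ).flip f).comp B

/-- `Q` is the operator `a T_x + b T_y` from `D_{2,α}` to `L²`, where `Q u` is taken in the sense of
distributions on `ℝ² ∖ {0}`; since `a` and `b` are real, `-(a T_x + b T_y)` is the formal adjoint. -/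
def IsTwist (α a b : ℝ) (Q : D2 α →L[ℂ] L2) : Prop :=
  ∀ (u : D2 α) (φ : Test), ⟪toL2 φ, Q u⟫_ℂ = -⟪toL2 (twistTest α a b φ), incl α u⟫_ℂ

/-- The commutator `[Q, P_α] u = Q P_α u - P_α Q u` in `D_{-2,α}`, for the formally skew-adjoint
`Q : D_{2,α} → L²`. Here `Q` and `P_α` act from `L²` to `D_{-2,α}` by duality, `(Q f, v) = -(f, Q v)`
and `(P_α f, v) = (f, P_α v)`. -/
def commutator {α : ℝ} (Q : D2 α →L[ℂ] L2) (u : D2 α) : Dminus2 α :=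
  -transpose Q (P α u) - transpose (P α) (Q u)

/-- `F` is supported at `0`: `(F, φ u) = 0` for every `u` in `D_{2,α}` and every smooth, compactly
supported `φ` that vanishes near `0` (the product `φ u` being again in `D_{2,α}`). -/
def SupportedAtZero {α : ℝ} (F : Dminus2 α) : Prop :=
  ∀ (u : D2 α) (φ : ℂ → ℂ), φ ∈ Test →
    ∃ w : D2 α, incl α w =ᵐ[volume] (fun z => φ z * incl α u z) ∧ F w = 0

/-- A smooth radial cutoff, equal to `1` for `r ≤ 1` and to `0` for large `r`. -/
def IsCutoff (ρ : ℝ → ℝ) : Prop :=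
  ContDiff ℝ ∞ ρ ∧ (∀ r ≤ 1, ρ r = 1) ∧ ∃ R, ∀ r ≥ R, ρ r = 0

/-- `u = (c₁ r^{1-α} e^{-iθ} + c₀ r^α) ρ(r) + v` with `v` in the domain of the closure of `P_α`. -/
def HasExpansion (α : ℝ) (ρ : ℝ → ℝ) (u : D2 α) (c₀ c₁ : ℂ) : Prop :=
  ∃ v ∈ closureDomain α, incl α u =ᵐ[volume] fun z =>
    (c₁ * (‖z‖ ^ (1 - α) : ℝ) * Complex.exp (-(Complex.I * z.arg)) + c₀ * (‖z‖ ^ α : ℝ)) * ρ ‖z‖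
      + v z

/-- `L₀` and `L₁` in `D_{-2,α}` are the functionals that extract the coefficients of `r^α` and of
`r^{1-α} e^{-iθ}`: whatever the cutoff, every `u` in `D_{2,α}` has exactly one expansion, and its
coefficients are `⟨L₀, u⟩` and `⟨L₁, u⟩`. -/
def AreCoefficients (α : ℝ) (L₀ L₁ : Dminus2 α) : Prop :=
  ∀ (ρ : ℝ → ℝ), IsCutoff ρ → ∀ (u : D2 α) (c₀ c₁ : ℂ),
    HasExpansion α ρ u c₀ c₁ ↔ c₀ = pairing L₀ u ∧ c₁ = pairing L₁ u

end AharonovBohm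

end

noncomputable section

namespace AharonovBohm

/-! ## Wirtinger calculus on the punctured plane -/

/-! The magnetic field vanishes off the origin. The twisted derivatives `Tz` and `Tzb`, which are
∂_z and ∂_z̄ conjugated by e^{iαθ}, therefore commute there, and on test functions each is minus the
adjoint of the other. Hence P = -4 T_z̄ T_z = -4 T_z T_z̄ (`ham_eq`, `ham_eq'`) and Q = X T_z + X̄
T_z̄ with X = a + ib, so that the commutator is formally zero. What survives is a boundary term at
the origin. With B(v,u) = ⟪T_z̄ v, P u⟫ + ⟪P v, T_z u⟫ (`crossForm`), the functional [Q,P]u takes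
the value -X B(v,u) - X̄ conj B(u,v) at v (`commutator_twistOp_apply`).

B(v,u) vanishes when u lies in the domain of the closure of P (`crossForm_eq_zero_right`), so it is
enough to know the Friedrichs domain modulo that subspace. Two functionals describe the quotient.
`bdryZero` is the defect in the integration by parts of T_z u against σ r^{-α}, a function killed by
T_z near 0; `bdryOne` is the defect for T_z̄ u against σ r^α/z, killed by T_z̄ near 0. Both vanish
on the closure domain, and conversely their common kernel is the closure domain
(`mem_minDomain_of_pairing`). This converse is the analytic core. (i) If the defect vanishes, then
T_z u / r and T_z̄ u / r are in L². This is proved by duality: the first-order equation is solved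
with a Cauchy transform, and the solution is bounded by Hardy's inequality for a flux shifted by one
(`first_order_solution`, `memLp_div_of_weak_Tzb`). (ii) A weighted Hardy inequality then puts u / r²
in L² (`memLp_div_sq`). (iii) Cutoffs that are dilated in log r have derivatives so small that χ_n u
converges to u in the graph norm (`mem_minDomain_of_div`). That χ_n u is itself in the closure
domain is a mollification argument (`mul_mem_closure`).

On the models M₀ = σ r^α and M₁ = σ r^{1-α}e^{-iθ} one first derivative is a test function, and the
other is a test function plus a multiple of σ r^α/z or of σ r^{-α}. This gives B(v,M₀) = -4α conj
`bdryOne`(v), B(M₁,u) = -4(1-α) `bdryZero`(u) and B(M₀,u) = B(v,M₁) = 0. A single integral,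
`bdryZero`(M₀) = -πα, then determines all values on the models. Dividing by them produces the
coefficient functionals and B(v,u) = 4πα(1-α) L₀(u) conj L₋₁(u')|_{u'=v} (`crossForm_eq`), which is
the formula. Localization at 0 follows because φ u lies in the closure domain, where both
coefficients vanish. -/

theorem dz_mul {f g : ℂ → ℂ} {z : ℂ} (hf : DifferentiableAt ℝ f z) (hg : DifferentiableAt ℝ g z) :
    dz (fun w => f w * g w) z = dz f z * g z + f z * dz g z := by
  simp only [dz, dx, dy, fderiv_fun_mul hf hg, _root_.add_apply, _root_.smul_apply,
    smul_eq_mul]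
  ring

theorem dzbar_mul {f g : ℂ → ℂ} {z : ℂ} (hf : DifferentiableAt ℝ f z)
    (hg : DifferentiableAt ℝ g z) :
    dzbar (fun w => f w * g w) z = dzbar f z * g z + f z * dzbar g z := by
  simp only [dzbar, dx, dy, fderiv_fun_mul hf hg, _root_.add_apply, _root_.smul_apply,
    smul_eq_mul]
  ring

theorem dz_add {f g : ℂ → ℂ} {z : ℂ} (hf : DifferentiableAt ℝ f z) (hg : DifferentiableAt ℝ g z) :
    dz (fun w => f w + g w) z = dz f z + dz g z := by
  simp only [dz, dx, dy, fderiv_fun_add hf hg, _root_.add_apply]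
  ring

theorem dzbar_add {f g : ℂ → ℂ} {z : ℂ} (hf : DifferentiableAt ℝ f z)
    (hg : DifferentiableAt ℝ g z) :
    dzbar (fun w => f w + g w) z = dzbar f z + dzbar g z := by
  simp only [dzbar, dx, dy, fderiv_fun_add hf hg, _root_.add_apply]
  ring

theorem dz_const (c z : ℂ) : dz (fun _ => c) z = 0 := by simp [dz, dx, dy]

theorem dzbar_const (c z : ℂ) : dzbar (fun _ => c) z = 0 := by simp [dzbar, dx, dy]

theorem dz_const_mul (c : ℂ) {f : ℂ → ℂ} {z : ℂ} (hf : DifferentiableAt ℝ f z) :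
    dz (fun w => c * f w) z = c * dz f z := by
  rw [dz_mul (differentiableAt_const c) hf, dz_const]; ring

theorem dzbar_const_mul (c : ℂ) {f : ℂ → ℂ} {z : ℂ} (hf : DifferentiableAt ℝ f z) :
    dzbar (fun w => c * f w) z = c * dzbar f z := by
  rw [dzbar_mul (differentiableAt_const c) hf, dzbar_const]; ring

theorem dz_congr {f g : ℂ → ℂ} {z : ℂ} (h : f =ᶠ[𝓝 z] g) : dz f z = dz g z := by
  simp only [dz, dx, dy, h.fderiv_eq]

theorem dzbar_congr {f g : ℂ → ℂ} {z : ℂ} (h : f =ᶠ[𝓝 z] g) : dzbar f z = dzbar g z := by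
  simp only [dzbar, dx, dy, h.fderiv_eq]

theorem fderiv_conj {f : ℂ → ℂ} {z : ℂ} (hf : DifferentiableAt ℝ f z) (v : ℂ) :
    fderiv ℝ (fun w => conj (f w)) z v = conj (fderiv ℝ f z v) := by
  have h1 : HasFDerivAt (fun z => conj (f z))
      (Complex.conjCLE.toContinuousLinearMap.comp (fderiv ℝ f z)) z :=
    Complex.conjCLE.toContinuousLinearMap.hasFDerivAt.comp z hf.hasFDerivAt
  rw [h1.fderiv]
  simp

theorem differentiableAt_conj {f : ℂ → ℂ} {z : ℂ} (hf : DifferentiableAt ℝ f z) :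
    DifferentiableAt ℝ (fun w => conj (f w)) z :=
  Complex.conjCLE.toContinuousLinearMap.differentiableAt.comp z hf

theorem dz_conj {f : ℂ → ℂ} {z : ℂ} (hf : DifferentiableAt ℝ f z) :
    dz (fun w => conj (f w)) z = conj (dzbar f z) := by
  simp only [dz, dzbar, dx, dy, fderiv_conj hf]
  simp only [map_mul, map_div₀, map_one, map_ofNat, map_add, Complex.conj_I]
  ring

theorem dzbar_conj {f : ℂ → ℂ} {z : ℂ} (hf : DifferentiableAt ℝ f z) :
    dzbar (fun w => conj (f w)) z = conj (dz f z) := by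
  simp only [dz, dzbar, dx, dy, fderiv_conj hf]
  simp only [map_mul, map_div₀, map_one, map_ofNat, map_sub, Complex.conj_I]
  ring

theorem fderiv_eq_dz_dzbar (f : ℂ → ℂ) (z v : ℂ) :
    fderiv ℝ f z v = v * dz f z + conj v * dzbar f z := by
  have h : v = v.re • (1 : ℂ) + v.im • Complex.I := by
    simp [Complex.re_add_im]
  conv_lhs => rw [h]
  rw [map_add, map_smul, map_smul]
  simp only [dz, dzbar, dx, dy, Complex.real_smul]
  conv_rhs => rw [← Complex.re_add_im v]
  simp only [map_add, map_mul, Complex.conj_ofReal, Complex.conj_I]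
  linear_combination ((v.im : ℂ) * fderiv ℝ f z Complex.I) * Complex.I_sq

theorem hasDerivAt_dz {f : ℂ → ℂ} {z f' : ℂ} (hf : HasDerivAt f f' z) :
    dz f z = f' ∧ dzbar f z = 0 := by
  have h := hf.hasFDerivAt.restrictScalars ℝ
  simp only [dz, dzbar, dx, dy, h.fderiv]
  simp
  constructor
  · linear_combination (-(1 / 2) * f') * Complex.I_sq
  · linear_combination f' * Complex.I_sq

theorem dz_dzbar_comm {f : ℂ → ℂ} {z : ℂ} (hf : ContDiffAt ℝ 2 f z) :
    dz (dzbar f) z = dzbar (dz f) z := by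
  have hs := (hf.isSymmSndFDerivAt (by simp)).eq 1 Complex.I
  have hd : DifferentiableAt ℝ (fderiv ℝ f) z :=
    (hf.fderiv_right (m := 1) (by norm_num)).differentiableAt (by simp)
  have hx : ∀ v w : ℂ, fderiv ℝ (fun z => fderiv ℝ f z v) z w = fderiv ℝ (fderiv ℝ f) z w v := by
    intro v w
    rw [fderiv_clm_apply hd (differentiableAt_const v)]
    simp
  have hdx : ∀ v : ℂ, DifferentiableAt ℝ (fun z => fderiv ℝ f z v) z := fun v =>
    hd.clm_apply (differentiableAt_const v)
  have e1 : dz (dzbar f) z = (1 / 2) * (dz (fun z => fderiv ℝ f z 1) z +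
      Complex.I * dz (fun z => fderiv ℝ f z Complex.I) z) := by
    unfold dzbar dx dy
    rw [dz_const_mul _ ((hdx 1).fun_add ((differentiableAt_const _).fun_mul (hdx _))),
      dz_add (hdx 1) ((differentiableAt_const _).fun_mul (hdx _)), dz_const_mul _ (hdx _)]
  have e2 : dzbar (dz f) z = (1 / 2) * (dzbar (fun z => fderiv ℝ f z 1) z +
      (-Complex.I) * dzbar (fun z => fderiv ℝ f z Complex.I) z) := by
    have : dz f = fun z => (1 / 2) * (fderiv ℝ f z 1 + (-Complex.I) * fderiv ℝ f z Complex.I) := by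
      funext z; simp only [dz, dx, dy]; ring
    rw [this, dzbar_const_mul _ ((hdx 1).fun_add ((differentiableAt_const _).fun_mul (hdx _))),
      dzbar_add (hdx 1) ((differentiableAt_const _).fun_mul (hdx _)), dzbar_const_mul _ (hdx _)]
  rw [e1, e2]
  simp only [dz, dzbar, dx, dy, hx, hs]
  ring

/-- `f` is smooth on the punctured plane. -/
def SmoothOff (f : ℂ → ℂ) : Prop := ∀ z, z ≠ 0 → ContDiffAt ℝ ∞ f z

namespace SmoothOff

variable {f g : ℂ → ℂ}

theorem differentiableAt (hf : SmoothOff f) {z : ℂ} (hz : z ≠ 0) : DifferentiableAt ℝ f z :=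
  (hf z hz).differentiableAt (by simp)

theorem contDiffAt_two (hf : SmoothOff f) {z : ℂ} (hz : z ≠ 0) : ContDiffAt ℝ 2 f z :=
  (hf z hz).of_le (by norm_cast)

theorem mul (hf : SmoothOff f) (hg : SmoothOff g) : SmoothOff fun z => f z * g z :=
  fun z hz => (hf z hz).mul (hg z hz)

theorem add (hf : SmoothOff f) (hg : SmoothOff g) : SmoothOff fun z => f z + g z :=
  fun z hz => (hf z hz).add (hg z hz)

theorem sub (hf : SmoothOff f) (hg : SmoothOff g) : SmoothOff fun z => f z - g z :=
  fun z hz => (hf z hz).sub (hg z hz)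

theorem star (hf : SmoothOff f) : SmoothOff fun z => conj (f z) :=
  fun z hz => (Complex.conjCLE.toContinuousLinearMap.contDiff.contDiffAt).comp z (hf z hz)

theorem const (c : ℂ) : SmoothOff fun _ => c := fun _ _ => contDiffAt_const

theorem id : SmoothOff fun z => z := fun _ _ => contDiffAt_id

theorem inv (hf : SmoothOff f) (h0 : ∀ z, z ≠ 0 → f z ≠ 0) : SmoothOff fun z => (f z)⁻¹ :=
  fun z hz => (hf z hz).inv (h0 z hz)

theorem div (hf : SmoothOff f) (hg : SmoothOff g) (h0 : ∀ z, z ≠ 0 → g z ≠ 0) :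
    SmoothOff fun z => f z / g z :=
  fun z hz => by
    simp only [div_eq_mul_inv]
    exact (hf z hz).mul ((hg z hz).inv (h0 z hz))

theorem of_contDiff (hf : ContDiff ℝ ∞ f) : SmoothOff f := fun _ _ => hf.contDiffAt

theorem dir (hf : SmoothOff f) (v : ℂ) : SmoothOff fun z => fderiv ℝ f z v :=
  fun z hz => ((hf z hz).fderiv_right (m := ∞) (by simp)).clm_apply contDiffAt_const

theorem dz (hf : SmoothOff f) : SmoothOff (dz f) :=
  (const _).mul ((hf.dir _).sub ((const _).mul (hf.dir _)))

theorem dzbar (hf : SmoothOff f) : SmoothOff (dzbar f) :=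
  (const _).mul ((hf.dir _).add ((const _).mul (hf.dir _)))

theorem aestronglyMeasurable (hf : SmoothOff f) : AEStronglyMeasurable f (volume : Measure ℂ) := by
  have h : ContinuousOn f {0}ᶜ := fun z hz => (hf z hz).continuousAt.continuousWithinAt
  have h2 := h.aestronglyMeasurable (μ := (volume : Measure ℂ)) (measurableSet_singleton 0).compl
  rwa [restrict_compl_singleton] at h2

theorem radial {κ : ℝ → ℝ} (hκ : ContDiff ℝ ∞ κ) : SmoothOff fun z => (κ (Real.log ‖z‖) : ℂ) :=
  fun z hz => contDiffAt_ofReal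
    (hκ.contDiffAt.comp z ((contDiffAt_norm ℝ hz).log (norm_ne_zero_iff.2 hz)))

end SmoothOff

theorem Test.smoothOff {f : ℂ → ℂ} (hf : f ∈ Test) : SmoothOff f := .of_contDiff hf.1

/-! ### Radial functions and powers of r. -/

theorem hasFDerivAt_log_norm {z : ℂ} (hz : z ≠ 0) (v : ℂ) :
    fderiv ℝ (fun w : ℂ => Real.log ‖w‖) z v = (conj z * v).re / ‖z‖ ^ 2 := by
  have h1 := (hasStrictFDerivAt_norm_sq z).hasFDerivAt
  have hz' : ‖z‖ ^ 2 ≠ 0 := by positivity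
  have h2 := (h1.log hz').const_mul (1 / 2)
  have h3 : (fun w : ℂ => Real.log ‖w‖) = fun w => 1 / 2 * Real.log (‖w‖ ^ 2) := by
    funext w; rw [Real.log_pow]; push_cast; ring
  rw [h3, h2.fderiv]
  simp
  field_simp

theorem fderiv_radial {κ : ℝ → ℝ} {z : ℂ} (hz : z ≠ 0) (hκ : DifferentiableAt ℝ κ (Real.log ‖z‖))
    (v : ℂ) : fderiv ℝ (fun w : ℂ => (κ (Real.log ‖w‖) : ℂ)) z v =
      deriv κ (Real.log ‖z‖) * ((conj z * v).re / ‖z‖ ^ 2 : ℝ) := by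
  have hl : DifferentiableAt ℝ (fun w : ℂ => Real.log ‖w‖) z :=
    ((contDiffAt_norm (n := 1) ℝ hz).log (norm_ne_zero_iff.2 hz)).differentiableAt (by simp)
  have h1 := Complex.ofRealCLM.hasFDerivAt.comp z (hκ.hasDerivAt.comp_hasFDerivAt z hl.hasFDerivAt)
  have h2 : HasFDerivAt (fun w : ℂ => (κ (Real.log ‖w‖) : ℂ)) _ z := h1
  rw [h2.fderiv]
  simp [hasFDerivAt_log_norm hz]

/-- Locally log |z| = (log z + log z̄)/2, whence the factor 1/(2z). Radial functions are written in
the variable log r because dilating that variable by n makes z ∂_z of the function smaller by the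
factor n. -/
theorem dz_radial {κ : ℝ → ℝ} {z : ℂ} (hz : z ≠ 0) (hκ : DifferentiableAt ℝ κ (Real.log ‖z‖)) :
    dz (fun w : ℂ => (κ (Real.log ‖w‖) : ℂ)) z = (deriv κ (Real.log ‖z‖) : ℝ) / (2 * z) := by
  simp only [dz, dx, dy, fderiv_radial hz hκ]
  have h : ((‖z‖ ^ 2 : ℝ) : ℂ) = z * conj z := by rw [Complex.mul_conj, Complex.normSq_eq_norm_sq]
  push_cast at h ⊢
  have hc : conj z ≠ 0 := (map_ne_zero _).2 hz
  rw [h, mul_one]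
  have e : ((conj z).re : ℂ) - Complex.I * ((conj z * Complex.I).re : ℂ) = conj z := by
    apply Complex.ext <;> simp
  field_simp
  linear_combination ((deriv κ (Real.log ‖z‖) : ℝ) : ℂ) * e

theorem dzbar_radial {κ : ℝ → ℝ} {z : ℂ} (hz : z ≠ 0)
    (hκ : DifferentiableAt ℝ κ (Real.log ‖z‖)) :
    dzbar (fun w : ℂ => (κ (Real.log ‖w‖) : ℂ)) z = (deriv κ (Real.log ‖z‖) : ℝ) / (2 * conj z) := by
  simp only [dzbar, dx, dy, fderiv_radial hz hκ]
  have h : ((‖z‖ ^ 2 : ℝ) : ℂ) = z * conj z := by rw [Complex.mul_conj, Complex.normSq_eq_norm_sq]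
  push_cast at h ⊢
  have hc : conj z ≠ 0 := (map_ne_zero _).2 hz
  rw [h, mul_one]
  have e : ((conj z).re : ℂ) + Complex.I * ((conj z * Complex.I).re : ℂ) = z := by
    apply Complex.ext <;> simp
  field_simp
  linear_combination ((deriv κ (Real.log ‖z‖) : ℝ) : ℂ) * e

/-- The function `r ^ a`, written as `exp (a log r)`. -/
def rpw (a : ℝ) (z : ℂ) : ℂ := (Real.exp (a * Real.log ‖z‖) : ℂ)

theorem rpw_smoothOff (a : ℝ) : SmoothOff (rpw a) :=
  SmoothOff.radial (κ := fun t => Real.exp (a * t)) (by fun_prop)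

theorem rpw_ne_zero (a : ℝ) (z : ℂ) : rpw a z ≠ 0 := by simp [rpw]

theorem rpw_eq (a : ℝ) {z : ℂ} (hz : z ≠ 0) : rpw a z = (‖z‖ ^ a : ℝ) := by
  rw [rpw, Real.rpow_def_of_pos (norm_pos_iff.2 hz), mul_comm]

theorem norm_rpw (a : ℝ) {z : ℂ} (hz : z ≠ 0) : ‖rpw a z‖ = ‖z‖ ^ a := by
  rw [rpw_eq a hz, Complex.norm_real, Real.norm_of_nonneg (by positivity)]

theorem conj_rpw (a : ℝ) (z : ℂ) : conj (rpw a z) = rpw a z := Complex.conj_ofReal _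

theorem rpw_add (a b : ℝ) (z : ℂ) : rpw (a + b) z = rpw a z * rpw b z := by
  simp only [rpw]; rw [add_mul, Real.exp_add]; push_cast; rfl

theorem rpw_zero (z : ℂ) : rpw 0 z = 1 := by simp [rpw]

theorem deriv_exp_mul (a t : ℝ) : deriv (fun t => Real.exp (a * t)) t = a * Real.exp (a * t) := by
  have h : HasDerivAt (fun t => Real.exp (a * t)) (Real.exp (a * t) * (a * 1)) t :=
    ((hasDerivAt_id t).const_mul a).exp
  rw [h.deriv]; ring

theorem dz_rpw (a : ℝ) {z : ℂ} (hz : z ≠ 0) : dz (rpw a) z = a / (2 * z) * rpw a z := by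
  have h := dz_radial (κ := fun t => Real.exp (a * t)) hz (by fun_prop)
  rw [deriv_exp_mul] at h
  refine h.trans ?_
  simp only [rpw]; push_cast; ring

theorem dzbar_rpw (a : ℝ) {z : ℂ} (hz : z ≠ 0) :
    dzbar (rpw a) z = a / (2 * conj z) * rpw a z := by
  have h := dzbar_radial (κ := fun t => Real.exp (a * t)) hz (by fun_prop)
  rw [deriv_exp_mul] at h
  refine h.trans ?_
  simp only [rpw]; push_cast; ring

/-! ## The first-order factors of the Hamiltonian -/

/-- The twisted derivative `e^{-iβθ} ∂_z e^{iβθ} = ∂_z + β / (2z)`. -/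
def Tz (β : ℝ) (f : ℂ → ℂ) (z : ℂ) : ℂ := dz f z + β / (2 * z) * f z

/-- The twisted derivative `e^{-iβθ} ∂_z̄ e^{iβθ} = ∂_z̄ - β / (2z̄)`. -/
def Tzb (β : ℝ) (f : ℂ → ℂ) (z : ℂ) : ℂ := dzbar f z - β / (2 * conj z) * f z

theorem smoothOff_coef (β : ℝ) : SmoothOff fun z => (β : ℂ) / (2 * z) :=
  (SmoothOff.const _).div ((SmoothOff.const 2).mul .id) fun z hz => by simpa using hz

theorem smoothOff_coef_conj (β : ℝ) : SmoothOff fun z => (β : ℂ) / (2 * conj z) :=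
  (SmoothOff.const _).div ((SmoothOff.const 2).mul SmoothOff.id.star) fun z hz => by simpa using hz

theorem SmoothOff.Tz {f : ℂ → ℂ} (hf : SmoothOff f) (β : ℝ) : SmoothOff (Tz β f) :=
  hf.dz.add ((smoothOff_coef β).mul hf)

theorem SmoothOff.Tzb {f : ℂ → ℂ} (hf : SmoothOff f) (β : ℝ) : SmoothOff (Tzb β f) :=
  hf.dzbar.sub ((smoothOff_coef_conj β).mul hf)

theorem Tz_mul (β : ℝ) {f g : ℂ → ℂ} {z : ℂ} (hf : DifferentiableAt ℝ f z)
    (hg : DifferentiableAt ℝ g z) :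
    Tz β (fun w => f w * g w) z = dz f z * g z + f z * Tz β g z := by
  simp only [Tz, dz_mul hf hg]; ring

theorem Tzb_mul (β : ℝ) {f g : ℂ → ℂ} {z : ℂ} (hf : DifferentiableAt ℝ f z)
    (hg : DifferentiableAt ℝ g z) :
    Tzb β (fun w => f w * g w) z = dzbar f z * g z + f z * Tzb β g z := by
  simp only [Tzb, dzbar_mul hf hg]; ring

theorem Tz_add (β : ℝ) {f g : ℂ → ℂ} {z : ℂ} (hf : DifferentiableAt ℝ f z)
    (hg : DifferentiableAt ℝ g z) :
    Tz β (fun w => f w + g w) z = Tz β f z + Tz β g z := by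
  simp only [Tz, dz_add hf hg]; ring

theorem Tzb_add (β : ℝ) {f g : ℂ → ℂ} {z : ℂ} (hf : DifferentiableAt ℝ f z)
    (hg : DifferentiableAt ℝ g z) :
    Tzb β (fun w => f w + g w) z = Tzb β f z + Tzb β g z := by
  simp only [Tzb, dzbar_add hf hg]; ring

theorem Tz_conj (β : ℝ) {f : ℂ → ℂ} {z : ℂ} (hf : DifferentiableAt ℝ f z) :
    Tz β (fun w => conj (f w)) z = conj (Tzb (-β) f z) := by
  simp only [Tz, Tzb, dz_conj hf]; simp [neg_div, map_ofNat]

theorem Tz_congr (β : ℝ) {f g : ℂ → ℂ} {z : ℂ} (h : f =ᶠ[𝓝 z] g) : Tz β f z = Tz β g z := by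
  simp only [Tz, dz_congr h, h.eq_of_nhds]

theorem Tzb_congr (β : ℝ) {f g : ℂ → ℂ} {z : ℂ} (h : f =ᶠ[𝓝 z] g) : Tzb β f z = Tzb β g z := by
  simp only [Tzb, dzbar_congr h, h.eq_of_nhds]

/-- The coefficient β/(2z) is holomorphic and β/(2z̄) antiholomorphic off the origin, so no
derivative of a coefficient appears in the commutator: the field is zero there. -/
theorem Tz_Tzb_comm (β : ℝ) {f : ℂ → ℂ} (hf : SmoothOff f) {z : ℂ} (hz : z ≠ 0) :
    Tz β (Tzb β f) z = Tzb β (Tz β f) z := by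
  have h1 : Tz β (Tzb β f) z = Tz β (dzbar f) z +
      Tz β (fun w => -(β / (2 * conj w)) * f w) z := by
    rw [← Tz_add β (hf.dzbar.differentiableAt hz)]
    · congr 1; funext w; simp only [Tzb]; ring
    · exact ((smoothOff_coef_conj β).differentiableAt hz).fun_neg.fun_mul (hf.differentiableAt hz)
  have h2 : Tzb β (Tz β f) z = Tzb β (dz f) z + Tzb β (fun w => (β / (2 * w)) * f w) z := by
    rw [← Tzb_add β (hf.dz.differentiableAt hz)]
    · rfl
    · exact ((smoothOff_coef β).differentiableAt hz).mul (hf.differentiableAt hz)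
  have h3 : HasDerivAt (fun w : ℂ => (β : ℂ) / (2 * w)) (-(β / (2 * z ^ 2))) z := by
    have := ((hasDerivAt_id z).const_mul 2).inv (by simpa using hz) |>.const_mul (β : ℂ)
    refine this.congr_deriv ?_
    simp only [id]; field_simp
  have h5 : dz (fun w => -((β : ℂ) / (2 * conj w))) z = 0 := by
    have : (fun w => -((β : ℂ) / (2 * conj w))) = fun w => conj (-((β : ℂ) / (2 * w))) := by
      funext w; simp [map_ofNat]
    rw [this, dz_conj (((smoothOff_coef β).differentiableAt hz).fun_neg), (hasDerivAt_dz h3.fun_neg).2]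
    simp
  rw [h1, h2, Tz_mul β ((smoothOff_coef_conj β).differentiableAt hz).fun_neg (hf.differentiableAt hz),
    Tzb_mul β ((smoothOff_coef β).differentiableAt hz) (hf.differentiableAt hz), h5,
    (hasDerivAt_dz h3).2]
  simp only [Tz, Tzb, dz_dzbar_comm (hf.contDiffAt_two hz)]
  ring

/-! ## The factors as operators on test functions -/

theorem Test.zero_near {f : ℂ → ℂ} (hf : f ∈ Test) : f =ᶠ[𝓝 0] fun _ => 0 :=
  notMem_tsupport_iff_eventuallyEq.1 hf.2.2

theorem Test.apply_zero {f : ℂ → ℂ} (hf : f ∈ Test) : f 0 = 0 := (Test.zero_near hf).eq_of_nhds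

theorem Test.dz {f : ℂ → ℂ} (hf : f ∈ Test) : dz f ∈ Test :=
  Test.smul_mem (1 / 2) (Test.sub_mem (Test.dir hf 1) (Test.smul_mem Complex.I (Test.dir hf _)))

theorem Test.dzbar {f : ℂ → ℂ} (hf : f ∈ Test) : dzbar f ∈ Test :=
  Test.smul_mem (1 / 2) (Test.add_mem (Test.dir hf 1) (Test.smul_mem Complex.I (Test.dir hf _)))

theorem Test.conj {f : ℂ → ℂ} (hf : f ∈ Test) : (fun z => conj (f z)) ∈ Test := by
  have hs : Function.support (fun z => conj (f z)) ⊆ Function.support f := by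
    intro z hz hz'
    exact hz (by simp [hz'])
  exact ⟨Complex.conjCLE.toContinuousLinearMap.contDiff.comp hf.1, hf.2.1.mono hs,
    fun h => hf.2.2 (closure_mono hs h)⟩

theorem Test.smoothOff_mul {f g : ℂ → ℂ} (hf : SmoothOff f) (hg : g ∈ Test) :
    (fun z => f z * g z) ∈ Test := Test.mul hg hf

theorem Test.Tz {f : ℂ → ℂ} (hf : f ∈ Test) (β : ℝ) : Tz β f ∈ Test :=
  Test.add_mem (Test.dz hf) (Test.mul hf (smoothOff_coef β))

theorem Test.Tzb {f : ℂ → ℂ} (hf : f ∈ Test) (β : ℝ) : Tzb β f ∈ Test :=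
  Test.sub_mem (Test.dzbar hf) (Test.mul hf (smoothOff_coef_conj β))

/-- `T_z` on test functions. -/
def tz (β : ℝ) : Test →ₗ[ℂ] Test where
  toFun φ := ⟨Tz β φ, Test.Tz φ.2 β⟩
  map_add' φ ψ := by
    ext z
    exact Tz_add β (Test.differentiableAt φ.2 z) (Test.differentiableAt ψ.2 z)
  map_smul' c φ := by
    ext z
    have := Tz_mul β (differentiableAt_const (x := z) c) (Test.differentiableAt φ.2 z)
    rw [dz_const, zero_mul, zero_add] at this
    exact this

/-- `T_z̄` on test functions. -/
def tzb (β : ℝ) : Test →ₗ[ℂ] Test where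
  toFun φ := ⟨Tzb β φ, Test.Tzb φ.2 β⟩
  map_add' φ ψ := by
    ext z
    exact Tzb_add β (Test.differentiableAt φ.2 z) (Test.differentiableAt ψ.2 z)
  map_smul' c φ := by
    ext z
    have := Tzb_mul β (differentiableAt_const (x := z) c) (Test.differentiableAt φ.2 z)
    rw [dzbar_const, zero_mul, zero_add] at this
    exact this

theorem tz_coe (β : ℝ) (φ : Test) : (tz β φ : ℂ → ℂ) = Tz β φ := rfl

theorem tzb_coe (β : ℝ) (φ : Test) : (tzb β φ : ℂ → ℂ) = Tzb β φ := rfl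

/-- Test functions vanish at the origin, where division by z has only a default value; identities
need to be checked elsewhere only. -/
theorem Test.ext_off {φ ψ : Test} (h : ∀ z, z ≠ 0 → (φ : ℂ → ℂ) z = (ψ : ℂ → ℂ) z) : φ = ψ := by
  ext z
  by_cases hz : z = 0
  · rw [hz, Test.apply_zero φ.2, Test.apply_zero ψ.2]
  · exact h z hz

theorem tz_tzb_comm (β : ℝ) (φ : Test) : tz β (tzb β φ) = tzb β (tz β φ) :=
  Test.ext_off fun _ hz => Tz_Tzb_comm β (Test.smoothOff φ.2) hz

theorem norm_sq_eq_mul_conj (z : ℂ) : ((z.re ^ 2 + z.im ^ 2 : ℝ) : ℂ) = z * conj z := by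
  rw [Complex.mul_conj, Complex.normSq_apply]; push_cast; ring

theorem coef_sub (α : ℝ) {z : ℂ} (hz : z ≠ 0) :
    (α : ℂ) / (2 * z) - α / (2 * conj z) =
      -Complex.I * (α * (z.im / (z.re ^ 2 + z.im ^ 2)) : ℝ) := by
  have hc : conj z ≠ 0 := (map_ne_zero _).2 hz
  have h := norm_sq_eq_mul_conj z
  push_cast at h ⊢
  rw [h]
  have e : conj z - z = -(2 * Complex.I * z.im) := by apply Complex.ext <;> simp; ring
  field_simp
  linear_combination (α : ℂ) * e

theorem coef_add (α : ℝ) {z : ℂ} (hz : z ≠ 0) :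
    (α : ℂ) / (2 * z) + α / (2 * conj z) = (α * (z.re / (z.re ^ 2 + z.im ^ 2)) : ℝ) := by
  have hc : conj z ≠ 0 := (map_ne_zero _).2 hz
  have h := norm_sq_eq_mul_conj z
  push_cast at h ⊢
  rw [h]
  have e : conj z + z = 2 * z.re := by apply Complex.ext <;> simp; ring
  field_simp
  linear_combination (α : ℂ) * e

theorem twistX_eq (α : ℝ) (f : ℂ → ℂ) {z : ℂ} (hz : z ≠ 0) :
    twistX α f z = Tz α f z + Tzb α f z := by
  simp only [twistX, Tz, Tzb, dz, dzbar]
  linear_combination -f z * coef_sub α hz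

theorem twistY_eq (α : ℝ) (f : ℂ → ℂ) {z : ℂ} (hz : z ≠ 0) :
    twistY α f z = Complex.I * (Tz α f z - Tzb α f z) := by
  simp only [twistY, Tz, Tzb, dz, dzbar]
  linear_combination -Complex.I * f z * coef_add α hz + dy f z * Complex.I_sq

theorem momX_eq (α : ℝ) (f : ℂ → ℂ) (z : ℂ) : momX α f z = -Complex.I * twistX α f z := by
  simp only [momX, twistX, potX, one_div, Complex.inv_I]
  push_cast
  linear_combination (-f z * α * (z.im / (z.re ^ 2 + z.im ^ 2))) * Complex.I_sq

theorem momY_eq (α : ℝ) (f : ℂ → ℂ) (z : ℂ) : momY α f z = -Complex.I * twistY α f z := by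
  simp only [momY, twistY, potY, one_div, Complex.inv_I]
  push_cast
  linear_combination (f z * α * (z.re / (z.re ^ 2 + z.im ^ 2))) * Complex.I_sq

theorem twist_eq (α a b : ℝ) (f : ℂ → ℂ) {z : ℂ} (hz : z ≠ 0) :
    twist α a b f z = (a + b * Complex.I) * Tz α f z + (a - b * Complex.I) * Tzb α f z := by
  rw [twist, twistX_eq α f hz, twistY_eq α f hz]; ring

theorem momX_test (α : ℝ) (φ : Test) :
    (⟨momX α φ, Test.momX φ.2⟩ : Test) = (-Complex.I) • (tz α φ + tzb α φ) := by
  refine Test.ext_off fun z hz => ?_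
  change momX α φ z = -Complex.I * (Tz α φ z + Tzb α φ z)
  rw [momX_eq, twistX_eq α _ hz]

theorem momY_test (α : ℝ) (φ : Test) :
    (⟨momY α φ, Test.momY φ.2⟩ : Test) = tz α φ - tzb α φ := by
  refine Test.ext_off fun z hz => ?_
  change momY α φ z = Tz α φ z - Tzb α φ z
  rw [momY_eq, twistY_eq α _ hz]
  linear_combination -(Tz α φ z - Tzb α φ z) * Complex.I_sq

/-- With S = T_z and S' = T_z̄ commuting, the momenta are -i(S + S') and S - S', and the sum of
their squares is -4 S S'. -/
theorem ham_eq (α : ℝ) (φ : Test) : ham α φ = (-4 : ℂ) • tzb α (tz α φ) := by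
  have h : ham α φ = (⟨momX α (⟨momX α φ, Test.momX φ.2⟩ : Test), Test.momX (Test.momX φ.2)⟩ : Test)
      + ⟨momY α (⟨momY α φ, Test.momY φ.2⟩ : Test), Test.momY (Test.momY φ.2)⟩ := rfl
  rw [h, momX_test α ⟨momX α φ, _⟩, momY_test α ⟨momY α φ, _⟩, momX_test, momY_test]
  simp only [map_smul, map_add, map_sub, tz_tzb_comm]
  have hI : Complex.I * Complex.I = -1 := Complex.I_mul_I
  match_scalars
  · linear_combination hI
  · linear_combination 2 * hI
  · linear_combination hI

theorem ham_eq' (α : ℝ) (φ : Test) : ham α φ = (-4 : ℂ) • tz α (tzb α φ) := by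
  rw [ham_eq, tz_tzb_comm]

theorem twistTest_eq (α a b : ℝ) (φ : Test) : twistTest α a b φ =
    (a + b * Complex.I : ℂ) • tz α φ + (a - b * Complex.I : ℂ) • tzb α φ :=
  Test.ext_off fun _ hz => twist_eq α a b φ hz

/-! ## Integration by parts and pairings -/

theorem integrable_test {f : ℂ → ℂ} (hf : f ∈ Test) : Integrable f (volume : Measure ℂ) :=
  hf.1.continuous.integrable_of_hasCompactSupport hf.2.1

theorem integral_dz_eq_zero {f : ℂ → ℂ} (hf : f ∈ Test) : ∫ z, dz f z = 0 := by
  have h : ∀ v, Integrable (fun z => fderiv ℝ f z v) (volume : Measure ℂ) := fun v =>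
    integrable_test (Test.dir hf v)
  simp only [AharonovBohm.dz, dx, dy]
  rw [integral_const_mul, integral_sub (h 1) ((h _).const_mul _), integral_const_mul,
    integral_dir_eq_zero hf, integral_dir_eq_zero hf]
  simp

theorem integral_dzbar_eq_zero {f : ℂ → ℂ} (hf : f ∈ Test) : ∫ z, dzbar f z = 0 := by
  have h : ∀ v, Integrable (fun z => fderiv ℝ f z v) (volume : Measure ℂ) := fun v =>
    integrable_test (Test.dir hf v)
  simp only [AharonovBohm.dzbar, dx, dy]
  rw [integral_const_mul, integral_add (h 1) ((h _).const_mul _), integral_const_mul,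
    integral_dir_eq_zero hf, integral_dir_eq_zero hf]
  simp

theorem ae_ne_zero : ∀ᵐ z ∂(volume : Measure ℂ), z ≠ 0 :=
  measure_eq_zero_iff_ae_notMem.1 (measure_singleton (0 : ℂ))

theorem Test.conj_mul_smooth {φ f : ℂ → ℂ} (hφ : φ ∈ Test) (hf : SmoothOff f) :
    (fun z => conj (φ z) * f z) ∈ Test := by
  have := Test.mul (Test.conj hφ) hf
  simpa only [mul_comm] using this

/-- The formal adjoint of T_z̄ is -T_z. Since φ vanishes near 0, f may have any singularity at the
origin; this is what allows the singular functions r^{-α} and r^α/z in place of f. -/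
theorem Tzb_parts (β : ℝ) (φ : Test) {f : ℂ → ℂ} (hf : SmoothOff f) :
    ∫ z, conj (Tzb β φ z) * f z = -∫ z, conj ((φ : ℂ → ℂ) z) * Tz β f z := by
  rw [← sub_eq_zero, sub_neg_eq_add,
    ← integral_add (integrable_test (Test.conj_mul_smooth (Test.Tzb φ.2 β) hf))
      (integrable_test (Test.conj_mul_smooth φ.2 (hf.Tz β))),
    ← integral_dz_eq_zero (Test.conj_mul_smooth φ.2 hf)]
  refine integral_congr_ae (ae_ne_zero.mono fun z hz => ?_)
  have hφ := Test.differentiableAt φ.2 z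
  simp only [AharonovBohm.Tz, AharonovBohm.Tzb,
    dz_mul (differentiableAt_conj hφ) (hf.differentiableAt hz), dz_conj hφ]
  simp [map_ofNat]
  ring

theorem Tz_parts (β : ℝ) (φ : Test) {f : ℂ → ℂ} (hf : SmoothOff f) :
    ∫ z, conj (Tz β φ z) * f z = -∫ z, conj ((φ : ℂ → ℂ) z) * Tzb β f z := by
  rw [← sub_eq_zero, sub_neg_eq_add,
    ← integral_add (integrable_test (Test.conj_mul_smooth (Test.Tz φ.2 β) hf))
      (integrable_test (Test.conj_mul_smooth φ.2 (hf.Tzb β))),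
    ← integral_dzbar_eq_zero (Test.conj_mul_smooth φ.2 hf)]
  refine integral_congr_ae (ae_ne_zero.mono fun z hz => ?_)
  have hφ := Test.differentiableAt φ.2 z
  simp only [AharonovBohm.Tz, AharonovBohm.Tzb,
    dzbar_mul (differentiableAt_conj hφ) (hf.differentiableAt hz), dzbar_conj hφ]
  simp [map_ofNat]
  ring

theorem toL2_coe (φ : Test) : (toL2 φ : ℂ → ℂ) =ᵐ[volume] (φ : ℂ → ℂ) :=
  MemLp.coeFn_toLp (Test.memLp φ)

theorem inner_toL2_left (φ : Test) (u : L2) :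
    ⟪toL2 φ, u⟫_ℂ = ∫ z, conj ((φ : ℂ → ℂ) z) * u z := by
  rw [L2.inner_def]
  refine integral_congr_ae ((toL2_coe φ).mono fun z h => ?_)
  change ⟪toL2 φ z, u z⟫_ℂ = _
  rw [h, RCLike.inner_apply, mul_comm]

theorem inner_toLp_right (φ : Test) {f : ℂ → ℂ} (hf : MemLp f 2 (volume : Measure ℂ)) :
    ⟪toL2 φ, hf.toLp⟫_ℂ = ∫ z, conj ((φ : ℂ → ℂ) z) * f z := by
  rw [inner_toL2_left]
  exact integral_congr_ae (hf.coeFn_toLp.mono fun z h => by simp only [h])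

theorem inner_tzb (β : ℝ) (φ ψ : Test) : ⟪toL2 (tzb β φ), toL2 ψ⟫_ℂ = -⟪toL2 φ, toL2 (tz β ψ)⟫_ℂ := by
  rw [inner_toL2, inner_toL2]
  exact Tzb_parts β φ (Test.smoothOff ψ.2)

theorem inner_tz (β : ℝ) (φ ψ : Test) : ⟪toL2 (tz β φ), toL2 ψ⟫_ℂ = -⟪toL2 φ, toL2 (tzb β ψ)⟫_ℂ := by
  rw [inner_toL2, inner_toL2]
  exact Tz_parts β φ (Test.smoothOff ψ.2)

/-- The two operators commute and are adjoint up to sign, so T_z is normal. The form is thus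
controlled by either derivative alone. -/
theorem norm_tzb (β : ℝ) (φ : Test) : ‖toL2 (tzb β φ)‖ = ‖toL2 (tz β φ)‖ := by
  have h : ⟪toL2 (tzb β φ), toL2 (tzb β φ)⟫_ℂ = ⟪toL2 (tz β φ), toL2 (tz β φ)⟫_ℂ := by
    rw [inner_tzb, inner_tz, tz_tzb_comm]
  rw [inner_self_eq_norm_sq_to_K, inner_self_eq_norm_sq_to_K] at h
  have h' : ‖toL2 (tzb β φ)‖ ^ 2 = ‖toL2 (tz β φ)‖ ^ 2 := by exact_mod_cast h
  exact (sq_eq_sq₀ (norm_nonneg _) (norm_nonneg _)).1 h'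

theorem form_eq_tz (α : ℝ) (φ : Test) : form α φ = 4 * ‖toL2 (tz α φ)‖ ^ 2 := by
  have h : ⟪toL2 (ham α φ), toL2 φ⟫_ℂ = 4 * ⟪toL2 (tz α φ), toL2 (tz α φ)⟫_ℂ := by
    rw [ham_eq, map_smul, inner_smul_left, inner_tzb]
    simp [map_ofNat]
  rw [form, h, inner_self_eq_norm_sq_to_K]
  simp [← Complex.ofReal_pow]

theorem locallyIntegrable_of_memLp {f : ℂ → ℂ} (hf : MemLp f 2 (volume : Measure ℂ)) :
    LocallyIntegrable f (volume : Measure ℂ) := hf.locallyIntegrable (by norm_num)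

/-- The fundamental lemma of the calculus of variations on the punctured plane suffices, because the
origin is a null set. -/
theorem ae_eq_zero_of_test {f : ℂ → ℂ} (hf : LocallyIntegrable f (volume : Measure ℂ))
    (h : ∀ φ : Test, ∫ z, conj ((φ : ℂ → ℂ) z) * f z = 0) : f =ᵐ[volume] 0 := by
  have h1 := (isOpen_compl_singleton (x := (0 : ℂ))).ae_eq_zero_of_integral_contDiff_smul_eq_zero
    (μ := (volume : Measure ℂ)) (f := f) (hf.locallyIntegrableOn _) ?_
  · filter_upwards [h1, ae_ne_zero] with z hz hz0
    exact hz hz0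
  · intro g hg hg1 hg2
    have hs : Function.support (fun z => (g z : ℂ)) ⊆ Function.support g := by
      intro z hz hz'
      exact hz (by simp [hz'])
    have hT : (fun z => (g z : ℂ)) ∈ Test :=
      ⟨Complex.ofRealCLM.contDiff.comp hg, hg1.mono hs, fun h0 => hg2 (closure_mono hs h0) rfl⟩
    simpa using h ⟨_, hT⟩

theorem L2_ext {u v : L2} (h : ∀ φ : Test, ⟪toL2 φ, u⟫_ℂ = ⟪toL2 φ, v⟫_ℂ) : u = v := by
  rw [← sub_eq_zero, Lp.eq_zero_iff_ae_eq_zero]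
  refine ae_eq_zero_of_test (locallyIntegrable_of_memLp (Lp.memLp _)) fun φ => ?_
  rw [← inner_toL2_left, inner_sub_right, h, sub_self]

/-! ## A Hardy inequality for non-integer flux -/

/-- Cauchy–Schwarz against the constant function 1. -/
theorem sq_lintegral_le {X : Type*} [MeasurableSpace X] (μ : Measure X) {f : X → ENNReal}
    (hf : AEMeasurable f μ) : (∫⁻ x, f x ∂μ) ^ 2 ≤ μ Set.univ * ∫⁻ x, f x ^ 2 ∂μ := by
  have h := ENNReal.lintegral_mul_le_Lp_mul_Lq μ Real.HolderConjugate.two_two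
    (f := fun _ => 1) (g := f) aemeasurable_const hf
  simp only [Pi.mul_apply, one_mul, ENNReal.one_rpow, lintegral_one] at h
  calc (∫⁻ x, f x ∂μ) ^ 2
      ≤ ((μ Set.univ) ^ (1 / (2 : ℝ)) * (∫⁻ x, f x ^ (2 : ℝ) ∂μ) ^ (1 / (2 : ℝ))) ^ 2 := by
        gcongr
    _ = μ Set.univ * ∫⁻ x, f x ^ 2 ∂μ := by
        have e : ∀ x : ENNReal, (x ^ (1 / (2 : ℝ))) ^ 2 = x := fun x => by
          rw [← ENNReal.rpow_natCast, ← ENNReal.rpow_mul]; norm_num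
        rw [mul_pow, e, e]
        simp only [ENNReal.rpow_two]

theorem lintegral_rotate (s : ℝ) {F : ℂ → ENNReal} (hF : Measurable F) :
    ∫⁻ z, F (Complex.exp (s * Complex.I) * z) = ∫⁻ z, F z := by
  have h := (rotation (Circle.exp s)).measurePreserving.lintegral_comp hF
  simpa using h

/-- The function s ↦ e^{iβs} φ(e^{is} z) has the integrand on the right as its derivative, and a
full turn multiplies it by e^{2πiβ}. For β not an integer this recovers φ from its angular
derivative, which is the source of Hardy's inequality. -/
theorem rotation_identity (β : ℝ) (φ : Test) (z : ℂ) :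
    (Complex.exp (β * (2 * Real.pi) * Complex.I) - 1) * (φ : ℂ → ℂ) z =
      ∫ s in (0 : ℝ)..(2 * Real.pi), Complex.I * Complex.exp (β * s * Complex.I) *
        ((Complex.exp (s * Complex.I) * z) * Tz β φ (Complex.exp (s * Complex.I) * z) -
          conj (Complex.exp (s * Complex.I) * z) * Tzb β φ (Complex.exp (s * Complex.I) * z)) := by
  have hd : ∀ s : ℝ, HasDerivAt (fun s : ℝ => Complex.exp (β * s * Complex.I) *
      (φ : ℂ → ℂ) (Complex.exp (s * Complex.I) * z))
      (Complex.I * Complex.exp (β * s * Complex.I) *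
        ((Complex.exp (s * Complex.I) * z) * Tz β φ (Complex.exp (s * Complex.I) * z) -
          conj (Complex.exp (s * Complex.I) * z) *
            Tzb β φ (Complex.exp (s * Complex.I) * z))) s := by
    intro s
    have h1 : HasDerivAt (fun s : ℝ => (s : ℂ)) 1 s := Complex.ofRealCLM.hasDerivAt
    have h2 := ((h1.const_mul (β : ℂ)).mul_const Complex.I).cexp
    have h3 := ((h1.mul_const Complex.I).cexp).mul_const z
    have h4 := (Test.differentiableAt φ.2 (Complex.exp (s * Complex.I) * z)).hasFDerivAt
    have h5 := h4.comp_hasDerivAt s h3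
    refine (h2.mul h5).congr_deriv ?_
    set w := Complex.exp (s * Complex.I) * z with hw
    by_cases hw0 : w = 0
    · simp [hw0, Test.apply_zero φ.2, ← hw]
      have : Complex.exp (s * Complex.I) * Complex.I * z = 0 := by
        rw [mul_right_comm, ← hw, hw0, zero_mul]
      rw [this, map_zero]
    · have e : Complex.exp (s * Complex.I) * (1 * Complex.I) * z = Complex.I * w := by rw [hw]; ring
      have hc : conj w ≠ 0 := (map_ne_zero _).2 hw0
      rw [e, fderiv_eq_dz_dzbar]
      simp only [Tz, Tzb, Function.comp_def, ← hw, map_mul, Complex.conj_I]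
      field_simp
      ring
  have hcont : Continuous fun s : ℝ => Complex.I * Complex.exp (β * s * Complex.I) *
        ((Complex.exp (s * Complex.I) * z) * Tz β φ (Complex.exp (s * Complex.I) * z) -
          conj (Complex.exp (s * Complex.I) * z) *
            Tzb β φ (Complex.exp (s * Complex.I) * z)) := by
    have h1 : Continuous (Tz β φ) := (Test.Tz φ.2 β).1.continuous
    have h2 : Continuous (Tzb β φ) := (Test.Tzb φ.2 β).1.continuous
    have h3 : Continuous fun s : ℝ => conj (Complex.exp (s * Complex.I) * z) :=
      Complex.continuous_conj.comp (by fun_prop)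
    fun_prop
  rw [intervalIntegral.integral_eq_sub_of_hasDerivAt (fun s _ => hd s)
    (hcont.intervalIntegrable _ _)]
  simp [Complex.exp_two_pi_mul_I]
  ring

theorem exp_flux_ne_one {β : ℝ} (hβ : ∀ n : ℤ, β ≠ n) :
    Complex.exp (β * (2 * Real.pi) * Complex.I) - 1 ≠ 0 := by
  intro h
  obtain ⟨n, hn⟩ := Complex.exp_eq_one_iff.1 (sub_eq_zero.1 h)
  apply hβ n
  have h2 : (2 * Real.pi * Complex.I : ℂ) ≠ 0 := Complex.two_pi_I_ne_zero
  have h3 : (β : ℂ) * (2 * Real.pi * Complex.I) = n * (2 * Real.pi * Complex.I) := by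
    rw [← hn]; ring
  exact_mod_cast mul_right_cancel₀ h2 h3

/-- Hardy's inequality with an arbitrary radial weight. -/
theorem hardy {β : ℝ} (hβ : ∀ n : ℤ, β ≠ n) : ∃ C : ENNReal, C ≠ ⊤ ∧
    ∀ (φ : Test) (m : ℝ → ENNReal), Measurable m →
      ∫⁻ z, m ‖z‖ * ‖(φ : ℂ → ℂ) z‖ₑ ^ 2 ≤
        C * ∫⁻ z, m ‖z‖ * ‖z‖ₑ ^ 2 * (‖Tz β φ z‖ₑ ^ 2 + ‖Tzb β φ z‖ₑ ^ 2) := by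
  set κ := Complex.exp (β * (2 * Real.pi) * Complex.I) - 1 with hκ
  have hκ0 : κ ≠ 0 := exp_flux_ne_one hβ
  have hκe : ‖κ‖ₑ ^ 2 ≠ 0 := by simpa using hκ0
  have hκt : ‖κ‖ₑ ^ 2 ≠ ⊤ := by simp
  set ν := (volume : Measure ℝ).restrict (Set.Ioc 0 (2 * Real.pi)) with hν
  have hνt : ν Set.univ ≠ ⊤ := measure_ne_top _ _
  refine ⟨(‖κ‖ₑ ^ 2)⁻¹ * (ν Set.univ * (2 * ν Set.univ)), ?_, fun φ m hm => ?_⟩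
  · exact ENNReal.mul_ne_top (by simpa using hκ0)
      (ENNReal.mul_ne_top hνt (ENNReal.mul_ne_top (by simp) hνt))
  have hc1 : Continuous (Tz β φ) := (Test.Tz φ.2 β).1.continuous
  have hc2 : Continuous (Tzb β φ) := (Test.Tzb φ.2 β).1.continuous
  set G : ℂ → ENNReal := fun z => ‖Tz β φ z‖ₑ ^ 2 + ‖Tzb β φ z‖ₑ ^ 2 with hG
  have hGm : Measurable G := by
    have := hc1.enorm.measurable
    have := hc2.enorm.measurable
    fun_prop
  have hmn : Measurable fun z : ℂ => m ‖z‖ * ‖z‖ₑ ^ 2 :=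
    (hm.comp measurable_norm).mul (measurable_enorm.pow_const 2)
  have hrot : ∀ (s : ℝ) (z : ℂ), ‖Complex.exp (s * Complex.I) * z‖ = ‖z‖ := fun s z => by
    rw [norm_mul, Complex.norm_exp_ofReal_mul_I, one_mul]
  have hrot' : ∀ (s : ℝ) (z : ℂ), ‖Complex.exp (s * Complex.I) * z‖ₑ = ‖z‖ₑ := fun s z => by
    rw [← ofReal_norm, ← ofReal_norm, hrot]
  -- Pointwise version: `rotation_identity` and Cauchy–Schwarz in s bound φ(z) by the mean of the
  -- squared derivatives over the circle through z.
  have key : ∀ z : ℂ, ‖κ‖ₑ ^ 2 * ‖(φ : ℂ → ℂ) z‖ₑ ^ 2 ≤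
      ν Set.univ * ∫⁻ s, 2 * (‖z‖ₑ ^ 2 * G (Complex.exp (s * Complex.I) * z)) ∂ν := by
    intro z
    have hmeas : Continuous fun s : ℝ => Complex.exp (s * Complex.I) * z := by fun_prop
    calc ‖κ‖ₑ ^ 2 * ‖(φ : ℂ → ℂ) z‖ₑ ^ 2 = ‖κ * (φ : ℂ → ℂ) z‖ₑ ^ 2 := by
          rw [enorm_mul, mul_pow]
      _ ≤ (∫⁻ s, ‖z‖ₑ * (‖Tz β φ (Complex.exp (s * Complex.I) * z)‖ₑ +
            ‖Tzb β φ (Complex.exp (s * Complex.I) * z)‖ₑ) ∂ν) ^ 2 := by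
          rw [hκ, rotation_identity, intervalIntegral.integral_of_le (by positivity)]
          gcongr
          refine (enorm_integral_le_lintegral_enorm _).trans (lintegral_mono fun s => ?_)
          have e1 : ‖Complex.exp (β * s * Complex.I)‖ₑ = 1 := by
            rw [← ofReal_norm, ← Complex.ofReal_mul, Complex.norm_exp_ofReal_mul_I]; simp
          have e2 : ‖Complex.I‖ₑ = 1 := by rw [← ofReal_norm]; simp
          have e3 : ∀ w : ℂ, ‖conj w‖ₑ = ‖w‖ₑ := fun w => by
            rw [← ofReal_norm, ← ofReal_norm, Complex.norm_conj]
          rw [enorm_mul, enorm_mul, e1, e2, one_mul, one_mul]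
          refine (enorm_sub_le).trans (le_of_eq ?_)
          rw [enorm_mul _ (Tz _ _ _), enorm_mul _ (Tzb _ _ _), e3, hrot', mul_add]
      _ ≤ ν Set.univ * ∫⁻ s, (‖z‖ₑ * (‖Tz β φ (Complex.exp (s * Complex.I) * z)‖ₑ +
            ‖Tzb β φ (Complex.exp (s * Complex.I) * z)‖ₑ)) ^ 2 ∂ν :=
          sq_lintegral_le ν (((hc1.comp hmeas).enorm.measurable.add
            (hc2.comp hmeas).enorm.measurable).const_mul _).aemeasurable
      _ ≤ _ := by
          gcongr with s
          rw [mul_pow, mul_left_comm]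
          gcongr
          have h := ENNReal.rpow_add_le_mul_rpow_add_rpow
            ‖Tz β φ (Complex.exp (s * Complex.I) * z)‖ₑ
            ‖Tzb β φ (Complex.exp (s * Complex.I) * z)‖ₑ (p := 2) (by norm_num)
          norm_num at h
          exact h
  have hjoint : Measurable fun p : ℂ × ℝ =>
      m ‖p.1‖ * ‖p.1‖ₑ ^ 2 * G (Complex.exp (p.2 * Complex.I) * p.1) := by
    have h1 : Measurable fun p : ℂ × ℝ => Complex.exp (p.2 * Complex.I) * p.1 :=
      (by fun_prop : Continuous fun p : ℂ × ℝ => Complex.exp (p.2 * Complex.I) * p.1).measurable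
    exact (hmn.comp measurable_fst).mul (hGm.comp h1)
  rw [mul_assoc (‖κ‖ₑ ^ 2)⁻¹, mul_comm (‖κ‖ₑ ^ 2)⁻¹, ← div_eq_mul_inv,
    ENNReal.le_div_iff_mul_le (Or.inl hκe) (Or.inl hκt), mul_comm, ← lintegral_const_mul' _ _ hκt]
  -- Integrate `key` in z and exchange the integrals. The weight is radial and Lebesgue measure is
  -- rotation invariant, so the integral over z does not depend on s.
  calc ∫⁻ z, ‖κ‖ₑ ^ 2 * (m ‖z‖ * ‖(φ : ℂ → ℂ) z‖ₑ ^ 2)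
      ≤ ∫⁻ z, ν Set.univ * (2 * ∫⁻ s, m ‖z‖ * ‖z‖ₑ ^ 2 * G (Complex.exp (s * Complex.I) * z) ∂ν) := by
        refine lintegral_mono fun z => ?_
        have h1 : Measurable fun s : ℝ => ‖z‖ₑ ^ 2 * G (Complex.exp (s * Complex.I) * z) :=
          (hGm.comp (by fun_prop : Continuous fun s : ℝ =>
            Complex.exp (s * Complex.I) * z).measurable).const_mul _
        calc _ = m ‖z‖ * (‖κ‖ₑ ^ 2 * ‖(φ : ℂ → ℂ) z‖ₑ ^ 2) := by ring
          _ ≤ m ‖z‖ * (ν Set.univ *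
              ∫⁻ s, 2 * (‖z‖ₑ ^ 2 * G (Complex.exp (s * Complex.I) * z)) ∂ν) := by
              exact mul_le_mul_right (key z) _
          _ = _ := by
              rw [lintegral_const_mul _ h1]
              simp only [mul_assoc (m ‖z‖)]
              rw [lintegral_const_mul _ h1]
              ring
    _ = ν Set.univ * (2 * ∫⁻ s : ℝ,
          (∫⁻ z : ℂ, m ‖z‖ * ‖z‖ₑ ^ 2 * G (Complex.exp (s * Complex.I) * z)) ∂ν) := by
        rw [lintegral_const_mul' _ _ hνt, lintegral_const_mul' _ _ (by simp),
          lintegral_lintegral_swap hjoint.aemeasurable]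
    _ = ν Set.univ * (2 * ∫⁻ s, (∫⁻ z, m ‖z‖ * ‖z‖ₑ ^ 2 * G z) ∂ν) := by
        congr 2
        refine lintegral_congr fun s => ?_
        have h := lintegral_rotate s (hmn.mul hGm)
        simpa only [Pi.mul_apply, hrot, hrot'] using h
    _ = _ := by
        rw [lintegral_const]; ring

theorem enorm_sq_eq_lintegral (u : L2) : ‖u‖ₑ ^ 2 = ∫⁻ z, ‖u z‖ₑ ^ 2 := by
  rw [Lp.enorm_def, eLpNorm_eq_lintegral_rpow_enorm_toReal (by norm_num) (by norm_num)]
  rw [← ENNReal.rpow_natCast, ← ENNReal.rpow_mul]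
  norm_num

theorem enorm_sq_toL2 (φ : Test) : ‖toL2 φ‖ₑ ^ 2 = ∫⁻ z, ‖(φ : ℂ → ℂ) z‖ₑ ^ 2 := by
  rw [enorm_sq_eq_lintegral]
  exact lintegral_congr_ae ((toL2_coe φ).mono fun z h => by simp only [h])

/-- Multiplication of test functions by a function that is smooth off the origin. -/
def mulT (g : ℂ → ℂ) (hg : SmoothOff g) (φ : Test) : Test := ⟨fun z => g z * φ.1 z, Test.mul φ.2 hg⟩

/-- Hardy's inequality with the weight r^{-2}; the two derivatives have equal norms, so one of them
suffices. -/
theorem hardy_norm {β : ℝ} (hβ : ∀ n : ℤ, β ≠ n) : ∃ C : ℝ, 0 ≤ C ∧ ∀ φ : Test,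
    ‖toL2 (mulT (rpw (-1)) (rpw_smoothOff _) φ)‖ ≤ C * ‖toL2 (tzb β φ)‖ := by
  obtain ⟨C, hC, h⟩ := hardy hβ
  refine ⟨Real.sqrt (2 * C.toReal), by positivity, fun φ => ?_⟩
  have h1 := h φ (fun r => ENNReal.ofReal ((r ^ 2)⁻¹)) (by fun_prop)
  have h2 : ∀ᵐ z : ℂ, ENNReal.ofReal ((‖z‖ ^ 2)⁻¹) * ‖z‖ₑ ^ 2 = 1 := ae_ne_zero.mono fun z hz => by
    rw [← ofReal_norm z, ← ENNReal.ofReal_pow (norm_nonneg _), ← ENNReal.ofReal_mul (by positivity),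
      inv_mul_cancel₀ (by simpa using hz), ENNReal.ofReal_one]
  have h3 : ∫⁻ z, ENNReal.ofReal ((‖z‖ ^ 2)⁻¹) * ‖(φ : ℂ → ℂ) z‖ₑ ^ 2 =
      ‖toL2 (mulT (rpw (-1)) (rpw_smoothOff _) φ)‖ₑ ^ 2 := by
    rw [enorm_sq_toL2]
    refine lintegral_congr_ae (ae_ne_zero.mono fun z hz => ?_)
    simp only [mulT]
    rw [enorm_mul, mul_pow, ← ofReal_norm (rpw (-1) z), norm_rpw _ hz, Real.rpow_neg_one,
      ← ENNReal.ofReal_pow (by positivity), inv_pow]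
  have h4 : ∫⁻ z, ENNReal.ofReal ((‖z‖ ^ 2)⁻¹) * ‖z‖ₑ ^ 2 * (‖Tz β φ z‖ₑ ^ 2 + ‖Tzb β φ z‖ₑ ^ 2) =
      2 * ‖toL2 (tzb β φ)‖ₑ ^ 2 := by
    have e : ‖toL2 (tz β φ)‖ₑ ^ 2 = ‖toL2 (tzb β φ)‖ₑ ^ 2 := by
      rw [← ofReal_norm, ← ofReal_norm, norm_tzb]
    rw [two_mul, ← e]
    nth_rw 2 [e]
    have hm : Measurable fun z => ‖(tz β φ : ℂ → ℂ) z‖ₑ ^ 2 :=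
      (Test.Tz φ.2 β).1.continuous.enorm.measurable.pow_const 2
    rw [enorm_sq_toL2, enorm_sq_toL2, ← lintegral_add_left hm]
    exact lintegral_congr_ae (h2.mono fun z hz => by simp only [hz, one_mul]; rfl)
  rw [h3, h4] at h1
  rw [← sq_le_sq₀ (norm_nonneg _) (by positivity), mul_pow, Real.sq_sqrt (by positivity)]
  rw [← ofReal_norm, ← ofReal_norm, ← ENNReal.ofReal_toReal hC,
    ← ENNReal.ofReal_pow (norm_nonneg _), ← ENNReal.ofReal_pow (norm_nonneg _), two_mul,
    ← ENNReal.ofReal_add (by positivity) (by positivity),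
    ← ENNReal.ofReal_mul (by positivity), ENNReal.ofReal_le_ofReal_iff (by positivity)] at h1
  linarith

/-! ## The Cauchy transform -/

theorem locallyIntegrable_inv : LocallyIntegrable (fun z : ℂ => z⁻¹) (volume : Measure ℂ) := by
  refine locallyIntegrable_of_norm_le_rpow (C := 1) (α := 1) (by simp) (by simp) ?_ ?_
  · refine Filter.Eventually.of_forall fun z => ?_
    rw [norm_inv, one_mul, Real.rpow_neg_one]
  · exact measurable_inv.aestronglyMeasurable

/-- The Jacobian r turns ∂_z̄ f / z into (∂_r f + (i/r) ∂_θ f)/2, which has no singularity and is a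
sum of exact derivatives. -/
theorem polar_dzbar (f : ℂ → ℂ) {r : ℝ} (hr : r ≠ 0) (θ : ℝ) :
    (r : ℂ) * (dzbar f (r * Complex.exp (θ * Complex.I)) / (r * Complex.exp (θ * Complex.I))) =
      (1 / 2) * (fderiv ℝ f (r * Complex.exp (θ * Complex.I)) (Complex.exp (θ * Complex.I)) +
        Complex.I * fderiv ℝ f (r * Complex.exp (θ * Complex.I))
          (Complex.exp (θ * Complex.I) * Complex.I)) := by
  have hr' : (r : ℂ) ≠ 0 := by exact_mod_cast hr
  have he : Complex.exp (θ * Complex.I) ≠ 0 := Complex.exp_ne_zero _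
  have hc : conj (Complex.exp (θ * Complex.I)) * Complex.exp (θ * Complex.I) = 1 := by
    rw [mul_comm, Complex.mul_conj, Complex.normSq_eq_norm_sq, Complex.norm_exp_ofReal_mul_I]
    simp
  rw [fderiv_eq_dz_dzbar, fderiv_eq_dz_dzbar, map_mul, Complex.conj_I]
  set e := Complex.exp (θ * Complex.I)
  have hc' : conj e = e⁻¹ := eq_inv_of_mul_eq_one_left hc
  rw [hc']
  field_simp
  linear_combination (dzbar f (r * e) - dz f (r * e) * e ^ 2) * Complex.I_sq

/-- The Cauchy–Pompeiu formula at 0. In polar coordinates the radial derivative integrates to -f(0)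
along each ray, and the angular derivative to 0 along each circle. -/
theorem integral_dzbar_div {f : ℂ → ℂ} (hf : ContDiff ℝ 1 f) (hc : HasCompactSupport f) :
    ∫ z, dzbar f z / z = -(Real.pi : ℂ) * f 0 := by
  obtain ⟨R, hR0, hR⟩ : ∃ R : ℝ, 0 < R ∧ ∀ z, R ≤ ‖z‖ → f z = 0 := by
    obtain ⟨R, hR⟩ := hc.isBounded.subset_ball 0
    refine ⟨max R 1, by positivity, fun z hz => ?_⟩
    by_contra h
    have := hR (subset_tsupport f h)
    rw [mem_ball_zero_iff] at this
    exact absurd (le_max_left R 1) (by linarith)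
  have hfd : Continuous (fderiv ℝ f) := hf.continuous_fderiv (by simp)
  set w : ℝ × ℝ → ℂ := fun p => p.1 * Complex.exp (p.2 * Complex.I) with hw
  have hwc : Continuous w := by fun_prop
  set A : ℝ × ℝ → ℂ := fun p => fderiv ℝ f (w p) (Complex.exp (p.2 * Complex.I)) with hA
  set B : ℝ × ℝ → ℂ := fun p => fderiv ℝ f (w p) (Complex.exp (p.2 * Complex.I) * Complex.I) with hB
  have hAc : Continuous A := (hfd.comp hwc).clm_apply (by fun_prop)
  have hBc : Continuous B := (hfd.comp hwc).clm_apply (by fun_prop)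
  have hzero : ∀ p : ℝ × ℝ, R < p.1 → fderiv ℝ f (w p) = 0 := by
    intro p hp
    have hn : R < ‖w p‖ := by
      rw [hw]; simp only [norm_mul, Complex.norm_exp_ofReal_mul_I, mul_one, Complex.norm_real]
      exact hp.trans_le (le_abs_self _)
    have : f =ᶠ[𝓝 (w p)] fun _ => 0 := by
      filter_upwards [(isOpen_lt continuous_const continuous_norm).mem_nhds hn] with z hz
      exact hR z (le_of_lt hz)
    rw [this.fderiv_eq]; simp
  have hint : ∀ F : ℝ × ℝ → ℂ, Continuous F → (∀ p : ℝ × ℝ, R < p.1 → F p = 0) →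
      IntegrableOn F (Set.Ioi 0 ×ˢ Set.Ioo (-Real.pi) Real.pi) := by
    intro F hF h0
    have h1 : IntegrableOn F (Set.Icc 0 R ×ˢ Set.Icc (-Real.pi) Real.pi) :=
      hF.continuousOn.integrableOn_compact (isCompact_Icc.prod isCompact_Icc)
    refine h1.of_forall_sdiff_eq_zero (measurableSet_Ioi.prod measurableSet_Ioo) ?_
    rintro p ⟨hp1, hp2⟩
    apply h0
    by_contra h
    exact hp2 ⟨⟨le_of_lt hp1.1, not_lt.1 h⟩, ⟨le_of_lt hp1.2.1, le_of_lt hp1.2.2⟩⟩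
  have hAi := hint A hAc fun p hp => by simp [hA, hzero p hp]
  have hBi := hint B hBc fun p hp => by simp [hB, hzero p hp]
  have hdA : ∀ p : ℝ × ℝ, HasDerivAt (fun r : ℝ => f (r * Complex.exp (p.2 * Complex.I))) (A p) p.1 := by
    intro p
    have h1 : HasDerivAt (fun r : ℝ => (r : ℂ) * Complex.exp (p.2 * Complex.I))
        (1 * Complex.exp (p.2 * Complex.I)) p.1 := (Complex.ofRealCLM.hasDerivAt).mul_const _
    have := ((hf.differentiable (by simp)) (w p)).hasFDerivAt.comp_hasDerivAt p.1 h1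
    rwa [one_mul] at this
  have hdB : ∀ p : ℝ × ℝ, p.1 ≠ 0 → HasDerivAt
      (fun θ : ℝ => (p.1 : ℂ)⁻¹ * f (p.1 * Complex.exp (θ * Complex.I))) (B p) p.2 := by
    intro p hp
    have h0 : HasDerivAt (fun s : ℝ => (s : ℂ)) 1 p.2 := Complex.ofRealCLM.hasDerivAt
    have h1 := ((h0.mul_const Complex.I).cexp).const_mul (p.1 : ℂ)
    have h2 := (((hf.differentiable (by simp)) (w p)).hasFDerivAt.comp_hasDerivAt p.2 h1).const_mul
      (p.1 : ℂ)⁻¹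
    refine h2.congr_deriv ?_
    have hp' : (p.1 : ℂ) ≠ 0 := by exact_mod_cast hp
    have e : (p.1 : ℂ) * (Complex.exp (p.2 * Complex.I) * (1 * Complex.I)) =
        p.1 • (Complex.exp (p.2 * Complex.I) * Complex.I) := by rw [Complex.real_smul]; ring
    rw [e, map_smul, Complex.real_smul, ← mul_assoc, inv_mul_cancel₀ hp', one_mul]
  have hIA : ∫ p in Set.Ioi (0 : ℝ) ×ˢ Set.Ioo (-Real.pi) Real.pi, A p = -(2 * Real.pi : ℂ) * f 0 := by
    rw [Measure.volume_eq_prod, ← setIntegral_prod_swap,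
      setIntegral_prod (fun p : ℝ × ℝ => A p.swap) hAi.swap]
    have : ∀ θ : ℝ, ∫ r in Set.Ioi (0 : ℝ), A (r, θ) = -f 0 := by
      intro θ
      have h1 := integral_Ioi_of_hasDerivAt_of_tendsto' (a := 0) (m := 0)
        (f := fun r : ℝ => f (r * Complex.exp (θ * Complex.I))) (f' := fun r => A (r, θ))
        (fun r _ => hdA (r, θ)) ?_ ?_
      · simpa using h1
      · have h2 : IntegrableOn (fun r => A (r, θ)) (Set.Icc 0 R) :=
          (hAc.comp (by fun_prop)).continuousOn.integrableOn_compact isCompact_Icc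
        refine h2.of_forall_sdiff_eq_zero measurableSet_Ioi ?_
        rintro r ⟨hr1, hr2⟩
        simp only [hA]
        rw [hzero (r, θ) (not_le.1 fun h => hr2 ⟨le_of_lt hr1, h⟩)]; simp
      · refine tendsto_const_nhds.congr' ?_
        filter_upwards [eventually_ge_atTop R] with r hr
        refine (hR _ ?_).symm
        rw [norm_mul, Complex.norm_exp_ofReal_mul_I, mul_one, Complex.norm_real]
        exact hr.trans (le_abs_self _)
    simp only [Prod.swap_prod_mk, this]
    rw [setIntegral_const]
    have e : (volume : Measure ℝ).real (Set.Ioo (-Real.pi) Real.pi) = 2 * Real.pi := by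
      rw [Measure.real, Real.volume_Ioo, ENNReal.toReal_ofReal (by linarith [Real.pi_pos])]; ring
    rw [e, Complex.real_smul]
    push_cast; ring
  have hIB : ∫ p in Set.Ioi (0 : ℝ) ×ˢ Set.Ioo (-Real.pi) Real.pi, B p = 0 := by
    rw [Measure.volume_eq_prod, setIntegral_prod _ hBi]
    rw [← integral_zero ℝ ℂ (μ := volume.restrict (Set.Ioi (0 : ℝ)))]
    refine setIntegral_congr_fun measurableSet_Ioi fun r hr => ?_
    have hr' : r ≠ 0 := ne_of_gt hr
    rw [← integral_Ioc_eq_integral_Ioo, ← intervalIntegral.integral_of_le (by linarith [Real.pi_pos]),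
      intervalIntegral.integral_eq_sub_of_hasDerivAt
        (f := fun θ : ℝ => (r : ℂ)⁻¹ * f (r * Complex.exp (θ * Complex.I))) (f' := fun θ => B (r, θ))
        (fun θ _ => hdB (r, θ) hr')
        ((hBc.comp (by fun_prop : Continuous fun θ : ℝ => (r, θ))).intervalIntegrable _ _)]
    simp [Complex.exp_pi_mul_I, neg_mul, Complex.exp_neg]
  rw [← Complex.integral_comp_polarCoord_symm]
  have hcongr : ∫ p in polarCoord.target, p.1 • (dzbar f (Complex.polarCoord.symm p) /
      Complex.polarCoord.symm p) =
      ∫ p in Set.Ioi (0 : ℝ) ×ˢ Set.Ioo (-Real.pi) Real.pi, (1 / 2) * (A p + Complex.I * B p) := by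
    rw [polarCoord_target]
    refine setIntegral_congr_fun (measurableSet_Ioi.prod measurableSet_Ioo) fun p hp => ?_
    have e : Complex.polarCoord.symm p = p.1 * Complex.exp (p.2 * Complex.I) := by
      rw [Complex.polarCoord_symm_apply, Complex.exp_mul_I, Complex.ofReal_cos, Complex.ofReal_sin]
    simp only [e, Complex.real_smul]
    rw [polar_dzbar f (ne_of_gt hp.1)]
  rw [hcongr, integral_const_mul, integral_add hAi (hBi.const_mul _), integral_const_mul, hIA, hIB]
  ring

/-- C is the convolution of f with 1/(πz). The derivative ∂_z̄ is moved onto f and evaluated by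
`integral_dzbar_div`; compactness of the support gives decay like 1/|z|. -/
theorem exists_cauchy_transform {f : ℂ → ℂ} (hf : ContDiff ℝ ∞ f) (hc : HasCompactSupport f) :
    ∃ (C : ℂ → ℂ) (M : ℝ), ContDiff ℝ ∞ C ∧ (∀ z, dzbar C z = f z) ∧
      ∀ z, ‖C z‖ * (1 + ‖z‖) ≤ M := by
  set L := ContinuousLinearMap.mul ℝ ℂ with hL
  set K : ℂ → ℂ := fun z => z⁻¹ with hK
  set C : ℂ → ℂ := fun z => (Real.pi : ℂ)⁻¹ * (convolution K f L volume) z with hC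
  have hC1 : ContDiff ℝ ∞ (convolution K f L volume) :=
    hc.contDiff_convolution_right L locallyIntegrable_inv hf
  have hCs : ContDiff ℝ ∞ C := contDiff_const.mul hC1
  have hf1 : ContDiff ℝ 1 f := hf.of_le (by norm_cast)
  have hfd : ∀ z v, fderiv ℝ (convolution K f L volume) z v =
      ∫ ζ, ζ⁻¹ * fderiv ℝ f (z - ζ) v := by
    intro z v
    rw [(hc.hasFDerivAt_convolution_right L locallyIntegrable_inv hf1 z).fderiv,
      convolution_precompR_apply L locallyIntegrable_inv (hc.fderiv ℝ)
        (hf1.continuous_fderiv (by simp)), convolution_def]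
    rfl
  have hi : ∀ z v, Integrable (fun ζ => ζ⁻¹ * fderiv ℝ f (z - ζ) v) (volume : Measure ℂ) := by
    intro z v
    have h1 : HasCompactSupport fun z => fderiv ℝ f z v := hc.fderiv_apply ℝ v
    have h2 : Continuous fun z => fderiv ℝ f z v :=
      (hf1.continuous_fderiv (by simp)).clm_apply continuous_const
    exact h1.convolutionExists_right L locallyIntegrable_inv h2 z
  have hdz : ∀ z, dzbar C z = f z := by
    intro z
    rw [hC, dzbar_const_mul _ ((hC1.differentiable (by simp)) z)]
    have h1 : dzbar (convolution K f L volume) z = ∫ ζ, dzbar f (z - ζ) / ζ := by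
      simp only [dzbar, dx, dy, hfd]
      rw [← integral_const_mul, ← integral_add (hi z 1) ((hi z _).const_mul _), ← integral_const_mul]
      congr 1; funext ζ; rw [div_eq_mul_inv]; ring
    have h2 : ∀ ζ, dzbar f (z - ζ) = -dzbar (fun ζ => f (z - ζ)) ζ := by
      intro ζ
      have h3 : ∀ v, fderiv ℝ (fun ζ => f (z - ζ)) ζ v = -fderiv ℝ f (z - ζ) v := by
        intro v
        have h4 := ((hf1.differentiable (by simp)) (z - ζ)).hasFDerivAt.comp ζ
          ((hasFDerivAt_id ζ).const_sub z)
        have h5 : HasFDerivAt (fun ζ => f (z - ζ)) _ ζ := h4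
        rw [h5.fderiv]; simp
      simp only [dzbar, dx, dy, h3]; ring
    have h6 : ContDiff ℝ 1 fun ζ => f (z - ζ) := hf1.comp (contDiff_const.sub contDiff_id)
    have h7 : HasCompactSupport fun ζ => f (z - ζ) :=
      hc.comp_homeomorph (Homeomorph.subLeft z)
    have h8 := integral_dzbar_div h6 h7
    rw [h1]
    simp only [h2, neg_div]
    rw [integral_neg, h8, sub_zero]
    have hpi : (Real.pi : ℂ) ≠ 0 := by exact_mod_cast Real.pi_ne_zero
    field_simp
  obtain ⟨R, hR0, hR⟩ : ∃ R : ℝ, 0 < R ∧ ∀ z, R ≤ ‖z‖ → f z = 0 := by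
    obtain ⟨R, hR⟩ := hc.isBounded.subset_ball 0
    refine ⟨max R 1, by positivity, fun z hz => ?_⟩
    by_contra h
    have := hR (subset_tsupport f h)
    rw [mem_ball_zero_iff] at this
    exact absurd (le_max_left R 1) (by linarith)
  set I := ∫ ζ, ‖f ζ‖ with hI
  have hI0 : 0 ≤ I := integral_nonneg fun _ => norm_nonneg _
  -- If |z - ζ| < R and |z| ≥ 2R, then |ζ| ≥ |z|/2, hence the factor 2/|z|.
  have hfar : ∀ z, 2 * R ≤ ‖z‖ → ‖C z‖ ≤ 2 / ‖z‖ * I := by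
    intro z hz
    have hz0 : 0 < ‖z‖ := by linarith
    have h1 : ‖convolution K f L volume z‖ ≤ ∫ ζ, 2 / ‖z‖ * ‖f (z - ζ)‖ := by
      rw [convolution_def]
      refine norm_integral_le_of_norm_le ?_ (Filter.Eventually.of_forall fun ζ => ?_)
      · exact ((hf.continuous.integrable_of_hasCompactSupport hc).comp_sub_left z).norm.const_mul _
      · change ‖ζ⁻¹ * f (z - ζ)‖ ≤ _
        rw [norm_mul]
        by_cases h : R ≤ ‖z - ζ‖
        · simp [hR _ h]
        · gcongr
          rw [norm_inv, ← one_div, div_le_div_iff₀ _ hz0]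
          · have := norm_sub_norm_le z ζ
            linarith [not_le.1 h]
          · have := norm_sub_norm_le z ζ
            linarith [not_le.1 h]
    rw [integral_const_mul, integral_sub_left_eq_self (fun ζ => ‖f ζ‖) volume z] at h1
    rw [hC]
    simp only [norm_mul, norm_inv, Complex.norm_real, Real.norm_of_nonneg Real.pi_pos.le]
    refine (mul_le_of_le_one_left (norm_nonneg _) ?_).trans h1
    exact inv_le_one_of_one_le₀ (by linarith [Real.pi_gt_three])
  obtain ⟨M, hM⟩ := (isCompact_closedBall (0 : ℂ) (2 * R)).exists_bound_of_continuousOn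
    hCs.continuous.continuousOn
  refine ⟨C, max (M * (1 + 2 * R)) (2 * I * (1 / (2 * R) + 1)), hCs, hdz, fun z => ?_⟩
  by_cases hz : ‖z‖ ≤ 2 * R
  · refine le_trans ?_ (le_max_left _ _)
    have := hM z (by simpa using hz)
    gcongr
    exact (norm_nonneg _).trans this
  · refine le_trans ?_ (le_max_right _ _)
    have hz' : 2 * R ≤ ‖z‖ := (not_le.1 hz).le
    have hz0 : 0 < ‖z‖ := by linarith
    calc ‖C z‖ * (1 + ‖z‖) ≤ 2 / ‖z‖ * I * (1 + ‖z‖) := by gcongr; exact hfar z hz'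
      _ = 2 * I * (1 / ‖z‖ + 1) := by field_simp
      _ ≤ _ := by gcongr

/-! ## Convergence in `L²` -/

theorem memLp_mul {m f : ℂ → ℂ} {B : ℝ} (hf : MemLp f 2 (volume : Measure ℂ))
    (hm : AEStronglyMeasurable m (volume : Measure ℂ)) (hB : ∀ᵐ z : ℂ, ‖m z‖ ≤ B) :
    MemLp (fun z => m z * f z) 2 (volume : Measure ℂ) :=
  hf.of_le_mul (c := B) (hm.mul hf.1) (hB.mono fun z hz => by rw [norm_mul]; gcongr)

theorem eLpNorm_sq {f : ℂ → ℂ} : eLpNorm f 2 (volume : Measure ℂ) ^ 2 = ∫⁻ z, ‖f z‖ₑ ^ 2 := by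
  rw [eLpNorm_eq_lintegral_rpow_enorm_toReal (by norm_num) (by norm_num)]
  rw [← ENNReal.rpow_natCast, ← ENNReal.rpow_mul]
  norm_num

theorem tendsto_eLpNorm_of_sq {F : ℕ → ℂ → ℂ}
    (h : Tendsto (fun n => ∫⁻ z, ‖F n z‖ₑ ^ 2) atTop (𝓝 0)) :
    Tendsto (fun n => eLpNorm (F n) 2 (volume : Measure ℂ)) atTop (𝓝 0) := by
  have h1 := h.ennrpow_const (1 / 2)
  rw [ENNReal.zero_rpow_of_pos (by norm_num)] at h1
  refine h1.congr fun n => ?_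
  rw [← eLpNorm_sq, ← ENNReal.rpow_natCast, ← ENNReal.rpow_mul]
  norm_num

theorem tendsto_L2_of_ae {U : ℕ → L2} {u : L2} {F : ℕ → ℂ → ℂ} {f : ℂ → ℂ}
    (hU : ∀ n, U n =ᵐ[volume] F n) (hu : u =ᵐ[volume] f)
    (h : Tendsto (fun n => eLpNorm (fun z => F n z - f z) 2 (volume : Measure ℂ)) atTop (𝓝 0)) :
    Tendsto U atTop (𝓝 u) := by
  rw [Lp.tendsto_Lp_iff_tendsto_eLpNorm']
  exact h.congr fun n => eLpNorm_congr_ae ((hU n).sub hu).symm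

/-- Dominated convergence for uniformly bounded multipliers of a fixed function in L². -/
theorem tendsto_mul_L2 {m : ℕ → ℂ → ℂ} {m₀ f : ℂ → ℂ} {B : ℝ} {U : ℕ → L2} {u : L2}
    (hf : MemLp f 2 (volume : Measure ℂ))
    (hm : ∀ n, AEStronglyMeasurable (m n) (volume : Measure ℂ))
    (hB : ∀ n, ∀ᵐ z : ℂ, ‖m n z‖ ≤ B) (hlim : ∀ᵐ z : ℂ, Tendsto (fun n => m n z) atTop (𝓝 (m₀ z)))
    (hU : ∀ n, U n =ᵐ[volume] fun z => m n z * f z) (hu : u =ᵐ[volume] fun z => m₀ z * f z) :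
    Tendsto U atTop (𝓝 u) := by
  refine tendsto_L2_of_ae hU hu (tendsto_eLpNorm_of_sq ?_)
  have hm0 : AEStronglyMeasurable m₀ (volume : Measure ℂ) := aestronglyMeasurable_of_tendsto_ae _ hm hlim
  have hB0 : ∀ᵐ z : ℂ, ‖m₀ z‖ ≤ B := by
    filter_upwards [hlim, ae_all_iff.2 hB] with z h1 h2
    exact le_of_tendsto h1.norm (Filter.Eventually.of_forall h2)
  have hdom := tendsto_lintegral_of_dominated_convergence' (μ := (volume : Measure ℂ))
    (F := fun n z => ‖m n z * f z - m₀ z * f z‖ₑ ^ 2) (f := fun _ => 0)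
    (fun z => (ENNReal.ofReal (2 * B)) ^ 2 * ‖f z‖ₑ ^ 2) ?_ ?_ ?_ ?_
  · simpa using hdom
  · exact fun n => ((((hm n).mul hf.1).sub (hm0.mul hf.1)).enorm.pow_const 2)
  · intro n
    filter_upwards [hB n, hB0] with z h1 h2
    rw [← mul_pow, ← sub_mul, enorm_mul]
    gcongr
    rw [← ofReal_norm]
    apply ENNReal.ofReal_le_ofReal
    linarith [norm_sub_le (m n z) (m₀ z)]
  · have ht : ENNReal.ofReal (2 * B) ^ 2 ≠ ⊤ := ENNReal.pow_ne_top ENNReal.ofReal_ne_top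
    rw [lintegral_const_mul' _ _ ht]
    exact ENNReal.mul_ne_top ht (by rw [← eLpNorm_sq]; exact ENNReal.pow_ne_top hf.2.ne)
  · filter_upwards [hlim] with z hz
    have h1 : Tendsto (fun n => m n z * f z - m₀ z * f z) atTop (𝓝 0) := by
      simpa using (hz.mul_const (f z)).sub_const (m₀ z * f z)
    have h2 := ENNReal.Tendsto.pow (n := 2) h1.enorm
    simpa using h2

/-! ## Radial cutoffs -/

/-- The function equal to `f` off the origin and to `0` at the origin. -/
def offZero (f : ℂ → ℂ) (z : ℂ) : ℂ := if z = 0 then 0 else f z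

theorem offZero_apply (f : ℂ → ℂ) {z : ℂ} (hz : z ≠ 0) : offZero f z = f z := if_neg hz

theorem offZero_near (f : ℂ → ℂ) {z : ℂ} (hz : z ≠ 0) : offZero f =ᶠ[𝓝 z] f := by
  filter_upwards [isOpen_ne.mem_nhds hz] with w hw
  exact offZero_apply f hw

theorem offZero_ae (f : ℂ → ℂ) : offZero f =ᵐ[volume] f :=
  ae_ne_zero.mono fun _ hz => offZero_apply f hz

theorem SmoothOff.offZero {f : ℂ → ℂ} (hf : SmoothOff f) : SmoothOff (offZero f) :=
  fun z hz => (hf z hz).congr_of_eventuallyEq (offZero_near f hz)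

theorem offZero_mem_Test {f : ℂ → ℂ} (hf : SmoothOff f) {ε R : ℝ} (hε : 0 < ε)
    (h1 : ∀ z, z ≠ 0 → ‖z‖ < ε → f z = 0) (h2 : ∀ z, z ≠ 0 → R < ‖z‖ → f z = 0) :
    offZero f ∈ Test := by
  have hnear : offZero f =ᶠ[𝓝 0] fun _ => 0 := by
    filter_upwards [Metric.ball_mem_nhds (0 : ℂ) hε] with w hw
    by_cases hw0 : w = 0
    · simp [offZero, hw0]
    · rw [offZero_apply f hw0, h1 w hw0 (by simpa using hw)]
  refine ⟨contDiff_iff_contDiffAt.2 fun z => ?_, ?_, notMem_tsupport_iff_eventuallyEq.2 hnear⟩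
  · by_cases hz : z = 0
    · rw [hz]
      exact contDiffAt_const.congr_of_eventuallyEq hnear
    · exact hf.offZero z hz
  · refine HasCompactSupport.intro (isCompact_closedBall (0 : ℂ) R) fun z hz => ?_
    by_cases hz0 : z = 0
    · simp [offZero, hz0]
    · rw [offZero_apply f hz0, h2 z hz0 (by simpa using hz)]

theorem contDiff_deriv_of_smooth {κ : ℝ → ℝ} (hκ : ContDiff ℝ ∞ κ) : ContDiff ℝ ∞ (deriv κ) :=
  ((contDiff_succ_iff_deriv (n := ∞)).1 (by simpa using hκ)).2.2

/-- A smooth step, equal to `1` on the negative axis and to `0` beyond `1`. -/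
def stp (t : ℝ) : ℝ := 1 - Real.smoothTransition t

theorem stp_contDiff : ContDiff ℝ ∞ stp := contDiff_const.sub Real.smoothTransition.contDiff

theorem stp_of_nonpos {t : ℝ} (h : t ≤ 0) : stp t = 1 := by
  simp [stp, Real.smoothTransition.zero_of_nonpos h]

theorem stp_of_one_le {t : ℝ} (h : 1 ≤ t) : stp t = 0 := by
  simp [stp, Real.smoothTransition.one_of_one_le h]

theorem stp_nonneg (t : ℝ) : 0 ≤ stp t := by
  simp [stp, Real.smoothTransition.le_one]

theorem stp_le_one (t : ℝ) : stp t ≤ 1 := by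
  simp [stp, Real.smoothTransition.nonneg]

/-- A smooth plateau, equal to `1` on `[-1, 1]` and to `0` off `[-2, 2]`. -/
def plateau (t : ℝ) : ℝ := stp (t - 1) * stp (-t - 1)

theorem plateau_contDiff : ContDiff ℝ ∞ plateau :=
  (stp_contDiff.comp (contDiff_id.sub contDiff_const)).mul
    (stp_contDiff.comp (contDiff_id.neg.sub contDiff_const))

theorem plateau_of_abs_le {t : ℝ} (h : |t| ≤ 1) : plateau t = 1 := by
  rw [abs_le] at h
  rw [plateau, stp_of_nonpos (by linarith), stp_of_nonpos (by linarith), one_mul]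

theorem plateau_of_le_abs {t : ℝ} (h : 2 ≤ |t|) : plateau t = 0 := by
  rcases le_abs.1 h with h | h
  · rw [plateau, stp_of_one_le (by linarith), zero_mul]
  · rw [plateau, stp_of_one_le (t := -t - 1) (by linarith), mul_zero]

theorem plateau_abs_le_one (t : ℝ) : |plateau t| ≤ 1 := by
  rw [plateau, abs_of_nonneg (mul_nonneg (stp_nonneg _) (stp_nonneg _))]
  exact mul_le_one₀ (stp_le_one _) (stp_nonneg _) (stp_le_one _)

theorem plateau_hasCompactSupport : HasCompactSupport plateau :=
  HasCompactSupport.intro (isCompact_Icc (a := -2) (b := 2)) fun t ht => plateau_of_le_abs (by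
    by_contra h
    exact ht ((abs_le.1 (not_le.1 h).le)))

/-- The dilated plateau. -/
def plat (n : ℕ) (t : ℝ) : ℝ := plateau (t / (n + 1))

theorem plat_contDiff (n : ℕ) : ContDiff ℝ ∞ (plat n) :=
  plateau_contDiff.comp (contDiff_id.div_const _)

theorem deriv_plat (n : ℕ) (t : ℝ) : deriv (plat n) t = deriv plateau (t / (n + 1)) / (n + 1) := by
  have h := ((plateau_contDiff.differentiable (by simp)) (t / (n + 1))).hasDerivAt.comp t
    ((hasDerivAt_id t).div_const ((n : ℝ) + 1))
  exact h.deriv.trans (by ring)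

theorem deriv_deriv_plat (n : ℕ) (t : ℝ) :
    deriv (deriv (plat n)) t = deriv (deriv plateau) (t / (n + 1)) / (n + 1) ^ 2 := by
  have h0 : deriv (plat n) = fun t => deriv plateau (t / (n + 1)) / (n + 1) := funext (deriv_plat n)
  have hd := contDiff_deriv_of_smooth plateau_contDiff
  have h := (((hd.differentiable (by simp)) (t / (n + 1))).hasDerivAt.comp t
    ((hasDerivAt_id t).div_const ((n : ℝ) + 1))).div_const ((n : ℝ) + 1)
  rw [h0]
  refine h.deriv.trans ?_
  have : (n : ℝ) + 1 ≠ 0 := by positivity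
  field_simp

/-- Smooth cutoffs to larger and larger annuli. -/
def chi (n : ℕ) : ℂ → ℂ := offZero fun z => (plat n (Real.log ‖z‖) : ℂ)

theorem plat_eq_zero {n : ℕ} {t : ℝ} (h : 2 * ((n : ℝ) + 1) ≤ |t|) : plat n t = 0 := by
  apply plateau_of_le_abs
  have : (0 : ℝ) < n + 1 := by positivity
  rw [abs_div, abs_of_pos this, le_div_iff₀ this]
  exact h

theorem radial_mul_mem {κ : ℝ → ℝ} (hκ : ContDiff ℝ ∞ κ) {T : ℝ} (hT : ∀ t, T ≤ |t| → κ t = 0)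
    {f : ℂ → ℂ} (hf : SmoothOff f) :
    offZero (fun z => (κ (Real.log ‖z‖) : ℂ) * f z) ∈ Test := by
  refine offZero_mem_Test (ε := Real.exp (-T)) (R := Real.exp T)
    ((SmoothOff.radial hκ).mul hf) (Real.exp_pos _) (fun z hz h => ?_) fun z hz h => ?_
  · have h1 := (Real.log_lt_iff_lt_exp (norm_pos_iff.2 hz)).2 h
    rw [hT _ (by have := neg_le_abs (Real.log ‖z‖); linarith)]
    simp
  · have h1 := (Real.lt_log_iff_exp_lt (norm_pos_iff.2 hz)).2 h
    rw [hT _ (by have := le_abs_self (Real.log ‖z‖); linarith)]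
    simp

theorem chi_mem (n : ℕ) : chi n ∈ Test := by
  have h := radial_mul_mem (plat_contDiff n) (fun _ => plat_eq_zero) (SmoothOff.const 1)
  simp only [mul_one] at h
  exact h

theorem norm_chi_le (n : ℕ) (z : ℂ) : ‖chi n z‖ ≤ 1 := by
  unfold chi offZero
  split_ifs
  · simp
  · rw [Complex.norm_real]
    exact plateau_abs_le_one _

theorem conj_chi (n : ℕ) (z : ℂ) : conj (chi n z) = chi n z := by
  unfold chi offZero
  split_ifs <;> simp

theorem tendsto_chi {z : ℂ} (hz : z ≠ 0) : Tendsto (fun n => chi n z) atTop (𝓝 1) := by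
  refine tendsto_const_nhds.congr' ?_
  obtain ⟨N, hN⟩ := exists_nat_ge |Real.log ‖z‖|
  filter_upwards [eventually_ge_atTop N] with n hn
  have hn' : (N : ℝ) ≤ n := by exact_mod_cast hn
  rw [chi, offZero_apply _ hz, plat, plateau_of_abs_le, Complex.ofReal_one]
  rw [abs_div, abs_of_pos (by positivity : (0 : ℝ) < n + 1), div_le_one (by positivity)]
  linarith

theorem dz_chi (n : ℕ) {z : ℂ} (hz : z ≠ 0) :
    dz (chi n) z = (deriv (plat n) (Real.log ‖z‖) : ℝ) / (2 * z) := by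
  rw [chi, dz_congr (offZero_near _ hz)]
  exact dz_radial hz ((plat_contDiff n).differentiable (by simp) _)

theorem dzbar_chi (n : ℕ) {z : ℂ} (hz : z ≠ 0) :
    dzbar (chi n) z = (deriv (plat n) (Real.log ‖z‖) : ℝ) / (2 * conj z) := by
  rw [chi, dzbar_congr (offZero_near _ hz)]
  exact dzbar_radial hz ((plat_contDiff n).differentiable (by simp) _)

theorem dz_inv_conj {z : ℂ} (hz : z ≠ 0) : dz (fun w => (2 * conj w)⁻¹) z = 0 := by
  have h : HasDerivAt (fun w : ℂ => (2 * w)⁻¹) _ z :=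
    ((hasDerivAt_id z).const_mul 2).inv (by simpa using hz)
  have e : (fun w : ℂ => (2 * conj w)⁻¹) = fun w => conj ((2 * w)⁻¹) := by
    funext w; simp [map_ofNat]
  rw [e, dz_conj (h.differentiableAt.restrictScalars ℝ), (hasDerivAt_dz h).2, map_zero]

theorem dz_dzbar_chi (n : ℕ) {z : ℂ} (hz : z ≠ 0) :
    dz (dzbar (chi n)) z =
      (deriv (deriv (plat n)) (Real.log ‖z‖) : ℝ) / (2 * z) * (2 * conj z)⁻¹ := by
  have h1 : dzbar (chi n) =ᶠ[𝓝 z]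
      fun w => ((deriv (plat n) (Real.log ‖w‖) : ℝ) : ℂ) * (2 * conj w)⁻¹ := by
    filter_upwards [isOpen_ne.mem_nhds hz] with w hw
    rw [dzbar_chi n hw, div_eq_mul_inv]
  have hd := contDiff_deriv_of_smooth (plat_contDiff n)
  rw [dz_congr h1, dz_mul ((SmoothOff.radial hd).differentiableAt hz), dz_inv_conj hz,
    dz_radial hz (hd.differentiable (by simp) _), mul_zero, add_zero]
  exact (((SmoothOff.const 2).mul SmoothOff.id.star).inv fun z hz => by simpa using hz).differentiableAt
    hz

/-- Since χ_n is a plateau in log r / (n+1), each derivative in log r costs a factor 1/(n+1).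
Cutoffs at a single scale would leave r ∂χ merely bounded; here it tends to 0 uniformly, and so does
r² ∂_z∂_z̄ χ_n. -/
theorem chi_deriv_bound : ∃ K : ℝ, ∀ (n : ℕ) (z : ℂ), z ≠ 0 →
    ‖dz (chi n) z‖ * ‖z‖ ≤ K / (n + 1) ∧ ‖dzbar (chi n) z‖ * ‖z‖ ≤ K / (n + 1) ∧
      ‖dz (dzbar (chi n)) z‖ * ‖z‖ ^ 2 ≤ K / (n + 1) := by
  have hd := contDiff_deriv_of_smooth plateau_contDiff
  obtain ⟨K₁, h1⟩ := hd.continuous.bounded_above_of_compact_support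
    plateau_hasCompactSupport.deriv
  obtain ⟨K₂, h2⟩ := (contDiff_deriv_of_smooth hd).continuous.bounded_above_of_compact_support
    plateau_hasCompactSupport.deriv.deriv
  have hK1 : 0 ≤ K₁ := (norm_nonneg _).trans (h1 0)
  have hK2 : 0 ≤ K₂ := (norm_nonneg _).trans (h2 0)
  refine ⟨K₁ + K₂, fun n z hz => ?_⟩
  have hz' : 0 < ‖z‖ := norm_pos_iff.2 hz
  have hn : (1 : ℝ) ≤ n + 1 := by linarith [n.cast_nonneg (α := ℝ)]
  have hn0 : (0 : ℝ) < n + 1 := by linarith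
  have e1 : ‖deriv (plat n) (Real.log ‖z‖)‖ ≤ K₁ / (n + 1) := by
    rw [deriv_plat, norm_div, Real.norm_of_nonneg hn0.le]
    gcongr
    exact h1 _
  have e2 : ‖deriv (deriv (plat n)) (Real.log ‖z‖)‖ ≤ K₂ / (n + 1) := by
    rw [deriv_deriv_plat, norm_div,
      Real.norm_of_nonneg (by positivity : (0 : ℝ) ≤ ((n : ℝ) + 1) ^ 2)]
    refine (div_le_div_of_nonneg_right (h2 _) (by positivity)).trans ?_
    gcongr
    nlinarith
  have e3 : K₁ / (n + 1) ≤ (K₁ + K₂) / (n + 1) := by gcongr; linarith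
  have e4 : K₂ / (n + 1) ≤ (K₁ + K₂) / (n + 1) := by gcongr; linarith
  refine ⟨?_, ?_, ?_⟩
  · rw [dz_chi n hz, norm_div, norm_mul, Complex.norm_real, div_mul_eq_mul_div, div_le_iff₀ (by simpa)]
    simp only [Complex.norm_ofNat]
    nlinarith [norm_nonneg (deriv (plat n) (Real.log ‖z‖))]
  · rw [dzbar_chi n hz, norm_div, norm_mul, Complex.norm_real, Complex.norm_conj, div_mul_eq_mul_div,
      div_le_iff₀ (by simpa)]
    simp only [Complex.norm_ofNat]
    nlinarith [norm_nonneg (deriv (plat n) (Real.log ‖z‖))]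
  · rw [dz_dzbar_chi n hz, norm_mul, norm_div, norm_inv, norm_mul, norm_mul, Complex.norm_real,
      Complex.norm_conj]
    simp only [Complex.norm_ofNat]
    have : ‖deriv (deriv (plat n)) (Real.log ‖z‖)‖ / (2 * ‖z‖) * (2 * ‖z‖)⁻¹ * ‖z‖ ^ 2 =
        ‖deriv (deriv (plat n)) (Real.log ‖z‖)‖ / 4 := by field_simp; norm_num
    rw [this]
    linarith [norm_nonneg (deriv (deriv (plat n)) (Real.log ‖z‖))]

theorem tendsto_const_div_succ (K : ℝ) : Tendsto (fun n : ℕ => K / ((n : ℝ) + 1)) atTop (𝓝 0) :=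
  (tendsto_const_nhds (x := K)).div_atTop
    (tendsto_atTop_add_const_right _ _ tendsto_natCast_atTop_atTop)

/-! ## Square integrability of powers -/

/-- The radial density behaves like r^{1-2γ} at 0 and r^{-1-2γ} at infinity; γ < 1 serves the
former, γ > 0 the latter. -/
theorem integrable_weight {γ : ℝ} (h0 : 0 < γ) (h1 : γ < 1) :
    Integrable (fun z : ℂ => (‖z‖ ^ (-γ) / (1 + ‖z‖)) ^ 2) (volume : Measure ℂ) := by
  rw [integrable_fun_norm_addHaar (volume : Measure ℂ) (f := fun r => (r ^ (-γ) / (1 + r)) ^ 2)]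
  simp only [Complex.finrank_real_complex, smul_eq_mul]
  have hm : Measurable fun r : ℝ => r ^ (2 - 1) * (r ^ (-γ) / (1 + r)) ^ 2 := by fun_prop
  have hpos : ∀ r : ℝ, 0 < r → r ^ (2 - 1) * (r ^ (-γ) / (1 + r)) ^ 2 =
      r ^ (1 - 2 * γ) / (1 + r) ^ 2 := by
    intro r hr
    rw [div_pow, ← mul_div_assoc, ← Real.rpow_natCast (r ^ (-γ)), ← Real.rpow_mul hr.le, pow_one]
    nth_rw 1 [← Real.rpow_one r]
    rw [← Real.rpow_add hr]
    congr 2; push_cast; ring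
  rw [← Set.Ioc_union_Ioi_eq_Ioi zero_le_one]
  refine IntegrableOn.union ?_ ?_
  · have h2 : IntegrableOn (fun r : ℝ => r ^ (1 - 2 * γ)) (Set.Ioc 0 1) :=
      (intervalIntegrable_iff_integrableOn_Ioc_of_le zero_le_one).1
        (intervalIntegral.intervalIntegrable_rpow' (by linarith))
    refine Integrable.mono' h2 hm.aestronglyMeasurable ?_
    refine (ae_restrict_mem measurableSet_Ioc).mono fun r hr => ?_
    rw [hpos r hr.1, Real.norm_of_nonneg (div_nonneg (Real.rpow_nonneg hr.1.le _) (by positivity))]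
    exact div_le_self (Real.rpow_nonneg hr.1.le _) (by nlinarith [hr.1])
  · have h2 : IntegrableOn (fun r : ℝ => r ^ (-1 - 2 * γ)) (Set.Ioi 1) :=
      integrableOn_Ioi_rpow_of_lt (by linarith) zero_lt_one
    refine Integrable.mono' h2 hm.aestronglyMeasurable ?_
    refine (ae_restrict_mem measurableSet_Ioi).mono fun r hr => ?_
    have hr0 : (0 : ℝ) < r := zero_lt_one.trans hr
    rw [hpos r hr0, Real.norm_of_nonneg (div_nonneg (Real.rpow_nonneg hr0.le _) (by positivity)),
      div_le_iff₀ (by positivity)]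
    have e : r ^ (1 - 2 * γ) = r ^ (-1 - 2 * γ) * r ^ 2 := by
      rw [← Real.rpow_natCast r 2, ← Real.rpow_add hr0]; congr 1; push_cast; ring
    rw [e]
    gcongr
    linarith

theorem memLp_of_weight {γ M : ℝ} (h0 : 0 < γ) (h1 : γ < 1) {f : ℂ → ℂ}
    (hf : AEStronglyMeasurable f (volume : Measure ℂ))
    (h : ∀ z, z ≠ 0 → ‖f z‖ ≤ M * (‖z‖ ^ (-γ) / (1 + ‖z‖))) :
    MemLp f 2 (volume : Measure ℂ) := by
  have hw : MemLp (fun z : ℂ => ‖z‖ ^ (-γ) / (1 + ‖z‖)) 2 (volume : Measure ℂ) :=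
    (memLp_two_iff_integrable_sq (by fun_prop : Measurable fun z : ℂ =>
      ‖z‖ ^ (-γ) / (1 + ‖z‖)).aestronglyMeasurable).2 (integrable_weight h0 h1)
  refine hw.of_le_mul (c := M) hf (ae_ne_zero.mono fun z hz => ?_)
  rw [Real.norm_of_nonneg (by positivity)]
  exact h z hz

/-! ## Cutting off functions that are smooth off the origin -/

/-- The test function `χ_n f`. -/
def chiT (n : ℕ) (f : ℂ → ℂ) (hf : SmoothOff f) : Test := mulT f hf ⟨chi n, chi_mem n⟩

theorem tendsto_chiT {f : ℂ → ℂ} (hf : SmoothOff f) {u : L2} (hu : u =ᵐ[volume] f) :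
    Tendsto (fun n => toL2 (chiT n f hf)) atTop (𝓝 u) := by
  refine tendsto_mul_L2 (m := chi) (m₀ := fun _ => 1) (f := f) (B := 1)
    ((memLp_congr_ae hu).1 (Lp.memLp u)) (fun n => (chi_mem n).1.continuous.aestronglyMeasurable)
    (fun n => Filter.Eventually.of_forall fun z => norm_chi_le n z)
    (ae_ne_zero.mono fun z hz => tendsto_chi hz) (fun n => ?_) (by simpa using hu)
  filter_upwards [toL2_coe (chiT n f hf)] with z hz
  rw [hz]
  exact mul_comm _ _

/-- Write D_n f = (r D_n)(f/r), with r D_n = O(1/(n+1)) uniformly and f/r in L². -/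
theorem tendsto_commutator_term {D : ℕ → ℂ → ℂ} (hD : ∀ n, SmoothOff (D n)) {K : ℝ}
    (hb : ∀ n z, z ≠ 0 → ‖D n z‖ * ‖z‖ ≤ K / (n + 1)) {f : ℂ → ℂ}
    (hf : MemLp (fun z => f z / ‖z‖) 2 (volume : Measure ℂ)) {U : ℕ → L2}
    (hU : ∀ n, U n =ᵐ[volume] fun z => D n z * f z) : Tendsto U atTop (𝓝 0) := by
  have hK : 0 ≤ K := by
    have := hb 0 1 one_ne_zero
    simp only [norm_one, mul_one, Nat.cast_zero, zero_add, div_one] at this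
    exact (norm_nonneg _).trans this
  refine tendsto_mul_L2 (m := fun n z => D n z * ‖z‖) (m₀ := fun _ => 0) (B := K) hf
    (fun n => (hD n).aestronglyMeasurable.mul (by fun_prop : Measurable fun z : ℂ =>
      (‖z‖ : ℂ)).aestronglyMeasurable)
    (fun n => ae_ne_zero.mono fun z hz => ?_) (ae_ne_zero.mono fun z hz => ?_) (fun n => ?_) ?_
  · rw [norm_mul, Complex.norm_real, norm_norm]
    refine (hb n z hz).trans (div_le_self hK ?_)
    linarith [n.cast_nonneg (α := ℝ)]
  · refine squeeze_zero_norm (fun n => ?_) (tendsto_const_div_succ K)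
    rw [norm_mul, Complex.norm_real, norm_norm]
    exact hb n z hz
  · filter_upwards [hU n, ae_ne_zero] with z hz hz0
    have : (‖z‖ : ℂ) ≠ 0 := by exact_mod_cast norm_ne_zero_iff.2 hz0
    rw [hz]
    field_simp
  · filter_upwards [Lp.coeFn_zero ℂ 2 (volume : Measure ℂ)] with z hz
    rw [hz]; simp

theorem memLp_commutator_term {D : ℂ → ℂ} (hD : SmoothOff D) {K : ℝ}
    (hb : ∀ z, z ≠ 0 → ‖D z‖ * ‖z‖ ≤ K) {f : ℂ → ℂ}
    (hf : MemLp (fun z => f z / ‖z‖) 2 (volume : Measure ℂ)) :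
    MemLp (fun z => D z * f z) 2 (volume : Measure ℂ) := by
  have h := memLp_mul (m := fun z => D z * ‖z‖) (B := K) hf
    (hD.aestronglyMeasurable.mul (by fun_prop : Measurable fun z : ℂ =>
      (‖z‖ : ℂ)).aestronglyMeasurable)
    (ae_ne_zero.mono fun z hz => by rw [norm_mul, Complex.norm_real, norm_norm]; exact hb z hz)
  refine (memLp_congr_ae (ae_ne_zero.mono fun z hz => ?_)).1 h
  have : (‖z‖ : ℂ) ≠ 0 := by exact_mod_cast norm_ne_zero_iff.2 hz
  field_simp

/-- T_z̄(χ_n f) = χ_n T_z̄ f + (∂_z̄ χ_n) f, and the last term disappears in the limit. Thus f has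
no boundary contribution at the origin once f/r is in L². -/
theorem tendsto_tzb_chiT (β : ℝ) {f : ℂ → ℂ} (hf : SmoothOff f)
    (hf' : MemLp (fun z => f z / ‖z‖) 2 (volume : Measure ℂ)) {u : L2} (hu : u =ᵐ[volume] Tzb β f) :
    Tendsto (fun n => toL2 (tzb β (chiT n f hf))) atTop (𝓝 u) := by
  obtain ⟨K, hK⟩ := chi_deriv_bound
  have hm : ∀ n, MemLp (fun z => dzbar (chi n) z * f z) 2 (volume : Measure ℂ) := fun n =>
    memLp_commutator_term (Test.smoothOff (Test.dzbar (chi_mem n))) (fun z hz => (hK n z hz).2.1) hf'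
  have h1 := tendsto_chiT (hf.Tzb β) hu
  have h2 := tendsto_commutator_term (D := fun n => dzbar (chi n))
    (fun n => Test.smoothOff (Test.dzbar (chi_mem n))) (fun n z hz => (hK n z hz).2.1) hf'
    (U := fun n => (hm n).toLp) (fun n => (hm n).coeFn_toLp)
  have h3 := h1.add h2
  rw [add_zero] at h3
  refine h3.congr fun n => Lp.ext ?_
  filter_upwards [Lp.coeFn_add (toL2 (chiT n _ (hf.Tzb β))) (hm n).toLp, (hm n).coeFn_toLp,
    toL2_coe (chiT n _ (hf.Tzb β)), toL2_coe (tzb β (chiT n f hf)), ae_ne_zero] with z e1 e2 e3 e4 hz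
  rw [e1, e4, Pi.add_apply, e2, e3, tzb_coe]
  have h := Tzb_mul β (Test.differentiableAt (chi_mem n) z) (hf.differentiableAt hz)
  have e5 : ((chiT n f hf : Test) : ℂ → ℂ) = fun w => chi n w * f w := by
    funext w; exact mul_comm _ _
  rw [e5, h]
  change Tzb β f z * chi n z + _ = _
  ring

theorem tendsto_tz_chiT (β : ℝ) {f : ℂ → ℂ} (hf : SmoothOff f)
    (hf' : MemLp (fun z => f z / ‖z‖) 2 (volume : Measure ℂ)) {u : L2} (hu : u =ᵐ[volume] Tz β f) :
    Tendsto (fun n => toL2 (tz β (chiT n f hf))) atTop (𝓝 u) := by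
  obtain ⟨K, hK⟩ := chi_deriv_bound
  have hm : ∀ n, MemLp (fun z => dz (chi n) z * f z) 2 (volume : Measure ℂ) := fun n =>
    memLp_commutator_term (Test.smoothOff (Test.dz (chi_mem n))) (fun z hz => (hK n z hz).1) hf'
  have h1 := tendsto_chiT (hf.Tz β) hu
  have h2 := tendsto_commutator_term (D := fun n => dz (chi n))
    (fun n => Test.smoothOff (Test.dz (chi_mem n))) (fun n z hz => (hK n z hz).1) hf'
    (U := fun n => (hm n).toLp) (fun n => (hm n).coeFn_toLp)
  have h3 := h1.add h2
  rw [add_zero] at h3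
  refine h3.congr fun n => Lp.ext ?_
  filter_upwards [Lp.coeFn_add (toL2 (chiT n _ (hf.Tz β))) (hm n).toLp, (hm n).coeFn_toLp,
    toL2_coe (chiT n _ (hf.Tz β)), toL2_coe (tz β (chiT n f hf)), ae_ne_zero] with z e1 e2 e3 e4 hz
  rw [e1, e4, Pi.add_apply, e2, e3, tz_coe]
  have h := Tz_mul β (Test.differentiableAt (chi_mem n) z) (hf.differentiableAt hz)
  have e5 : ((chiT n f hf : Test) : ℂ → ℂ) = fun w => chi n w * f w := by
    funext w; exact mul_comm _ _
  rw [e5, h]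
  change Tz β f z * chi n z + _ = _
  ring

/-! ## Solving the first-order equation -/

/-- The radial cutoff at scale one. -/
def sig (z : ℂ) : ℂ := (stp (Real.log ‖z‖) : ℂ)

theorem sig_smoothOff : SmoothOff sig := SmoothOff.radial stp_contDiff

theorem norm_sig_le (z : ℂ) : ‖sig z‖ ≤ 1 := by
  rw [sig, Complex.norm_real, Real.norm_of_nonneg (stp_nonneg _)]
  exact stp_le_one _

theorem sig_eq_one {z : ℂ} (hz : ‖z‖ ≤ 1) : sig z = 1 := by
  rw [sig, stp_of_nonpos (Real.log_nonpos (norm_nonneg _) hz), Complex.ofReal_one]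

theorem norm_sub_le_of_contDiff {C : ℂ → ℂ} (hC : ContDiff ℝ ∞ C) :
    ∃ L : ℝ, 0 ≤ L ∧ ∀ z, ‖z‖ ≤ 1 → ‖C z - C 0‖ ≤ L * ‖z‖ := by
  obtain ⟨L, hL⟩ := (isCompact_closedBall (0 : ℂ) 1).exists_bound_of_continuousOn
    (hC.continuous_fderiv (by simp)).continuousOn
  refine ⟨L, (norm_nonneg _).trans (hL 0 (by simp)), fun z hz => ?_⟩
  have := (convex_closedBall (0 : ℂ) 1).norm_image_sub_le_of_norm_fderiv_le (𝕜 := ℝ) (f := C)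
    (fun x _ => hC.differentiable (by simp) x) hL (x := 0) (y := z) (by simp) (by simpa using hz)
  simpa using this

/-- Multiplication by r raises the flux in T_z̄ by one, because ∂_z̄ r = r/(2z̄). -/
theorem Tzb_rpw_mul {β : ℝ} {f : ℂ → ℂ} {z : ℂ} (hz : z ≠ 0) (hf : DifferentiableAt ℝ f z) :
    Tzb (β + 1) (fun w => rpw 1 w * f w) z = rpw 1 z * Tzb β f z := by
  rw [Tzb_mul _ ((rpw_smoothOff 1).differentiableAt hz) hf, dzbar_rpw 1 hz]
  simp only [Tzb]
  push_cast
  ring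

/-- As μ is killed by T_z̄, dividing by it reduces T_z̄ F = Ψ to a ∂_z̄ equation, solved by a Cauchy
transform C, with F = C μ. Near 0, F behaves like C(0) μ, which F - C(0) σμ removes: the remainder
is a limit of test functions together with its T_z̄ derivative. The constant in the bound on F is
independent of Ψ. -/
theorem first_order_solution {β γ : ℝ} {μ : ℂ → ℂ} (hμ : SmoothOff μ)
    (hT : ∀ z, z ≠ 0 → Tzb β μ z = 0) (hn : ∀ z, z ≠ 0 → ‖μ z‖ = ‖z‖ ^ (-γ))
    (h0 : 0 < γ) (h1 : γ < 1) (hβ : ∀ n : ℤ, β + 1 ≠ n) {s t : L2}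
    (hs : s =ᵐ[volume] fun z => sig z * μ z) (ht : t =ᵐ[volume] fun z => dzbar sig z * μ z) :
    ∃ C : ℝ, 0 ≤ C ∧ ∀ Ψ : Test, ∃ (c : ℂ) (φ : ℕ → Test) (F : L2),
      Tendsto (fun n => toL2 (tzb β (φ n)) + c • t) atTop (𝓝 (toL2 Ψ)) ∧
      Tendsto (fun n => toL2 (φ n) + c • s) atTop (𝓝 F) ∧
      ‖F‖ ≤ C * ‖toL2 (mulT (rpw 1) (rpw_smoothOff 1) Ψ)‖ := by
  obtain ⟨A, hA0, hA⟩ := hardy_norm hβ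
  refine ⟨A, hA0, fun Ψ => ?_⟩
  have hμ0 : ∀ z, z ≠ 0 → μ z ≠ 0 := fun z hz h => by
    have := hn z hz
    rw [h, norm_zero] at this
    exact (Real.rpow_pos_of_pos (norm_pos_iff.2 hz) (-γ)).ne this
  set Ψ' : Test := mulT _ (hμ.inv hμ0) Ψ with hΨ'
  obtain ⟨C, M, hC, hdC, hM⟩ := exists_cauchy_transform Ψ'.2.1 Ψ'.2.2.1
  obtain ⟨L, hL0, hL⟩ := norm_sub_le_of_contDiff hC
  have hM0 : 0 ≤ M := le_trans (by positivity) (hM 0)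
  set φ : ℂ → ℂ := fun z => C z * μ z with hφ
  have hφs : SmoothOff φ := (SmoothOff.of_contDiff hC).mul hμ
  have hTφ : ∀ z, z ≠ 0 → Tzb β φ z = (Ψ : ℂ → ℂ) z := by
    intro z hz
    rw [hφ, Tzb_mul β (hC.differentiable (by simp) z) (hμ.differentiableAt hz), hT z hz, hdC]
    change (μ z)⁻¹ * (Ψ : ℂ → ℂ) z * μ z + _ = _
    field_simp [hμ0 z hz]
    ring
  have hCle : ∀ z, ‖C z‖ ≤ M / (1 + ‖z‖) := fun z => (le_div_iff₀ (by positivity)).2 (hM z)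
  have hφL : MemLp φ 2 (volume : Measure ℂ) := by
    refine memLp_of_weight (M := M) h0 h1 hφs.aestronglyMeasurable fun z hz => ?_
    rw [hφ]
    simp only [norm_mul, hn z hz]
    calc ‖C z‖ * ‖z‖ ^ (-γ) ≤ M / (1 + ‖z‖) * ‖z‖ ^ (-γ) := by gcongr; exact hCle z
      _ = _ := by ring
  set F : L2 := hφL.toLp with hF
  have hFe : F =ᵐ[volume] φ := hφL.coeFn_toLp
  -- Subtracting C(0) σμ leaves (C - C(0)σ)μ = O(r |μ|) at 0, so ψ/r is square integrable like μ
  -- itself.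
  set ψ : ℂ → ℂ := fun z => φ z + (-C 0) * (sig z * μ z) with hψ
  have hψs : SmoothOff ψ := hφs.add ((SmoothOff.const _).mul (sig_smoothOff.mul hμ))
  have hψL : MemLp (fun z => ψ z / ‖z‖) 2 (volume : Measure ℂ) := by
    -- On |z| ≤ 1 the difference is at most L|z| and 1 + |z| ≤ 2; for |z| ≥ 1 it is at most 2M and 1
    -- + |z| ≤ 2|z|.
    refine memLp_of_weight (M := 2 * L + 4 * M) h0 h1
      (hψs.aestronglyMeasurable.mul (by fun_prop : Measurable fun z : ℂ =>
        (‖z‖ : ℂ)⁻¹).aestronglyMeasurable) fun z hz => ?_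
    have hz' : 0 < ‖z‖ := norm_pos_iff.2 hz
    have e1 : ψ z = (C z - C 0 * sig z) * μ z := by simp only [hψ, hφ]; ring
    have e2 : ‖C z - C 0 * sig z‖ / ‖z‖ ≤ (2 * L + 4 * M) / (1 + ‖z‖) := by
      rw [div_le_div_iff₀ hz' (by positivity)]
      by_cases hz1 : ‖z‖ ≤ 1
      · rw [sig_eq_one hz1, mul_one]
        nlinarith [hL z hz1, mul_nonneg hL0 hz'.le, mul_nonneg hM0 hz'.le,
          mul_le_mul_of_nonneg_right (hL z hz1) (by positivity : 0 ≤ 1 + ‖z‖)]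
      · have hz2 : 1 ≤ ‖z‖ := (not_le.1 hz1).le
        have h3 : ‖C z‖ ≤ M := (hCle z).trans (div_le_self hM0 (by linarith))
        have h4 : ‖C 0 * sig z‖ ≤ M := by
          rw [norm_mul]
          have := hCle 0
          simp only [norm_zero, add_zero, div_one] at this
          nlinarith [norm_sig_le z, norm_nonneg (C 0), norm_nonneg (sig z)]
        have h5 := norm_sub_le (C z) (C 0 * sig z)
        nlinarith [mul_nonneg hL0 hz'.le, mul_le_mul_of_nonneg_right (h5.trans (add_le_add h3 h4))
          (by positivity : 0 ≤ 1 + ‖z‖)]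
    rw [norm_div, Complex.norm_real, norm_norm, e1, norm_mul, hn z hz]
    calc ‖C z - C 0 * sig z‖ * ‖z‖ ^ (-γ) / ‖z‖
        = ‖C z - C 0 * sig z‖ / ‖z‖ * ‖z‖ ^ (-γ) := by ring
      _ ≤ (2 * L + 4 * M) / (1 + ‖z‖) * ‖z‖ ^ (-γ) := by gcongr
      _ = _ := by ring
  have hψe : (F - C 0 • s : L2) =ᵐ[volume] ψ := by
    filter_upwards [Lp.coeFn_sub F (C 0 • s), Lp.coeFn_smul (C 0) s, hFe, hs] with z e1 e2 e3 e4
    rw [e1, Pi.sub_apply, e2, Pi.smul_apply, e3, e4, smul_eq_mul]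
    simp only [hψ]; ring
  have hTψe : (toL2 Ψ - C 0 • t : L2) =ᵐ[volume] Tzb β ψ := by
    filter_upwards [Lp.coeFn_sub (toL2 Ψ) (C 0 • t), Lp.coeFn_smul (C 0) t, toL2_coe Ψ, ht,
      ae_ne_zero] with z e1 e2 e3 e4 hz
    rw [e1, Pi.sub_apply, e2, Pi.smul_apply, e3, e4, smul_eq_mul, hψ,
      Tzb_add β (hφs.differentiableAt hz)
        (((SmoothOff.const _).mul (sig_smoothOff.mul hμ)).differentiableAt hz),
      Tzb_mul β (differentiableAt_const _) ((sig_smoothOff.mul hμ).differentiableAt hz),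
      Tzb_mul β (sig_smoothOff.differentiableAt hz) (hμ.differentiableAt hz), hTφ z hz, hT z hz,
      dzbar_const]
    ring
  have hrs : SmoothOff fun z => rpw 1 z * φ z := (rpw_smoothOff 1).mul hφs
  refine ⟨C 0, fun n => chiT n ψ hψs, F, ?_, ?_, ?_⟩
  · simpa using (tendsto_tzb_chiT β hψs hψL hTψe).add_const (C 0 • t)
  · simpa using (tendsto_chiT hψs hψe).add_const (C 0 • s)
  · have hr1 : ∀ z : ℂ, z ≠ 0 → rpw 1 z = ‖z‖ := fun z hz => by rw [rpw_eq 1 hz, Real.rpow_one]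
    -- Hardy's inequality with flux β + 1 is applied to cutoffs of r φ: its T_z̄ derivative is rΨ,
    -- and dividing by r returns φ.
    have l1 : Tendsto (fun n => toL2 (tzb (β + 1) (chiT n _ hrs))) atTop
        (𝓝 (toL2 (mulT (rpw 1) (rpw_smoothOff 1) Ψ))) := by
      refine tendsto_tzb_chiT (β + 1) hrs ?_ ?_
      · refine (memLp_congr_ae (ae_ne_zero.mono fun z hz => ?_)).1 hφL
        have : (‖z‖ : ℂ) ≠ 0 := by exact_mod_cast norm_ne_zero_iff.2 hz
        rw [hr1 z hz]
        field_simp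
      · filter_upwards [toL2_coe (mulT (rpw 1) (rpw_smoothOff 1) Ψ), ae_ne_zero] with z e hz
        rw [e, Tzb_rpw_mul hz (hφs.differentiableAt hz), hTφ z hz]
        rfl
    have l2 : Tendsto (fun n => toL2 (mulT (rpw (-1)) (rpw_smoothOff _) (chiT n _ hrs))) atTop
        (𝓝 F) := by
      refine (tendsto_chiT hφs hFe).congr fun n => ?_
      congr 1
      refine Test.ext_off fun z hz => ?_
      change φ z * chi n z = rpw (-1) z * (rpw 1 z * φ z * chi n z)
      have : rpw (-1) z * rpw 1 z = 1 := by rw [← rpw_add]; norm_num [rpw_zero]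
      linear_combination (-(φ z * chi n z)) * this
    exact le_of_tendsto_of_tendsto l2.norm (l1.norm.const_mul A)
      (Filter.Eventually.of_forall fun n => hA _)

/-! ## Square integrability of `g / r` for first-order equations without boundary term -/

theorem denseRange_toL2 : DenseRange toL2 := by
  have h : (LinearMap.range toL2).topologicalClosure = ⊤ := by
    rw [Submodule.topologicalClosure_eq_top_iff, Submodule.eq_bot_iff]
    intro u hu
    refine L2_ext fun φ => ?_
    rw [inner_zero_right]
    exact (Submodule.mem_orthogonal _ _).1 hu _ ⟨φ, rfl⟩
  have h2 := Submodule.dense_iff_topologicalClosure_eq_top.2 h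
  rwa [LinearMap.coe_range] at h2

theorem norm_le_of_test {u : L2} {K : ℝ} (hK : 0 ≤ K) (h : ∀ φ : Test, ‖⟪toL2 φ, u⟫_ℂ‖ ≤ K * ‖toL2 φ‖) :
    ‖u‖ ≤ K := by
  have h1 : ∀ v : L2, ‖⟪v, u⟫_ℂ‖ ≤ K * ‖v‖ := fun v =>
    denseRange_toL2.induction_on (p := fun v : L2 => ‖⟪v, u⟫_ℂ‖ ≤ K * ‖v‖) v
      (isClosed_le (by fun_prop) (by fun_prop)) h
  have h2 := h1 u
  rw [inner_self_eq_norm_sq_to_K] at h2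
  rw [norm_pow, RCLike.norm_ofReal, abs_norm, sq] at h2
  by_cases hu : ‖u‖ = 0
  · rwa [hu]
  · have : 0 < ‖u‖ := lt_of_le_of_ne (norm_nonneg _) (Ne.symm hu)
    exact le_of_mul_le_mul_right h2 this

/-- Fatou's lemma. -/
theorem memLp_of_tendsto_ae {F : ℕ → ℂ → ℂ} {f : ℂ → ℂ} {K : ENNReal}
    (hm : ∀ n, AEStronglyMeasurable (F n) (volume : Measure ℂ))
    (hlim : ∀ᵐ z : ℂ, Tendsto (fun n => F n z) atTop (𝓝 (f z))) (hK : K < ⊤)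
    (hb : ∀ n, eLpNorm (F n) 2 (volume : Measure ℂ) ≤ K) : MemLp f 2 (volume : Measure ℂ) := by
  refine ⟨aestronglyMeasurable_of_tendsto_ae _ hm hlim, ?_⟩
  refine lt_of_le_of_lt (Lp.eLpNorm_lim_le_liminf_eLpNorm hm _ hlim) ?_
  refine lt_of_le_of_lt (liminf_le_of_le (by isBoundedDefault) (a := K) ?_) hK
  intro b hbn
  obtain ⟨n, hn⟩ := hbn.exists
  exact hn.trans (hb n)

/-- Duality: taking Ψ = χ_n r^{-1} φ bounds χ_n g/r in L² uniformly in n, and Fatou's lemma removes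
the cutoff. -/
theorem memLp_div_of_bound {g : L2} {K : ℝ} (hK0 : 0 ≤ K)
    (h : ∀ Ψ : Test, ‖⟪toL2 Ψ, g⟫_ℂ‖ ≤ K * ‖toL2 (mulT (rpw 1) (rpw_smoothOff 1) Ψ)‖) :
    MemLp (fun z => g z / ‖z‖) 2 (volume : Measure ℂ) := by
  have hr : ∀ n, SmoothOff fun z => chi n z * rpw (-1) z := fun n =>
    (Test.smoothOff (chi_mem n)).mul (rpw_smoothOff _)
  have hm : ∀ n, MemLp (fun z => chi n z * rpw (-1) z * g z) 2 (volume : Measure ℂ) := by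
    intro n
    have hc : Continuous (fun z => rpw (-1) z * chi n z) :=
      (Test.mul (chi_mem n) (rpw_smoothOff (-1))).1.continuous
    obtain ⟨B, hB⟩ := hc.bounded_above_of_compact_support
      (Test.mul (chi_mem n) (rpw_smoothOff (-1))).2.1
    refine memLp_mul (B := B) (Lp.memLp g) (hr n).aestronglyMeasurable
      (Filter.Eventually.of_forall fun z => ?_)
    rw [mul_comm]; exact hB z
  have hb : ∀ n, eLpNorm (fun z => chi n z * rpw (-1) z * g z) 2 (volume : Measure ℂ) ≤
      ENNReal.ofReal K := by
    intro n
    rw [← Lp.enorm_toLp (hf := hm n), ← ofReal_norm]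
    apply ENNReal.ofReal_le_ofReal
    refine norm_le_of_test hK0 fun φ => ?_
    have e1 : ⟪toL2 φ, (hm n).toLp⟫_ℂ = ⟪toL2 (mulT _ (hr n) φ), g⟫_ℂ := by
      rw [inner_toLp_right, inner_toL2_left]
      congr 1; funext z
      simp only [mulT, map_mul, conj_chi, conj_rpw]
      ring
    rw [e1]
    refine (h _).trans (mul_le_mul_of_nonneg_left ?_ hK0)
    refine Lp.norm_le_norm_of_ae_le ?_
    filter_upwards [toL2_coe φ, toL2_coe (mulT (rpw 1) (rpw_smoothOff 1) (mulT _ (hr n) φ))]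
      with z e2 e3
    rw [e2, e3]
    change ‖rpw 1 z * (chi n z * rpw (-1) z * (φ : ℂ → ℂ) z)‖ ≤ _
    have e4 : rpw 1 z * rpw (-1) z = 1 := by rw [← rpw_add]; norm_num [rpw_zero]
    have e5 : rpw 1 z * (chi n z * rpw (-1) z * (φ : ℂ → ℂ) z) = chi n z * (φ : ℂ → ℂ) z := by
      linear_combination (chi n z * (φ : ℂ → ℂ) z) * e4
    rw [e5, norm_mul]
    exact mul_le_of_le_one_left (norm_nonneg _) (norm_chi_le n z)
  have hlim : ∀ᵐ z : ℂ, Tendsto (fun n => chi n z * rpw (-1) z * g z) atTop (𝓝 (g z / ‖z‖)) := by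
    filter_upwards [ae_ne_zero] with z hz
    have := ((tendsto_chi hz).mul_const (rpw (-1) z)).mul_const (g z)
    rw [rpw_eq _ hz, Real.rpow_neg_one] at this ⊢
    convert this using 2
    push_cast
    ring
  exact memLp_of_tendsto_ae (fun n => (hm n).1) hlim ENNReal.ofReal_lt_top hb

/-- Hypothesis `hb` extends the weak equation `hw` from test functions to the singular function σμ.
It then holds for the solution F of T_z̄ F = Ψ from `first_order_solution`, so ⟪Ψ, g⟫ = -⟪F, h⟫,
which is bounded by the norm of rΨ. -/
theorem memLp_div_of_weak_Tzb {β γ : ℝ} {μ : ℂ → ℂ} (hμ : SmoothOff μ)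
    (hT : ∀ z, z ≠ 0 → Tzb β μ z = 0) (hn : ∀ z, z ≠ 0 → ‖μ z‖ = ‖z‖ ^ (-γ))
    (h0 : 0 < γ) (h1 : γ < 1) (hβ : ∀ n : ℤ, β + 1 ≠ n) {s t : L2}
    (hs : s =ᵐ[volume] fun z => sig z * μ z) (ht : t =ᵐ[volume] fun z => dzbar sig z * μ z)
    {g h : L2} (hw : ∀ φ : Test, ⟪toL2 (tzb β φ), g⟫_ℂ = -⟪toL2 φ, h⟫_ℂ)
    (hb : ⟪t, g⟫_ℂ = -⟪s, h⟫_ℂ) : MemLp (fun z => g z / ‖z‖) 2 (volume : Measure ℂ) := by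
  obtain ⟨C, hC0, hC⟩ := first_order_solution hμ hT hn h0 h1 hβ hs ht
  refine memLp_div_of_bound (K := C * ‖h‖) (by positivity) fun Ψ => ?_
  obtain ⟨c, φ, F, hl1, hl2, hF⟩ := hC Ψ
  have e : ⟪toL2 Ψ, g⟫_ℂ = -⟪F, h⟫_ℂ := by
    refine tendsto_nhds_unique (hl1.inner tendsto_const_nhds) ?_
    refine (hl2.inner (tendsto_const_nhds (x := h))).neg.congr fun n => ?_
    rw [inner_add_left, inner_add_left, inner_smul_left, inner_smul_left, hw, hb]
    ring
  rw [e, norm_neg]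
  calc ‖⟪F, h⟫_ℂ‖ ≤ ‖F‖ * ‖h‖ := norm_inner_le_norm _ _
    _ ≤ C * ‖toL2 (mulT (rpw 1) (rpw_smoothOff 1) Ψ)‖ * ‖h‖ := by gcongr
    _ = _ := by ring

/-! ### Complex conjugation, which exchanges T_z with flux β and T_z̄ with flux -β. -/

theorem conj_memLp {f : ℂ → ℂ} (hf : MemLp f 2 (volume : Measure ℂ)) :
    MemLp (fun z => conj (f z)) 2 (volume : Measure ℂ) :=
  hf.of_le (Complex.continuous_conj.comp_aestronglyMeasurable hf.1)
    (Filter.Eventually.of_forall fun z => by rw [Complex.norm_conj])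

/-- Complex conjugation on `L²`. -/
def cj (u : L2) : L2 := (conj_memLp (Lp.memLp u)).toLp

theorem cj_coe (u : L2) : cj u =ᵐ[volume] fun z => conj (u z) := (conj_memLp (Lp.memLp u)).coeFn_toLp

theorem inner_cj (u v : L2) : ⟪cj u, v⟫_ℂ = conj ⟪u, cj v⟫_ℂ := by
  rw [L2.inner_def, L2.inner_def, ← integral_conj]
  refine integral_congr_ae ?_
  filter_upwards [cj_coe u, cj_coe v] with z e1 e2
  simp only [e1, e2, RCLike.inner_apply, map_mul, Complex.conj_conj]

theorem cj_cj (u : L2) : cj (cj u) = u := by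
  refine Lp.ext ?_
  filter_upwards [cj_coe u, cj_coe (cj u)] with z e1 e2
  rw [e2, e1, Complex.conj_conj]

/-- Complex conjugation of test functions. -/
def cjT (φ : Test) : Test := ⟨fun z => conj (φ.1 z), Test.conj φ.2⟩

theorem toL2_cjT (φ : Test) : toL2 (cjT φ) = cj (toL2 φ) := by
  refine Lp.ext ?_
  filter_upwards [cj_coe (toL2 φ), toL2_coe φ, toL2_coe (cjT φ)] with z e1 e2 e3
  rw [e3, e1, e2]; rfl

theorem tz_cjT (β : ℝ) (φ : Test) : tz β (cjT φ) = cjT (tzb (-β) φ) :=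
  Test.ext_off fun z _ => Tz_conj β (Test.differentiableAt φ.2 z)

theorem memLp_div_of_weak_Tz {β γ : ℝ} {μ : ℂ → ℂ} (hμ : SmoothOff μ)
    (hT : ∀ z, z ≠ 0 → Tz β μ z = 0) (hn : ∀ z, z ≠ 0 → ‖μ z‖ = ‖z‖ ^ (-γ))
    (h0 : 0 < γ) (h1 : γ < 1) (hβ : ∀ n : ℤ, -β + 1 ≠ n) {s t : L2}
    (hs : s =ᵐ[volume] fun z => sig z * μ z) (ht : t =ᵐ[volume] fun z => dz sig z * μ z)
    {g h : L2} (hw : ∀ φ : Test, ⟪toL2 (tz β φ), g⟫_ℂ = -⟪toL2 φ, h⟫_ℂ)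
    (hb : ⟪t, g⟫_ℂ = -⟪s, h⟫_ℂ) : MemLp (fun z => g z / ‖z‖) 2 (volume : Measure ℂ) := by
  have key : MemLp (fun z => cj g z / ‖z‖) 2 (volume : Measure ℂ) := by
    refine memLp_div_of_weak_Tzb (β := -β) (γ := γ) (μ := fun z => conj (μ z)) (s := cj s) (t := cj t)
      (h := cj h) hμ.star (fun z hz => ?_) (fun z hz => by rw [Complex.norm_conj, hn z hz]) h0 h1 hβ
      ?_ ?_ (fun φ => ?_) ?_
    · have := Tz_conj β (f := fun z => conj (μ z)) (differentiableAt_conj (hμ.differentiableAt hz))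
      simp only [Complex.conj_conj] at this
      rw [hT z hz] at this
      exact (map_eq_zero _).1 this.symm
    · filter_upwards [cj_coe s, hs] with z e1 e2
      rw [e1, e2, map_mul, sig, Complex.conj_ofReal]
    · filter_upwards [cj_coe t, ht, ae_ne_zero] with z e1 e2 hz
      have : dzbar (fun w => conj (sig w)) z = conj (dz sig z) :=
        dzbar_conj (sig_smoothOff.differentiableAt hz)
      simp only [sig, Complex.conj_ofReal] at this
      rw [e1, e2, map_mul, ← this]
      rfl
    · have h2 := hw (cjT φ)
      rw [tz_cjT, toL2_cjT, toL2_cjT, inner_cj, inner_cj, ← map_neg] at h2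
      exact (starRingEnd ℂ).injective h2
    · have h2 := inner_cj t (cj g)
      have h3 := inner_cj s (cj h)
      rw [cj_cj] at h2 h3
      rw [h2, h3, hb, map_neg]
  have hm : AEStronglyMeasurable (fun z => g z / ‖z‖) (volume : Measure ℂ) := by
    simp only [div_eq_mul_inv]
    exact (Lp.aestronglyMeasurable g).mul (by fun_prop : Measurable fun z : ℂ =>
      (‖z‖ : ℂ)⁻¹).aestronglyMeasurable
  refine key.of_le hm ?_
  filter_upwards [cj_coe g] with z hz
  rw [norm_div, norm_div, hz, Complex.norm_conj]

/-! ## Weak derivatives on the Friedrichs domain -/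

/-- The form equals 4‖T_z φ‖² = 4‖T_z̄ φ‖², so a form-Cauchy sequence has convergent first
derivatives. -/
theorem exists_approx {α : ℝ} {u : L2} (hu : u ∈ formDomain α) :
    ∃ (φ : ℕ → Test) (g k : L2), Tendsto (fun n => toL2 (φ n)) atTop (𝓝 u) ∧
      Tendsto (fun n => toL2 (tz α (φ n))) atTop (𝓝 g) ∧
      Tendsto (fun n => toL2 (tzb α (φ n))) atTop (𝓝 k) := by
  obtain ⟨φ, h1, h2⟩ := hu
  have h3 : Tendsto (fun p : ℕ × ℕ => ‖toL2 (tz α (φ p.1 - φ p.2))‖) atTop (𝓝 0) := by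
    have := ((h2.div_const 4).sqrt)
    rw [zero_div, Real.sqrt_zero] at this
    refine this.congr fun p => ?_
    rw [form_eq_tz, mul_div_cancel_left₀ _ (by norm_num), Real.sqrt_sq (norm_nonneg _)]
  have h4 : CauchySeq fun n => toL2 (tz α (φ n)) := by
    rw [cauchySeq_iff_tendsto_dist_atTop_0]
    simpa only [dist_eq_norm, map_sub] using h3
  have h5 : CauchySeq fun n => toL2 (tzb α (φ n)) := by
    rw [cauchySeq_iff_tendsto_dist_atTop_0]
    refine h3.congr fun p => ?_
    rw [← norm_tzb, map_sub, map_sub, dist_eq_norm]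
  obtain ⟨g, hg⟩ := cauchySeq_tendsto_of_complete h4
  obtain ⟨k, hk⟩ := cauchySeq_tendsto_of_complete h5
  exact ⟨φ, g, k, h1, hg, hk⟩

theorem mem_formDomain_of_tendsto {α : ℝ} {u g : L2} {φ : ℕ → Test}
    (h1 : Tendsto (fun n => toL2 (φ n)) atTop (𝓝 u))
    (h2 : Tendsto (fun n => toL2 (tz α (φ n))) atTop (𝓝 g)) : u ∈ formDomain α := by
  refine ⟨φ, h1, ?_⟩
  have h3 := cauchySeq_iff_tendsto_dist_atTop_0.1 h2.cauchySeq
  have h4 := (h3.pow 2).const_mul 4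
  rw [zero_pow two_ne_zero, mul_zero] at h4
  refine h4.congr fun p => ?_
  rw [form_eq_tz, map_sub, map_sub, dist_eq_norm]

/-- Test functions that approximate `u` in the form norm. -/
def approx {α : ℝ} (u : D2 α) : ℕ → Test := (exists_approx u.2.2).choose

/-- The weak derivative `T_z u`. -/
def weakDz {α : ℝ} (u : D2 α) : L2 := (exists_approx u.2.2).choose_spec.choose

/-- The weak derivative `T_z̄ u`. -/
def weakDzb {α : ℝ} (u : D2 α) : L2 := (exists_approx u.2.2).choose_spec.choose_spec.choose

variable {α : ℝ}

theorem tendsto_approx (u : D2 α) : Tendsto (fun n => toL2 (approx u n)) atTop (𝓝 (incl α u)) :=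
  (exists_approx u.2.2).choose_spec.choose_spec.choose_spec.1

theorem tendsto_tz_approx (u : D2 α) :
    Tendsto (fun n => toL2 (tz α (approx u n))) atTop (𝓝 (weakDz u)) :=
  (exists_approx u.2.2).choose_spec.choose_spec.choose_spec.2.1

theorem tendsto_tzb_approx (u : D2 α) :
    Tendsto (fun n => toL2 (tzb α (approx u n))) atTop (𝓝 (weakDzb u)) :=
  (exists_approx u.2.2).choose_spec.choose_spec.choose_spec.2.2

theorem inner_tzb_incl' (u : D2 α) (φ : Test) :
    ⟪toL2 (tzb α φ), incl α u⟫_ℂ = -⟪toL2 φ, weakDz u⟫_ℂ := by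
  refine tendsto_nhds_unique (tendsto_const_nhds.inner (tendsto_approx u)) ?_
  refine (tendsto_const_nhds.inner (tendsto_tz_approx u)).neg.congr fun n => ?_
  rw [inner_tzb]

theorem inner_tz_incl' (u : D2 α) (φ : Test) :
    ⟪toL2 (tz α φ), incl α u⟫_ℂ = -⟪toL2 φ, weakDzb u⟫_ℂ := by
  refine tendsto_nhds_unique (tendsto_const_nhds.inner (tendsto_approx u)) ?_
  refine (tendsto_const_nhds.inner (tendsto_tzb_approx u)).neg.congr fun n => ?_
  rw [inner_tz]

theorem inner_ham_incl (u : D2 α) (φ : Test) :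
    ⟪toL2 φ, P α u⟫_ℂ = ⟪toL2 (ham α φ), incl α u⟫_ℂ := u.2.1 φ

/-- The distributional equation P u = -4 T_z̄ (T_z u), with one derivative on the test function. -/
theorem inner_tz_weakDz (u : D2 α) (φ : Test) :
    ⟪toL2 (tz α φ), weakDz u⟫_ℂ = 1 / 4 * ⟪toL2 φ, P α u⟫_ℂ := by
  rw [inner_ham_incl, ham_eq, map_smul, inner_smul_left, inner_tzb_incl']
  simp [Complex.conj_ofNat]

theorem inner_tzb_weakDzb (u : D2 α) (φ : Test) :
    ⟪toL2 (tzb α φ), weakDzb u⟫_ℂ = 1 / 4 * ⟪toL2 φ, P α u⟫_ℂ := by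
  rw [inner_ham_incl, ham_eq', map_smul, inner_smul_left, inner_tz_incl']
  simp [Complex.conj_ofNat]

theorem norm_incl_le (u : D2 α) : ‖incl α u‖ ≤ ‖u‖ := norm_fst_le (u : L2 × L2)

theorem norm_P_le (u : D2 α) : ‖P α u‖ ≤ ‖u‖ := norm_snd_le (u : L2 × L2)

/-- The hypothesis is the energy identity, obtained by letting φ tend to u in the weak equation. It
makes the first derivatives continuous for the graph norm. -/
theorem norm_le_of_inner_self {u : D2 α} {g : L2}
    (h : ⟪g, g⟫_ℂ = 1 / 4 * ⟪incl α u, P α u⟫_ℂ) : ‖g‖ ≤ 1 * ‖u‖ := by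
  have h1 : ‖g‖ ^ 2 ≤ 1 / 4 * (‖incl α u‖ * ‖P α u‖) := by
    have h2 := congrArg norm h
    rw [inner_self_eq_norm_sq_to_K, norm_pow, RCLike.norm_ofReal, abs_norm, norm_mul] at h2
    rw [h2]
    have := norm_inner_le_norm (𝕜 := ℂ) (incl α u) (P α u)
    norm_num
    linarith
  rw [one_mul]
  have := mul_le_mul (norm_incl_le u) (norm_P_le u) (norm_nonneg _) (norm_nonneg _)
  nlinarith [norm_nonneg u, norm_nonneg g]

theorem norm_weakDz_le (u : D2 α) : ‖weakDz u‖ ≤ 1 * ‖u‖ := by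
  refine norm_le_of_inner_self (tendsto_nhds_unique ((tendsto_tz_approx u).inner
    (tendsto_const_nhds (x := weakDz u))) ?_)
  refine (((tendsto_approx u).inner (tendsto_const_nhds (x := P α u))).const_mul (1 / 4)).congr
    fun n => (inner_tz_weakDz u _).symm

theorem norm_weakDzb_le (u : D2 α) : ‖weakDzb u‖ ≤ 1 * ‖u‖ := by
  refine norm_le_of_inner_self (tendsto_nhds_unique ((tendsto_tzb_approx u).inner
    (tendsto_const_nhds (x := weakDzb u))) ?_)
  refine (((tendsto_approx u).inner (tendsto_const_nhds (x := P α u))).const_mul (1 / 4)).congr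
    fun n => (inner_tzb_weakDzb u _).symm

theorem weakDz_unique {u : D2 α} {g : L2}
    (h : ∀ φ : Test, ⟪toL2 (tzb α φ), incl α u⟫_ℂ = -⟪toL2 φ, g⟫_ℂ) : weakDz u = g :=
  L2_ext fun φ => neg_injective (by rw [← inner_tzb_incl', h])

theorem weakDzb_unique {u : D2 α} {g : L2}
    (h : ∀ φ : Test, ⟪toL2 (tz α φ), incl α u⟫_ℂ = -⟪toL2 φ, g⟫_ℂ) : weakDzb u = g :=
  L2_ext fun φ => neg_injective (by rw [← inner_tz_incl', h])

/-- `T_z` as an operator from the Friedrichs domain to `L²`. -/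
def Dz (α : ℝ) : D2 α →L[ℂ] L2 :=
  LinearMap.mkContinuous
    { toFun := weakDz
      map_add' := fun u v => weakDz_unique fun φ => by
        rw [map_add, inner_add_right, inner_add_right, inner_tzb_incl', inner_tzb_incl', neg_add]
      map_smul' := fun c u => weakDz_unique fun φ => by
        rw [map_smul, inner_smul_right, RingHom.id_apply, inner_smul_right, inner_tzb_incl',
          mul_neg] } 1 norm_weakDz_le

/-- `T_z̄` as an operator from the Friedrichs domain to `L²`. -/
def Dzb (α : ℝ) : D2 α →L[ℂ] L2 :=
  LinearMap.mkContinuous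
    { toFun := weakDzb
      map_add' := fun u v => weakDzb_unique fun φ => by
        rw [map_add, inner_add_right, inner_add_right, inner_tz_incl', inner_tz_incl', neg_add]
      map_smul' := fun c u => weakDzb_unique fun φ => by
        rw [map_smul, inner_smul_right, RingHom.id_apply, inner_smul_right, inner_tz_incl',
          mul_neg] } 1 norm_weakDzb_le

theorem inner_tzb_incl (u : D2 α) (φ : Test) :
    ⟪toL2 (tzb α φ), incl α u⟫_ℂ = -⟪toL2 φ, Dz α u⟫_ℂ := inner_tzb_incl' u φ

theorem inner_tz_incl (u : D2 α) (φ : Test) :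
    ⟪toL2 (tz α φ), incl α u⟫_ℂ = -⟪toL2 φ, Dzb α u⟫_ℂ := inner_tz_incl' u φ

theorem inner_tz_Dz (u : D2 α) (φ : Test) :
    ⟪toL2 (tz α φ), Dz α u⟫_ℂ = 1 / 4 * ⟪toL2 φ, P α u⟫_ℂ := inner_tz_weakDz u φ

theorem inner_tzb_Dzb (u : D2 α) (φ : Test) :
    ⟪toL2 (tzb α φ), Dzb α u⟫_ℂ = 1 / 4 * ⟪toL2 φ, P α u⟫_ℂ := inner_tzb_weakDzb u φ

/-- The operator `a T_x + b T_y` on the Friedrichs domain. -/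
def twistOp (α a b : ℝ) : D2 α →L[ℂ] L2 :=
  (a + b * Complex.I : ℂ) • Dz α + (a - b * Complex.I : ℂ) • Dzb α

theorem isTwist_twistOp (a b : ℝ) : IsTwist α a b (twistOp α a b) := by
  intro u φ
  rw [twistTest_eq, map_add, map_smul, map_smul, inner_add_left, inner_smul_left, inner_smul_left,
    inner_tz_incl, inner_tzb_incl]
  simp only [twistOp, _root_.add_apply, _root_.smul_apply, inner_add_right,
    inner_smul_right, map_add, map_sub, map_mul, Complex.conj_ofReal, Complex.conj_I]
  ring

/-! ## Elements of the Friedrichs domain -/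

theorem isClosed_maxGraph (α : ℝ) : IsClosed (maxGraph α : Set (L2 × L2)) := by
  have : (maxGraph α : Set (L2 × L2)) =
      ⋂ φ : Test, {p | ⟪toL2 φ, p.2⟫_ℂ = ⟪toL2 (ham α φ), p.1⟫_ℂ} := by
    ext p; simp [maxGraph]
  rw [this]
  exact isClosed_iInter fun φ => isClosed_eq (by fun_prop) (by fun_prop)

theorem minGraph_le_maxGraph (α : ℝ) : minGraph α ≤ maxGraph α := by
  rintro _ ⟨ψ, rfl⟩ φ
  change ⟪toL2 φ, toL2 (ham α ψ)⟫_ℂ = ⟪toL2 (ham α φ), toL2 ψ⟫_ℂ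
  rw [ham_eq α ψ, ham_eq α φ, map_smul, map_smul, inner_smul_left, inner_smul_right, inner_tzb,
    ← neg_eq_iff_eq_neg.2 (inner_tz α φ (tz α ψ))]
  simp [Complex.conj_ofNat]

theorem closure_minGraph_le_maxGraph (α : ℝ) : (minGraph α).topologicalClosure ≤ maxGraph α :=
  Submodule.topologicalClosure_minimal _ (minGraph_le_maxGraph α) (isClosed_maxGraph α)

theorem norm_tz_sq_le (φ : Test) : ‖toL2 (tz α φ)‖ ^ 2 ≤ ‖toL2 (ham α φ)‖ * ‖toL2 φ‖ := by
  have h := form_eq_tz α φ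
  have h2 : form α φ ≤ ‖toL2 (ham α φ)‖ * ‖toL2 φ‖ :=
    (Complex.re_le_norm _).trans (norm_inner_le_norm _ _)
  nlinarith [sq_nonneg ‖toL2 (tz α φ)‖]

/-- By ‖T_z φ‖² ≤ ‖P φ‖ ‖φ‖, a sequence that is Cauchy in the graph norm is Cauchy in the form norm.
-/
theorem closure_minGraph_le (α : ℝ) : (minGraph α).topologicalClosure ≤ D2 α := by
  intro p hp
  refine ⟨closure_minGraph_le_maxGraph α hp, ?_⟩
  obtain ⟨q, hq, hlim⟩ := mem_closure_iff_seq_limit.1 hp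
  choose φ hφ using hq
  have hlim' : Tendsto (fun n => (toL2 (φ n), toL2 (ham α (φ n)))) atTop (𝓝 p) := by
    refine hlim.congr fun n => ?_
    rw [← hφ n]; rfl
  have h1 : Tendsto (fun n => toL2 (φ n)) atTop (𝓝 p.1) := hlim'.fst_nhds
  have h2 : Tendsto (fun n => toL2 (ham α (φ n))) atTop (𝓝 p.2) := hlim'.snd_nhds
  have h3 : CauchySeq fun n => toL2 (tz α (φ n)) := by
    rw [cauchySeq_iff_tendsto_dist_atTop_0]
    have e := ((cauchySeq_iff_tendsto_dist_atTop_0.1 h2.cauchySeq).mul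
      (cauchySeq_iff_tendsto_dist_atTop_0.1 h1.cauchySeq)).sqrt
    rw [mul_zero, Real.sqrt_zero] at e
    refine squeeze_zero (fun _ => dist_nonneg) (fun p => ?_) e
    refine Real.le_sqrt_of_sq_le ?_
    simp only [dist_eq_norm, ← map_sub]
    exact norm_tz_sq_le _
  obtain ⟨g, hg⟩ := cauchySeq_tendsto_of_complete h3
  exact mem_formDomain_of_tendsto h1 hg

theorem D2_ext {u v : D2 α} (h : incl α u = incl α v) : u = v := by
  refine Subtype.ext (Prod.ext h ?_)
  exact L2_ext fun φ => by
    have h1 := inner_ham_incl u φ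
    have h2 := inner_ham_incl v φ
    rw [h, ← h2] at h1
    exact h1

/-- The element of the Friedrichs domain given by a test function. -/
def testD2 (α : ℝ) (φ : Test) : D2 α :=
  ⟨(toL2 φ, toL2 (ham α φ)), closure_minGraph_le α (subset_closure ⟨φ, rfl⟩)⟩

theorem incl_testD2 (φ : Test) : incl α (testD2 α φ) = toL2 φ := rfl

theorem P_testD2 (φ : Test) : P α (testD2 α φ) = toL2 (ham α φ) := rfl

theorem Dz_testD2 (φ : Test) : Dz α (testD2 α φ) = toL2 (tz α φ) :=
  weakDz_unique fun ψ => by rw [incl_testD2, inner_tzb]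

theorem Dzb_testD2 (φ : Test) : Dzb α (testD2 α φ) = toL2 (tzb α φ) :=
  weakDzb_unique fun ψ => by rw [incl_testD2, inner_tz]

/-- The domain of the closure of `P_α`, as a subspace of the Friedrichs domain. -/
def minDomain (α : ℝ) : Submodule ℂ (D2 α) :=
  (minGraph α).topologicalClosure.comap (D2 α).subtype

theorem mem_minDomain_iff {u : D2 α} : u ∈ minDomain α ↔ incl α u ∈ closureDomain α := by
  refine ⟨fun h => ⟨P α u, h⟩, fun ⟨f, hf⟩ => ?_⟩
  -- The second component of a pair in the Friedrichs graph is determined by the first, so f = P u.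
  have : u = ⟨(incl α u, f), closure_minGraph_le α hf⟩ := D2_ext rfl
  rw [this]
  exact hf

theorem testD2_mem (φ : Test) : testD2 α φ ∈ minDomain α := subset_closure ⟨φ, rfl⟩

theorem eq_zero_of_mem_minDomain {B : D2 α → ℂ} (hB : Continuous B)
    (h0 : ∀ φ, B (testD2 α φ) = 0) {u : D2 α} (hu : u ∈ minDomain α) : B u = 0 := by
  obtain ⟨q, hq, hlim⟩ := mem_closure_iff_seq_limit.1 (show (u : L2 × L2) ∈ closure _ from hu)
  choose φ hφ using hq
  have h1 : Tendsto (fun n => testD2 α (φ n)) atTop (𝓝 u) :=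
    tendsto_subtype_rng.2 (hlim.congr fun n => (hφ n).symm)
  refine tendsto_nhds_unique ((hB.tendsto u).comp h1) ?_
  simp only [Function.comp_def, h0, tendsto_const_nhds]

theorem inner_eq_of_ae (φ : Test) {u : L2} {f : ℂ → ℂ} (hu : u =ᵐ[volume] f) :
    ⟪toL2 φ, u⟫_ℂ = ∫ z, conj ((φ : ℂ → ℂ) z) * f z := by
  rw [inner_toL2_left]
  exact integral_congr_ae (hu.mono fun z hz => by simp only [hz])

/-- Square integrability of f/r puts f in the form domain by logarithmic cutoffs. Its image under P
in the sense of distributions on the punctured plane is the pointwise one. -/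
theorem exists_D2_of_smoothOff {f : ℂ → ℂ} (hf : SmoothOff f)
    (hf' : MemLp (fun z => f z / ‖z‖) 2 (volume : Measure ℂ)) {u g w : L2} (hu : u =ᵐ[volume] f)
    (hg : g =ᵐ[volume] Tz α f) (hw : w =ᵐ[volume] fun z => -4 * Tz α (Tzb α f) z) :
    ∃ v : D2 α, incl α v = u ∧ P α v = w := by
  refine ⟨⟨(u, w), fun φ => ?_, mem_formDomain_of_tendsto (tendsto_chiT hf hu)
    (tendsto_tz_chiT α hf hf' hg)⟩, rfl, rfl⟩
  change ⟪toL2 φ, w⟫_ℂ = ⟪toL2 (ham α φ), u⟫_ℂ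
  rw [ham_eq', map_smul, inner_smul_left, inner_eq_of_ae _ hw, inner_eq_of_ae _ hu, tz_coe,
    Tz_parts α _ hf, tzb_coe, Tzb_parts α _ (hf.Tzb α), neg_neg, ← integral_const_mul]
  refine integral_congr_ae (Filter.Eventually.of_forall fun z => ?_)
  simp only [map_neg, Complex.conj_ofNat]
  ring

theorem Dz_eq_of_smoothOff {f : ℂ → ℂ} (hf : SmoothOff f) {v : D2 α} (hv : incl α v =ᵐ[volume] f)
    {g : L2} (hg : g =ᵐ[volume] Tz α f) : Dz α v = g :=
  weakDz_unique fun φ => by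
    rw [inner_eq_of_ae _ hv, inner_eq_of_ae _ hg, tzb_coe, Tzb_parts α _ hf]

theorem Dzb_eq_of_smoothOff {f : ℂ → ℂ} (hf : SmoothOff f) {v : D2 α} (hv : incl α v =ᵐ[volume] f)
    {g : L2} (hg : g =ᵐ[volume] Tzb α f) : Dzb α v = g :=
  weakDzb_unique fun φ => by
    rw [inner_eq_of_ae _ hv, inner_eq_of_ae _ hg, tz_coe, Tz_parts α _ hf]

/-! ## Mollification in `L²` -/

theorem exists_bound_test (φ : Test) : ∃ B : ℝ, ∀ z, ‖(φ : ℂ → ℂ) z‖ ≤ B :=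
  φ.2.1.continuous.bounded_above_of_compact_support φ.2.2.1

theorem memLp_test_mul (φ : Test) (u : L2) :
    MemLp (fun z => (φ : ℂ → ℂ) z * u z) 2 (volume : Measure ℂ) := by
  obtain ⟨B, hB⟩ := exists_bound_test φ
  exact memLp_mul (Lp.memLp u) φ.2.1.continuous.aestronglyMeasurable
    (Filter.Eventually.of_forall hB)

/-- Multiplication by a test function. -/
def mulL (φ : Test) : L2 →L[ℂ] L2 :=
  LinearMap.mkContinuousOfExistsBound
    { toFun := fun u => (memLp_test_mul φ u).toLp
      map_add' := fun u v => Lp.ext <| by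
        filter_upwards [(memLp_test_mul φ (u + v)).coeFn_toLp, (memLp_test_mul φ u).coeFn_toLp,
          (memLp_test_mul φ v).coeFn_toLp, Lp.coeFn_add u v,
          Lp.coeFn_add (memLp_test_mul φ u).toLp (memLp_test_mul φ v).toLp] with z h1 h2 h3 h4 h5
        rw [h1, h5, Pi.add_apply, h2, h3, h4, Pi.add_apply, mul_add]
      map_smul' := fun c u => Lp.ext <| by
        filter_upwards [(memLp_test_mul φ (c • u)).coeFn_toLp, (memLp_test_mul φ u).coeFn_toLp,
          Lp.coeFn_smul c u, Lp.coeFn_smul c (memLp_test_mul φ u).toLp] with z h1 h2 h3 h4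
        rw [h1, RingHom.id_apply, h4, Pi.smul_apply, h2, h3, Pi.smul_apply, smul_eq_mul,
          smul_eq_mul]
        ring }
    (by
      obtain ⟨B, hB⟩ := exists_bound_test φ
      refine ⟨B, fun u => Lp.norm_le_mul_norm_of_ae_le_mul ?_⟩
      filter_upwards [(memLp_test_mul φ u).coeFn_toLp] with z h
      change ‖(memLp_test_mul φ u).toLp _ z‖ ≤ _
      rw [h, norm_mul]
      gcongr
      exact hB z)

theorem mulL_coe (φ : Test) (u : L2) : mulL φ u =ᵐ[volume] fun z => (φ : ℂ → ℂ) z * u z :=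
  (memLp_test_mul φ u).coeFn_toLp

/-- A smooth approximate identity. -/
def bump (n : ℕ) : ContDiffBump (0 : ℂ) where
  rIn := 1 / (2 * ((n : ℝ) + 1))
  rOut := 1 / ((n : ℝ) + 1)
  rIn_pos := by positivity
  rIn_lt_rOut := by
    have : (0 : ℝ) < (n : ℝ) + 1 := by positivity
    exact one_div_lt_one_div_of_lt this (by linarith)

/-- The approximate identity, with complex values. -/
def eta (n : ℕ) (z : ℂ) : ℂ := ((bump n).normed volume z : ℝ)

theorem eta_contDiff (n : ℕ) : ContDiff ℝ ∞ (eta n) :=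
  Complex.ofRealCLM.contDiff.comp (bump n).contDiff_normed

theorem eta_hasCompactSupport (n : ℕ) : HasCompactSupport (eta n) :=
  (bump n).hasCompactSupport_normed.comp_left Complex.ofReal_zero

theorem eta_eq_zero {n : ℕ} {z : ℂ} (hz : 1 / ((n : ℝ) + 1) ≤ ‖z‖) : eta n z = 0 := by
  have : (bump n).normed volume z = 0 := by
    rw [← Function.notMem_support, (bump n).support_normed_eq]
    simpa [bump] using hz
  rw [eta, this, Complex.ofReal_zero]

theorem integral_eta (n : ℕ) : ∫ z, eta n z = 1 := by
  simp only [eta]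
  rw [integral_complex_ofReal, (bump n).integral_normed, Complex.ofReal_one]

theorem enorm_eta (n : ℕ) (z : ℂ) : ‖eta n z‖ₑ = ENNReal.ofReal ((bump n).normed volume z) := by
  rw [← ofReal_norm, eta, Complex.norm_real, Real.norm_of_nonneg ((bump n).nonneg_normed z)]

theorem lintegral_eta (n : ℕ) : ∫⁻ z, ‖eta n z‖ₑ = 1 := by
  simp only [enorm_eta]
  rw [← ofReal_integral_eq_lintegral_ofReal (bump n).integrable_normed
    (Filter.Eventually.of_forall (bump n).nonneg_normed), (bump n).integral_normed,
    ENNReal.ofReal_one]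

/-- The convolution of `v` and `η`. -/
def conv (v η : ℂ → ℂ) (x : ℂ) : ℂ := ∫ t, v t * η (x - t)

theorem conv_eq (v η : ℂ → ℂ) :
    conv v η = convolution v η (ContinuousLinearMap.mul ℝ ℂ) volume := rfl

theorem conv_flip (v η : ℂ → ℂ) (x : ℂ) : conv v η x = ∫ t, v (x - t) * η t := by
  rw [conv, ← integral_sub_left_eq_self _ volume x]
  simp

/-- Translation by `t` on `L²`. -/
def translate (v : L2) (t : ℂ) : L2 :=
  Lp.compMeasurePreserving (fun x => x - t) (measurePreserving_sub_right volume t) v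

theorem translate_coe (v : L2) (t : ℂ) : translate v t =ᵐ[volume] fun x => v (x - t) :=
  Lp.coeFn_compMeasurePreserving v (measurePreserving_sub_right volume t)

theorem continuous_translate (v : L2) : Continuous (translate v) := by
  let g : C(ℂ, C(ℂ, ℂ)) := ContinuousMap.curry ⟨fun p : ℂ × ℂ => p.2 - p.1, by fun_prop⟩
  exact Continuous.compMeasurePreservingLp (f := fun _ : ℂ => v) (g := g) continuous_const
    g.continuous (fun t => measurePreserving_sub_right volume t) (by simp)

theorem translate_zero (v : L2) : translate v 0 = v := by
  refine Lp.ext ?_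
  filter_upwards [translate_coe v 0] with x hx
  rw [hx, sub_zero]

theorem enorm_sq_Lp {u : L2} {f : ℂ → ℂ} (hu : u =ᵐ[volume] f) : ‖u‖ₑ ^ 2 = ∫⁻ z, ‖f z‖ₑ ^ 2 := by
  rw [Lp.enorm_def, eLpNorm_congr_ae hu, eLpNorm_sq]

/-- η_n is a probability density, so Cauchy–Schwarz for the measure η_n dt moves the square inside
the mean. -/
theorem enorm_conv_sub_sq_le (v : L2) (n : ℕ) (x : ℂ) :
    ‖conv v (eta n) x - v x‖ₑ ^ 2 ≤ ∫⁻ t, ‖eta n t‖ₑ * ‖v (x - t) - v x‖ₑ ^ 2 := by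
  have hv : LocallyIntegrable v (volume : Measure ℂ) := locallyIntegrable_of_memLp (Lp.memLp v)
  have hi : Integrable (fun t => v (x - t) * eta n t) (volume : Measure ℂ) := by
    have h := (eta_hasCompactSupport n).convolutionExists_right (ContinuousLinearMap.mul ℝ ℂ)
      hv (eta_contDiff n).continuous x
    have h2 := h.integrable.comp_sub_left x
    simpa using h2
  have hi2 : Integrable (fun t => v x * eta n t) (volume : Measure ℂ) :=
    ((eta_contDiff n).continuous.integrable_of_hasCompactSupport (eta_hasCompactSupport n)).const_mul _
  have e1 : conv v (eta n) x - v x = ∫ t, eta n t * (v (x - t) - v x) := by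
    rw [conv_flip]
    have e2 : v x = ∫ t, v x * eta n t := by rw [integral_const_mul, integral_eta, mul_one]
    calc _ = (∫ t, v (x - t) * eta n t) - ∫ t, v x * eta n t := by rw [← e2]
      _ = _ := by
        rw [← integral_sub hi hi2]
        congr 1; funext t; ring
  have hm : Measurable fun t => v (x - t) - v x :=
    ((Lp.stronglyMeasurable v).measurable.comp (measurable_const.sub measurable_id)).sub_const _
  have hme : Measurable fun t => ‖eta n t‖ₑ := (eta_contDiff n).continuous.measurable.enorm
  have h2 := sq_lintegral_le ((volume : Measure ℂ).withDensity fun t => ‖eta n t‖ₑ)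
    (f := fun t => ‖v (x - t) - v x‖ₑ) hm.enorm.aemeasurable
  rw [withDensity_apply _ MeasurableSet.univ, Measure.restrict_univ, lintegral_eta, one_mul,
    lintegral_withDensity_eq_lintegral_mul _ hme hm.enorm,
    lintegral_withDensity_eq_lintegral_mul _ hme (hm.enorm.pow_const 2)] at h2
  refine le_trans ?_ h2
  gcongr
  rw [e1]
  refine (enorm_integral_le_lintegral_enorm _).trans_eq ?_
  simp only [enorm_mul, Pi.mul_apply]

theorem lintegral_conv_sub_sq_le (v : L2) (n : ℕ) :
    ∫⁻ x, ‖conv v (eta n) x - v x‖ₑ ^ 2 ≤ ∫⁻ t, ‖eta n t‖ₑ * ‖translate v t - v‖ₑ ^ 2 := by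
  have hv := (Lp.stronglyMeasurable v).measurable
  have hm : Measurable fun p : ℂ × ℂ => ‖eta n p.2‖ₑ * ‖v (p.1 - p.2) - v p.1‖ₑ ^ 2 :=
    ((eta_contDiff n).continuous.measurable.comp measurable_snd).enorm.mul
      (((hv.comp (measurable_fst.sub measurable_snd)).sub (hv.comp measurable_fst)).enorm.pow_const 2)
  calc ∫⁻ x, ‖conv v (eta n) x - v x‖ₑ ^ 2
      ≤ ∫⁻ x, ∫⁻ t, ‖eta n t‖ₑ * ‖v (x - t) - v x‖ₑ ^ 2 :=
        lintegral_mono (enorm_conv_sub_sq_le v n)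
    _ = ∫⁻ t, ∫⁻ x, ‖eta n t‖ₑ * ‖v (x - t) - v x‖ₑ ^ 2 :=
        lintegral_lintegral_swap hm.aemeasurable
    _ = _ := lintegral_congr fun t => by
        rw [lintegral_const_mul' _ _ enorm_ne_top]
        congr 1
        refine (enorm_sq_Lp ?_).symm
        filter_upwards [Lp.coeFn_sub (translate v t) v, translate_coe v t] with x h1 h2
        rw [h1, Pi.sub_apply, h2]

/-- The error is at most the η_n-mean of ‖v(· - t) - v‖², and translation is continuous in L². -/
theorem tendsto_lintegral_conv_sub_sq (v : L2) :
    Tendsto (fun n => ∫⁻ x, ‖conv v (eta n) x - v x‖ₑ ^ 2) atTop (𝓝 0) := by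
  rw [ENNReal.tendsto_nhds_zero]
  intro ε hε
  have h1 : Tendsto (fun t => ‖translate v t - v‖ₑ ^ 2) (𝓝 0) (𝓝 0) := by
    have h := ((continuous_translate v).sub (continuous_const (y := v))).tendsto 0
    change Tendsto (fun t => translate v t - v) (𝓝 0) (𝓝 (translate v 0 - v)) at h
    rw [translate_zero, sub_self] at h
    have h2 := ((ENNReal.continuous_pow 2).tendsto _).comp ((continuous_enorm.tendsto _).comp h)
    simpa [Function.comp_def] using h2
  have h2 := (ENNReal.tendsto_nhds_zero.1 h1) ε hε
  obtain ⟨δ, hδ, hd⟩ := Metric.eventually_nhds_iff.1 h2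
  obtain ⟨N, hN⟩ := exists_nat_one_div_lt hδ
  filter_upwards [eventually_ge_atTop N] with n hn
  refine (lintegral_conv_sub_sq_le v n).trans ?_
  calc ∫⁻ t, ‖eta n t‖ₑ * ‖translate v t - v‖ₑ ^ 2 ≤ ∫⁻ t, ‖eta n t‖ₑ * ε := by
        refine lintegral_mono fun t => ?_
        by_cases ht : 1 / ((n : ℝ) + 1) ≤ ‖t‖
        · simp [eta_eq_zero ht]
        · gcongr
          refine hd ?_
          rw [dist_zero_right]
          refine (not_le.1 ht).trans (lt_of_le_of_lt ?_ hN)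
          gcongr
    _ = ε := by
        rw [lintegral_mul_const _ (eta_contDiff n).continuous.measurable.enorm, lintegral_eta,
          one_mul]

/-! ### Derivatives of convolutions, classical and weak. -/

theorem contDiff_conv {v η : ℂ → ℂ} (hv : LocallyIntegrable v (volume : Measure ℂ))
    (hη : ContDiff ℝ ∞ η) (hη' : HasCompactSupport η) : ContDiff ℝ ∞ (conv v η) := by
  rw [conv_eq]
  exact hη'.contDiff_convolution_right _ hv hη

theorem fderiv_conv {v η : ℂ → ℂ} (hv : LocallyIntegrable v (volume : Measure ℂ))
    (hη : ContDiff ℝ ∞ η) (hη' : HasCompactSupport η) (x e : ℂ) :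
    fderiv ℝ (conv v η) x e = conv v (fun t => fderiv ℝ η t e) x := by
  rw [conv_eq, (hη'.hasFDerivAt_convolution_right (ContinuousLinearMap.mul ℝ ℂ) hv
    (hη.of_le (by simp)) x).fderiv, convolution_precompR_apply _ hv (hη'.fderiv ℝ)
    (hη.continuous_fderiv (by simp))]
  rfl

theorem integrable_conv {v η : ℂ → ℂ} (hv : LocallyIntegrable v (volume : Measure ℂ))
    (hη : Continuous η) (hη' : HasCompactSupport η) (x : ℂ) :
    Integrable (fun t => v t * η (x - t)) (volume : Measure ℂ) :=
  (hη'.convolutionExists_right (ContinuousLinearMap.mul ℝ ℂ) hv hη x).integrable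

theorem norm_translate (v : L2) (t : ℂ) : ‖translate v t‖ = ‖v‖ :=
  Lp.norm_compMeasurePreserving v (measurePreserving_sub_right volume t)

theorem memLp_conv (v : L2) (n : ℕ) : MemLp (conv v (eta n)) 2 (volume : Measure ℂ) := by
  have hm : AEStronglyMeasurable (conv v (eta n)) (volume : Measure ℂ) :=
    (contDiff_conv (locallyIntegrable_of_memLp (Lp.memLp v)) (eta_contDiff n)
      (eta_hasCompactSupport n)).continuous.aestronglyMeasurable
  have h : ∫⁻ x, ‖conv v (eta n) x - v x‖ₑ ^ 2 < ⊤ := by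
    refine (lintegral_conv_sub_sq_le v n).trans_lt ?_
    have hb : ∀ t, ‖translate v t - v‖ₑ ^ 2 ≤ ENNReal.ofReal ((2 * ‖v‖) ^ 2) := fun t => by
      rw [← ofReal_norm, ← ENNReal.ofReal_pow (norm_nonneg _)]
      gcongr
      refine (norm_sub_le _ _).trans_eq ?_
      rw [norm_translate]; ring
    refine (lintegral_mono fun t => mul_le_mul_right (hb t) _).trans_lt ?_
    rw [lintegral_mul_const _ (eta_contDiff n).continuous.measurable.enorm, lintegral_eta, one_mul]
    exact ENNReal.ofReal_lt_top
  have h1 : MemLp (fun x => conv v (eta n) x - v x) 2 (volume : Measure ℂ) := by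
    refine ⟨hm.sub (Lp.aestronglyMeasurable v), ?_⟩
    rw [← eLpNorm_sq] at h
    exact lt_top_iff_ne_top.2 fun h' => h.ne (by rw [h']; rfl)
  have := h1.add (Lp.memLp v)
  simpa [Pi.add_def] using this

/-- The mollification of `v`. -/
def mollify (n : ℕ) (v : L2) : L2 := (memLp_conv v n).toLp

theorem mollify_coe (n : ℕ) (v : L2) : mollify n v =ᵐ[volume] conv v (eta n) :=
  (memLp_conv v n).coeFn_toLp

theorem tendsto_mollify (v : L2) : Tendsto (fun n => mollify n v) atTop (𝓝 v) :=
  tendsto_L2_of_ae (fun n => mollify_coe n v) (Filter.EventuallyEq.refl _ _)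
    (tendsto_eLpNorm_of_sq (tendsto_lintegral_conv_sub_sq v))

/-- `∂_z w = g` in the sense of distributions on the plane. -/
def IsWeakDz (w g : ℂ → ℂ) : Prop :=
  ∀ ψ : ℂ → ℂ, ContDiff ℝ ∞ ψ → HasCompactSupport ψ → ∫ t, w t * dz ψ t = -∫ t, g t * ψ t

/-- `∂_z̄ w = g` in the sense of distributions on the plane. -/
def IsWeakDzbar (w g : ℂ → ℂ) : Prop :=
  ∀ ψ : ℂ → ℂ, ContDiff ℝ ∞ ψ → HasCompactSupport ψ → ∫ t, w t * dzbar ψ t = -∫ t, g t * ψ t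

section

variable {v η : ℂ → ℂ}

theorem conv_dir (hv : LocallyIntegrable v (volume : Measure ℂ)) (hη : ContDiff ℝ ∞ η)
    (hη' : HasCompactSupport η) (x e : ℂ) :
    Integrable (fun t => v t * fderiv ℝ η (x - t) e) (volume : Measure ℂ) :=
  integrable_conv (η := fun t => fderiv ℝ η t e) hv
    ((hη.continuous_fderiv (by simp)).clm_apply continuous_const)
    ((hη'.fderiv ℝ).comp_left (g := fun L : ℂ →L[ℝ] ℂ => L e) rfl) x

theorem dz_conv (hv : LocallyIntegrable v (volume : Measure ℂ)) (hη : ContDiff ℝ ∞ η)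
    (hη' : HasCompactSupport η) (x : ℂ) : dz (conv v η) x = conv v (dz η) x := by
  simp only [dz, dx, dy]
  rw [fderiv_conv hv hη hη', fderiv_conv hv hη hη', conv, conv, conv, ← integral_const_mul,
    ← integral_sub (conv_dir hv hη hη' x 1) ((conv_dir hv hη hη' x _).const_mul _),
    ← integral_const_mul]
  congr 1; funext t
  simp only [dz, dx, dy]
  ring

theorem dzbar_conv (hv : LocallyIntegrable v (volume : Measure ℂ)) (hη : ContDiff ℝ ∞ η)
    (hη' : HasCompactSupport η) (x : ℂ) : dzbar (conv v η) x = conv v (dzbar η) x := by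
  simp only [dzbar, dx, dy]
  rw [fderiv_conv hv hη hη', fderiv_conv hv hη hη', conv, conv, conv, ← integral_const_mul,
    ← integral_add (conv_dir hv hη hη' x 1) ((conv_dir hv hη hη' x _).const_mul _),
    ← integral_const_mul]
  congr 1; funext t
  simp only [dzbar, dx, dy]
  ring

theorem fderiv_reflect (hη : ContDiff ℝ ∞ η) (x t e : ℂ) :
    fderiv ℝ (fun s => η (x - s)) t e = -fderiv ℝ η (x - t) e := by
  have h := ((hη.differentiable (by simp) (x - t)).hasFDerivAt.comp t
    ((hasFDerivAt_id t).const_sub x)).fderiv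
  change fderiv ℝ (η ∘ HSub.hSub x) t e = _
  rw [h]
  simp

theorem dz_conv_of_weak {g : ℂ → ℂ} (hv : LocallyIntegrable v (volume : Measure ℂ))
    (hη : ContDiff ℝ ∞ η) (hη' : HasCompactSupport η) (h : IsWeakDz v g) (x : ℂ) :
    dz (conv v η) x = conv g η x := by
  have h1 := h (fun t => η (x - t)) (hη.comp (contDiff_const.sub contDiff_id))
    (hη'.comp_homeomorph (Homeomorph.subLeft x))
  rw [dz_conv hv hη hη', conv, conv, ← neg_eq_iff_eq_neg.2 h1, ← integral_neg]
  congr 1; funext t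
  simp only [dz, dx, dy, fderiv_reflect hη]
  ring

theorem dzbar_conv_of_weak {g : ℂ → ℂ} (hv : LocallyIntegrable v (volume : Measure ℂ))
    (hη : ContDiff ℝ ∞ η) (hη' : HasCompactSupport η) (h : IsWeakDzbar v g) (x : ℂ) :
    dzbar (conv v η) x = conv g η x := by
  have h1 := h (fun t => η (x - t)) (hη.comp (contDiff_const.sub contDiff_id))
    (hη'.comp_homeomorph (Homeomorph.subLeft x))
  rw [dzbar_conv hv hη hη', conv, conv, ← neg_eq_iff_eq_neg.2 h1, ← integral_neg]
  congr 1; funext t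
  simp only [dzbar, dx, dy, fderiv_reflect hη]
  ring

end

theorem conv_eq_zero {v : L2} {δ R : ℝ} (hv : ∀ᵐ z : ℂ, ‖z‖ < δ ∨ R < ‖z‖ → v z = 0) {n : ℕ} {x : ℂ}
    (hx : ‖x‖ + 1 / ((n : ℝ) + 1) ≤ δ ∨ R + 1 / ((n : ℝ) + 1) ≤ ‖x‖) : conv v (eta n) x = 0 := by
  refine integral_eq_zero_of_ae (hv.mono fun t ht => ?_)
  by_cases h : 1 / ((n : ℝ) + 1) ≤ ‖x - t‖
  · simp [eta_eq_zero h]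
  · have h1 := abs_norm_sub_norm_le x t
    rw [abs_le] at h1
    have : v t = 0 := by
      apply ht
      rcases hx with hx | hx
      · left; linarith
      · right; linarith
    simp [this]

/-! ## Products of test functions and elements of the Friedrichs domain -/

theorem integrable_test_mul (φ : Test) (u : L2) :
    Integrable (fun z => (φ : ℂ → ℂ) z * u z) (volume : Measure ℂ) :=
  MemLp.integrable_mul (p := 2) (q := 2) (Test.memLp φ) (Lp.memLp u)

theorem integrable_L2_mul {ψ : ℂ → ℂ} (hψ : ContDiff ℝ ∞ ψ) (hψ' : HasCompactSupport ψ) (u : L2) :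
    Integrable (fun z => u z * ψ z) (volume : Measure ℂ) :=
  MemLp.integrable_mul (p := 2) (q := 2) (Lp.memLp u) (hψ.continuous.memLp_of_hasCompactSupport hψ')

/-- Leibniz rule ∂_z(φu) = φ T_z u + (T_z^{-α} φ) u: the flux -α on φ cancels the potential acting
on u. As φ vanishes near 0, the identity may be tested with ψ that do not vanish there. -/
theorem isWeakDz_mul {u g : L2} (h : ∀ θ : Test, ⟪toL2 (tzb α θ), u⟫_ℂ = -⟪toL2 θ, g⟫_ℂ)
    (φ : Test) : IsWeakDz (mulL φ u) ⇑(mulL φ g + mulL (tz (-α) φ) u) := by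
  intro ψ hψ _
  have hψs := SmoothOff.of_contDiff hψ
  have hm : (fun z => conj (ψ z * (φ : ℂ → ℂ) z)) ∈ Test := Test.conj (Test.smoothOff_mul hψs φ.2)
  have h1 := h ⟨_, hm⟩
  have e1 : ∀ z, conj ((tzb α ⟨_, hm⟩ : ℂ → ℂ) z) =
      dz ψ z * (φ : ℂ → ℂ) z + ψ z * Tz (-α) φ z := fun z => by
    have h2 := Tz_conj (-α) (Test.differentiableAt hm z)
    simp only [Complex.conj_conj, neg_neg] at h2
    rw [tzb_coe, ← h2, Tz_mul _ (hψ.differentiable (by simp) z) (Test.differentiableAt φ.2 z)]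
  rw [inner_toL2_left, inner_toL2_left] at h1
  simp only [e1, Complex.conj_conj] at h1
  have i1 : Integrable (fun z => ψ z * Tz (-α) φ z * u z) (volume : Measure ℂ) :=
    integrable_test_mul (mulT _ hψs (tz (-α) φ)) u
  have i2 : Integrable (fun z => dz ψ z * (φ : ℂ → ℂ) z * u z) (volume : Measure ℂ) :=
    integrable_test_mul (mulT _ hψs.dz φ) u
  have i3 : Integrable (fun z => ψ z * (φ : ℂ → ℂ) z * g z) (volume : Measure ℂ) :=
    integrable_test_mul (mulT _ hψs φ) g
  have e2 : ∫ z, (dz ψ z * (φ : ℂ → ℂ) z + ψ z * Tz (-α) φ z) * u z =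
      (∫ z, dz ψ z * (φ : ℂ → ℂ) z * u z) + ∫ z, ψ z * Tz (-α) φ z * u z := by
    rw [← integral_add i2 i1]
    congr 1; funext z
    ring
  have e3 : ∫ z, mulL φ u z * dz ψ z = ∫ z, dz ψ z * (φ : ℂ → ℂ) z * u z :=
    integral_congr_ae ((mulL_coe φ u).mono fun z hz => by simp only [hz]; ring)
  have e4 : ∫ z, (mulL φ g + mulL (tz (-α) φ) u : L2) z * ψ z =
      (∫ z, ψ z * (φ : ℂ → ℂ) z * g z) + ∫ z, ψ z * Tz (-α) φ z * u z := by
    rw [← integral_add i3 i1]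
    refine integral_congr_ae ?_
    filter_upwards [Lp.coeFn_add (mulL φ g) (mulL (tz (-α) φ) u), mulL_coe φ g,
      mulL_coe (tz (-α) φ) u] with z h1 h2 h3
    simp only [h1, Pi.add_apply, h2, h3, tz_coe]
    ring
  rw [e3, e4]
  linear_combination h1 - e2

theorem isWeakDzbar_mul {u g : L2} (h : ∀ θ : Test, ⟪toL2 (tz α θ), u⟫_ℂ = -⟪toL2 θ, g⟫_ℂ)
    (φ : Test) : IsWeakDzbar (mulL φ u) ⇑(mulL φ g + mulL (tzb (-α) φ) u) := by
  intro ψ hψ _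
  have hψs := SmoothOff.of_contDiff hψ
  have hm : (fun z => conj (ψ z * (φ : ℂ → ℂ) z)) ∈ Test := Test.conj (Test.smoothOff_mul hψs φ.2)
  have h1 := h ⟨_, hm⟩
  have e1 : ∀ z, conj ((tz α ⟨_, hm⟩ : ℂ → ℂ) z) =
      dzbar ψ z * (φ : ℂ → ℂ) z + ψ z * Tzb (-α) φ z := fun z => by
    have hd : DifferentiableAt ℝ (fun w => ψ w * (φ : ℂ → ℂ) w) z :=
      (hψ.differentiable (by simp) z).mul (Test.differentiableAt φ.2 z)
    have h2 := Tz_conj α hd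
    rw [tz_coe, h2, Complex.conj_conj,
      Tzb_mul _ (hψ.differentiable (by simp) z) (Test.differentiableAt φ.2 z)]
  rw [inner_toL2_left, inner_toL2_left] at h1
  simp only [e1, Complex.conj_conj] at h1
  have i1 : Integrable (fun z => ψ z * Tzb (-α) φ z * u z) (volume : Measure ℂ) :=
    integrable_test_mul (mulT _ hψs (tzb (-α) φ)) u
  have i2 : Integrable (fun z => dzbar ψ z * (φ : ℂ → ℂ) z * u z) (volume : Measure ℂ) :=
    integrable_test_mul (mulT _ hψs.dzbar φ) u
  have i3 : Integrable (fun z => ψ z * (φ : ℂ → ℂ) z * g z) (volume : Measure ℂ) :=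
    integrable_test_mul (mulT _ hψs φ) g
  have e2 : ∫ z, (dzbar ψ z * (φ : ℂ → ℂ) z + ψ z * Tzb (-α) φ z) * u z =
      (∫ z, dzbar ψ z * (φ : ℂ → ℂ) z * u z) + ∫ z, ψ z * Tzb (-α) φ z * u z := by
    rw [← integral_add i2 i1]
    congr 1; funext z
    ring
  have e3 : ∫ z, mulL φ u z * dzbar ψ z = ∫ z, dzbar ψ z * (φ : ℂ → ℂ) z * u z :=
    integral_congr_ae ((mulL_coe φ u).mono fun z hz => by simp only [hz]; ring)
  have e4 : ∫ z, (mulL φ g + mulL (tzb (-α) φ) u : L2) z * ψ z =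
      (∫ z, ψ z * (φ : ℂ → ℂ) z * g z) + ∫ z, ψ z * Tzb (-α) φ z * u z := by
    rw [← integral_add i3 i1]
    refine integral_congr_ae ?_
    filter_upwards [Lp.coeFn_add (mulL φ g) (mulL (tzb (-α) φ) u), mulL_coe φ g,
      mulL_coe (tzb (-α) φ) u] with z h1 h2 h3
    simp only [h1, Pi.add_apply, h2, h3, tzb_coe]
    ring
  rw [e3, e4]
  linear_combination h1 - e2

theorem IsWeakDz.add {w g w' g' : L2} (h : IsWeakDz w g) (h' : IsWeakDz w' g') :
    IsWeakDz ⇑(w + w') ⇑(g + g') := by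
  intro ψ hψ hψ'
  have hd := (SmoothOff.of_contDiff hψ).dz
  have hc : ContDiff ℝ ∞ (dz ψ) ∧ HasCompactSupport (dz ψ) := by
    have hs : ∀ e : ℂ, ContDiff ℝ ∞ fun z => fderiv ℝ ψ z e := fun e =>
      (hψ.fderiv_right (m := ∞) (by simp)).clm_apply contDiff_const
    have hk : ∀ e : ℂ, HasCompactSupport fun z => fderiv ℝ ψ z e := fun e =>
      (hψ'.fderiv ℝ).comp_left (g := fun L : ℂ →L[ℝ] ℂ => L e) rfl
    exact ⟨contDiff_const.mul ((hs _).sub (contDiff_const.mul (hs _))),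
      ((hk 1).sub ((hk Complex.I).mul_left (f := fun _ => Complex.I))).mul_left
        (f := fun _ => (1 / 2 : ℂ))⟩
  have e1 : ∫ z, (w + w' : L2) z * dz ψ z = (∫ z, w z * dz ψ z) + ∫ z, w' z * dz ψ z := by
    rw [← integral_add (integrable_L2_mul hc.1 hc.2 w) (integrable_L2_mul hc.1 hc.2 w')]
    exact integral_congr_ae ((Lp.coeFn_add w w').mono fun z hz => by
      simp only [hz, Pi.add_apply, add_mul])
  have e2 : ∫ z, (g + g' : L2) z * ψ z = (∫ z, g z * ψ z) + ∫ z, g' z * ψ z := by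
    rw [← integral_add (integrable_L2_mul hψ hψ' g) (integrable_L2_mul hψ hψ' g')]
    exact integral_congr_ae ((Lp.coeFn_add g g').mono fun z hz => by
      simp only [hz, Pi.add_apply, add_mul])
  rw [e1, e2, h ψ hψ hψ', h' ψ hψ hψ']
  ring

theorem Tz_Tzb_expand (β : ℝ) {f : ℂ → ℂ} (hf : SmoothOff f) {z : ℂ} (hz : z ≠ 0) :
    Tz β (Tzb β f) z = dz (dzbar f) z + β / (2 * z) * dzbar f z - β / (2 * conj z) * dz f z -
      β ^ 2 / (4 * (z * conj z)) * f z := by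
  have hz' : conj z ≠ 0 := (map_ne_zero _).2 hz
  have hi : SmoothOff fun w => (2 * conj w)⁻¹ :=
    ((SmoothOff.const 2).mul SmoothOff.id.star).inv fun w hw =>
      mul_ne_zero two_ne_zero ((map_ne_zero _).2 hw)
  have e1 : Tzb β f = fun w => dzbar f w + (-β : ℂ) * ((2 * conj w)⁻¹ * f w) := by
    funext w; simp only [Tzb]; ring
  have e2 : dz (Tzb β f) z = dz (dzbar f) z + (-β : ℂ) * ((2 * conj z)⁻¹ * dz f z) := by
    rw [e1, dz_add (hf.dzbar.differentiableAt hz)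
      (((SmoothOff.const _).mul (hi.mul hf)).differentiableAt hz),
      dz_const_mul _ ((hi.mul hf).differentiableAt hz),
      dz_mul (hi.differentiableAt hz) (hf.differentiableAt hz), dz_inv_conj hz]
    ring
  rw [Tz, e2, Tzb]
  field_simp
  ring

/-- `f` vanishes outside of the closed annulus with radii `δ` and `R`. -/
def Vanishes (δ R : ℝ) (f : ℂ → ℂ) : Prop := ∀ z, ‖z‖ < δ ∨ R < ‖z‖ → f z = 0

theorem exists_vanishes (φ : Test) : ∃ δ R : ℝ, 0 < δ ∧ Vanishes δ R φ := by
  obtain ⟨δ, hδ, h1⟩ := Metric.eventually_nhds_iff.1 (Test.zero_near φ.2)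
  obtain ⟨R, hR⟩ := φ.2.2.1.isCompact.isBounded.subset_closedBall 0
  refine ⟨δ, R, hδ, fun z hz => ?_⟩
  rcases hz with hz | hz
  · exact h1 (by simpa using hz)
  · by_contra h
    have := hR (subset_tsupport _ h)
    simp only [Metric.mem_closedBall, dist_zero_right] at this
    linarith

theorem Vanishes.near {δ R : ℝ} {f : ℂ → ℂ} (h : Vanishes δ R f) {z : ℂ} (hz : ‖z‖ < δ ∨ R < ‖z‖) :
    f =ᶠ[𝓝 z] fun _ => 0 := by
  have ho : IsOpen {z : ℂ | ‖z‖ < δ ∨ R < ‖z‖} :=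
    (isOpen_lt continuous_norm continuous_const).union (isOpen_lt continuous_const continuous_norm)
  filter_upwards [ho.mem_nhds hz] with w hw using h w hw

theorem Vanishes.dz {δ R : ℝ} {f : ℂ → ℂ} (h : Vanishes δ R f) : Vanishes δ R (dz f) :=
  fun z hz => by rw [dz_congr (h.near hz), dz_const]

theorem Vanishes.dzbar {δ R : ℝ} {f : ℂ → ℂ} (h : Vanishes δ R f) : Vanishes δ R (dzbar f) :=
  fun z hz => by rw [dzbar_congr (h.near hz), dzbar_const]

theorem Vanishes.tz {δ R β : ℝ} {φ : Test} (h : Vanishes δ R φ) : Vanishes δ R (tz β φ) :=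
  fun z hz => by rw [tz_coe, AharonovBohm.Tz, h.dz z hz, h z hz]; ring

theorem Vanishes.tzb {δ R β : ℝ} {φ : Test} (h : Vanishes δ R φ) : Vanishes δ R (tzb β φ) :=
  fun z hz => by rw [tzb_coe, AharonovBohm.Tzb, h.dzbar z hz, h z hz]; ring

theorem chi_eq_one {δ R : ℝ} (hδ : 0 < δ) : ∃ m, ∀ z : ℂ, δ ≤ ‖z‖ → ‖z‖ ≤ R → chi m z = 1 := by
  obtain ⟨m, hm⟩ := exists_nat_ge (|Real.log δ| + |Real.log R|)
  refine ⟨m, fun z h1 h2 => ?_⟩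
  have hz0 : 0 < ‖z‖ := hδ.trans_le h1
  have hz : z ≠ 0 := norm_pos_iff.1 hz0
  rw [chi, offZero_apply _ hz, plat, plateau_of_abs_le, Complex.ofReal_one]
  have l1 := Real.log_le_log hδ h1
  have l2 := Real.log_le_log hz0 h2
  rw [abs_div, abs_of_pos (by positivity : (0 : ℝ) < (m : ℝ) + 1), div_le_one (by positivity)]
  rw [abs_le]
  have a1 := neg_abs_le (Real.log δ)
  have a2 := le_abs_self (Real.log R)
  have a3 := abs_nonneg (Real.log δ)
  have a4 := abs_nonneg (Real.log R)
  constructor <;> linarith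

/-- The coefficient `α / (2 z)`, cut off. -/
def coefT (α : ℝ) (m : ℕ) : Test := mulT _ (smoothOff_coef α) ⟨chi m, chi_mem m⟩

/-- The coefficient `α / (2 z̄)`, cut off. -/
def coefConjT (α : ℝ) (m : ℕ) : Test := mulT _ (smoothOff_coef_conj α) ⟨chi m, chi_mem m⟩

/-- The coefficient `α² / (4 z z̄)`, cut off. -/
def coefSqT (α : ℝ) (m : ℕ) : Test :=
  mulT _ ((smoothOff_coef α).mul (smoothOff_coef_conj α)) ⟨chi m, chi_mem m⟩

/-- Mollifying w commutes with its weak derivatives and gives test functions supported in a slightly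
larger annulus. There the coefficients of P are smooth and may be cut off by χ_m, hence act
boundedly on L², so that the images under P converge too. -/
theorem mem_closure_of_weak {w w₁ w₂ w₁₂ : L2} {δ R : ℝ} (hδ : 0 < δ)
    (hv : ∀ᵐ z : ℂ, ‖z‖ < δ ∨ R < ‖z‖ → w z = 0) (h1 : IsWeakDz w w₁) (h2 : IsWeakDzbar w w₂)
    (h12 : IsWeakDz w₂ w₁₂) {m : ℕ} (hm : ∀ z : ℂ, δ / 2 ≤ ‖z‖ → ‖z‖ ≤ R + 1 → chi m z = 1) :
    (w, (-4 : ℂ) • (w₁₂ + mulL (coefT α m) w₂ - mulL (coefConjT α m) w₁ - mulL (coefSqT α m) w)) ∈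
      (minGraph α).topologicalClosure := by
  refine mem_closure_of_tendsto (f := fun n => (mollify n w, (-4 : ℂ) • (mollify n w₁₂ +
    mulL (coefT α m) (mollify n w₂) - mulL (coefConjT α m) (mollify n w₁) -
      mulL (coefSqT α m) (mollify n w)))) (b := atTop) ?_ ?_
  · refine (tendsto_mollify w).prodMk_nhds (Tendsto.const_smul ?_ _)
    exact (((tendsto_mollify w₁₂).add (((mulL (coefT α m)).continuous.tendsto _).comp
      (tendsto_mollify w₂))).sub (((mulL (coefConjT α m)).continuous.tendsto _).comp
      (tendsto_mollify w₁))).sub (((mulL (coefSqT α m)).continuous.tendsto _).comp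
      (tendsto_mollify w))
  · obtain ⟨N, hN⟩ := exists_nat_one_div_lt (show 0 < min (δ / 2) 1 by positivity)
    filter_upwards [eventually_ge_atTop N] with n hn
    have hn1 : 1 / ((n : ℝ) + 1) < min (δ / 2) 1 := lt_of_le_of_lt (by gcongr) hN
    have hn2 := hn1.trans_le (min_le_left _ _)
    have hn3 := hn1.trans_le (min_le_right _ _)
    have hli := fun v : L2 => locallyIntegrable_of_memLp (Lp.memLp v)
    set f := conv w (eta n) with hf
    have hfs : ContDiff ℝ ∞ f := contDiff_conv (hli w) (eta_contDiff n) (eta_hasCompactSupport n)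
    have hvan : Vanishes (δ / 2) (R + 1) f := fun x hx => conv_eq_zero hv (by
      rcases hx with hx | hx
      · left; linarith
      · right; linarith)
    have hfT : f ∈ Test := by
      refine ⟨hfs, HasCompactSupport.intro (isCompact_closedBall 0 (R + 1)) fun x hx => ?_, ?_⟩
      · exact hvan x (Or.inr (by simpa using hx))
      · rw [notMem_tsupport_iff_eventuallyEq]
        exact hvan.near (Or.inl (by simpa using half_pos hδ))
    have d1 : dz f = conv w₁ (eta n) := funext fun x =>
      dz_conv_of_weak (hli w) (eta_contDiff n) (eta_hasCompactSupport n) h1 x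
    have d2 : dzbar f = conv w₂ (eta n) := funext fun x =>
      dzbar_conv_of_weak (hli w) (eta_contDiff n) (eta_hasCompactSupport n) h2 x
    have d12 : dz (dzbar f) = conv w₁₂ (eta n) := by
      rw [d2]
      exact funext fun x =>
        dz_conv_of_weak (hli w₂) (eta_contDiff n) (eta_hasCompactSupport n) h12 x
    have hc : ∀ g : ℂ → ℂ, Vanishes (δ / 2) (R + 1) g → ∀ z, chi m z * g z = g z := by
      intro g hg z
      by_cases hz : δ / 2 ≤ ‖z‖ ∧ ‖z‖ ≤ R + 1
      · rw [hm z hz.1 hz.2, one_mul]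
      · rw [hg z (by by_contra h; push Not at h; exact hz h), mul_zero]
    refine ⟨⟨f, hfT⟩, Prod.ext (Lp.ext ?_) (Lp.ext ?_)⟩
    · filter_upwards [toL2_coe ⟨f, hfT⟩, mollify_coe n w] with z e1 e2
      exact e1.trans e2.symm
    · change toL2 (ham α ⟨f, hfT⟩) =ᵐ[volume] _
      rw [ham_eq', map_smul]
      set A := mulL (coefT α m) (mollify n w₂)
      set B := mulL (coefConjT α m) (mollify n w₁)
      set C := mulL (coefSqT α m) (mollify n w)
      set M := mollify n w₁₂
      filter_upwards [Lp.coeFn_smul (-4 : ℂ) (toL2 (tz α (tzb α ⟨f, hfT⟩))),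
        toL2_coe (tz α (tzb α ⟨f, hfT⟩)), Lp.coeFn_smul (-4 : ℂ) (M + A - B - C),
        Lp.coeFn_sub (M + A - B) C, Lp.coeFn_sub (M + A) B, Lp.coeFn_add M A,
        mollify_coe n w₁₂, mulL_coe (coefT α m) (mollify n w₂),
        mulL_coe (coefConjT α m) (mollify n w₁), mulL_coe (coefSqT α m) (mollify n w),
        mollify_coe n w₂, mollify_coe n w₁, mollify_coe n w, ae_ne_zero]
        with z a1 a2 a3 a4 a5 a6 a7 a8 a9 a10 a11 a12 a13 hz
      rw [a1, a3, Pi.smul_apply, Pi.smul_apply, a2, a4, Pi.sub_apply, a5, Pi.sub_apply, a6,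
        Pi.add_apply, a7, a8, a9, a10, a11, a12, a13, ← d12, ← d1, ← d2, ← hf, tz_coe, tzb_coe,
        Tz_Tzb_expand α (SmoothOff.of_contDiff hfs) hz]
      simp only [coefT, coefConjT, coefSqT, mulT]
      have c1 := hc _ hvan.dz z
      have c2 := hc _ hvan.dzbar z
      have c3 := hc _ hvan z
      have hz' : conj z ≠ 0 := (map_ne_zero _).2 hz
      have c4 : (α : ℂ) / (2 * z) * (α / (2 * conj z)) = α ^ 2 / (4 * (z * conj z)) := by
        field_simp; norm_num
      rw [c4, mul_assoc (_ / _) (chi m z), mul_assoc (_ / _) (chi m z), mul_assoc (_ / _) (chi m z),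
        c1, c2, c3]

/-- `∂_z` on test functions. -/
def dzT (φ : Test) : Test := ⟨dz φ, Test.dz φ.2⟩

/-- `∂_z̄` on test functions. -/
def dzbarT (φ : Test) : Test := ⟨dzbar φ, Test.dzbar φ.2⟩

theorem mulL_add_left (φ ψ : Test) (v : L2) : mulL (φ + ψ) v = mulL φ v + mulL ψ v := by
  refine Lp.ext ?_
  filter_upwards [mulL_coe (φ + ψ) v, Lp.coeFn_add (mulL φ v) (mulL ψ v), mulL_coe φ v,
    mulL_coe ψ v] with z h1 h2 h3 h4
  rw [h1, h2, Pi.add_apply, h3, h4, Submodule.coe_add, Pi.add_apply, add_mul]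

theorem mulL_sub_left (φ ψ : Test) (v : L2) : mulL (φ - ψ) v = mulL φ v - mulL ψ v := by
  rw [eq_sub_iff_add_eq, ← mulL_add_left, sub_add_cancel]

theorem mulL_mulL (φ ψ : Test) (v : L2) :
    mulL φ (mulL ψ v) = mulL (mulT φ (Test.smoothOff φ.2) ψ) v := by
  refine Lp.ext ?_
  filter_upwards [mulL_coe (mulT φ (Test.smoothOff φ.2) ψ) v, mulL_coe φ (mulL ψ v), mulL_coe ψ v]
    with z h1 h2 h3
  rw [h1, h2, h3, mulT, mul_assoc]

/-- Away from the origin no boundary term can arise: φu has weak derivatives ∂_z, ∂_z̄ and ∂_z∂_z̄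
in L² of the whole plane, so mollification applies. The second component is the Leibniz rule for P =
-4 T_z T_z̄. -/
theorem mul_mem_closure (u : D2 α) (φ : Test) :
    (mulL φ (incl α u), mulL φ (P α u) + (-4 : ℂ) • (mulL (dzT φ) (Dzb α u) +
      mulL (dzbarT φ) (Dz α u) + mulL (dzT (dzbarT φ)) (incl α u))) ∈
      (minGraph α).topologicalClosure := by
  obtain ⟨δ, R, hδ, hφ⟩ := exists_vanishes φ
  obtain ⟨m, hm⟩ := chi_eq_one (R := R + 1) (half_pos hδ)
  have k1 := isWeakDz_mul (inner_tzb_incl u) φ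
  have k2 := isWeakDzbar_mul (inner_tz_incl u) φ
  have k3 := isWeakDz_mul (u := Dzb α u) (g := (-(1 / 4) : ℂ) • P α u) (fun θ => by
    rw [inner_tzb_Dzb, inner_smul_right]; ring) φ
  have k4 := isWeakDz_mul (inner_tzb_incl u) (tzb (-α) φ)
  have hv : ∀ᵐ z : ℂ, ‖z‖ < δ ∨ R < ‖z‖ → mulL φ (incl α u) z = 0 := by
    filter_upwards [mulL_coe φ (incl α u)] with z hz h
    rw [hz, hφ z h, zero_mul]
  have key := mem_closure_of_weak (α := α) hδ hv k1 k2 (k3.add k4) hm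
  have hc : ∀ g : ℂ → ℂ, Vanishes δ R g → ∀ z, chi m z * g z = g z := by
    intro g hg z
    by_cases hz : δ ≤ ‖z‖ ∧ ‖z‖ ≤ R
    · rw [hm z (by linarith [hz.1]) (by linarith [hz.2]), one_mul]
    · rw [hg z (by by_contra h; push Not at h; exact hz h), mul_zero]
  have e1 : dzT φ = tz (-α) φ + mulT _ (Test.smoothOff (coefT α m).2) φ :=
    Test.ext_off fun z hz => by
      change dz φ z = Tz (-α) φ z + α / (2 * z) * chi m z * (φ : ℂ → ℂ) z
      rw [mul_assoc, hc _ hφ z, Tz]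
      push_cast; ring
  have e2 : dzbarT φ = tzb (-α) φ - mulT _ (Test.smoothOff (coefConjT α m).2) φ :=
    Test.ext_off fun z hz => by
      change dzbar φ z = Tzb (-α) φ z - α / (2 * conj z) * chi m z * (φ : ℂ → ℂ) z
      rw [mul_assoc, hc _ hφ z, Tzb]
      push_cast; ring
  have e3 : dzT (dzbarT φ) = tz (-α) (tzb (-α) φ) +
      mulT _ (Test.smoothOff (coefT α m).2) (tzb (-α) φ) -
      mulT _ (Test.smoothOff (coefConjT α m).2) (tz (-α) φ) -
      mulT _ (Test.smoothOff (coefSqT α m).2) φ :=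
    Test.ext_off fun z hz => by
      change dz (dzbar φ) z = Tz (-α) (Tzb (-α) φ) z + α / (2 * z) * chi m z * Tzb (-α) φ z -
        α / (2 * conj z) * chi m z * Tz (-α) φ z -
        α / (2 * z) * (α / (2 * conj z)) * chi m z * (φ : ℂ → ℂ) z
      have c1 := hc _ (hφ.tz (β := -α)) z
      have c2 := hc _ (hφ.tzb (β := -α)) z
      rw [tz_coe] at c1
      rw [tzb_coe] at c2
      have hz' : conj z ≠ 0 := (map_ne_zero _).2 hz
      rw [mul_assoc (_ / _) (chi m z), mul_assoc (_ / _) (chi m z), mul_assoc (_ * _) (chi m z),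
        c1, c2, hc _ hφ z, Tz_Tzb_expand _ (Test.smoothOff φ.2) hz, Tz, Tzb]
      push_cast
      field_simp
      ring
  convert key using 2
  rw [e3, e1, e2]
  simp only [mulL_add_left, mulL_sub_left, map_add, map_smul, mulL_mulL, smul_add, smul_sub,
    smul_smul]
  module

/-- The product of an element of the Friedrichs domain and a test function. -/
def prodD2 (u : D2 α) (φ : Test) : D2 α := ⟨_, closure_minGraph_le α (mul_mem_closure u φ)⟩

theorem prodD2_mem (u : D2 α) (φ : Test) : prodD2 u φ ∈ minDomain α := mul_mem_closure u φ

/-! ## Elements of the Friedrichs domain that decay at the origin -/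

theorem chi_norm (n : ℕ) (z : ℂ) : chi n (‖z‖ : ℂ) = chi n z := by
  by_cases hz : z = 0
  · simp [hz]
  · have : (‖z‖ : ℂ) ≠ 0 := by exact_mod_cast norm_ne_zero_iff.2 hz
    rw [chi, offZero_apply _ hz, offZero_apply _ this, Complex.norm_real, norm_norm]

theorem rpw_norm (a : ℝ) (z : ℂ) : rpw a (‖z‖ : ℂ) = rpw a z := by
  simp only [rpw, Complex.norm_real, norm_norm]

theorem enorm_mulL_toL2_sq (φ ψ : Test) :
    ‖mulL φ (toL2 ψ)‖ₑ ^ 2 = ∫⁻ z, ‖(φ : ℂ → ℂ) z * (ψ : ℂ → ℂ) z‖ₑ ^ 2 :=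
  enorm_sq_Lp (by
    filter_upwards [mulL_coe φ (toL2 ψ), toL2_coe ψ] with z h1 h2
    rw [h1, h2])

/-- The test function `χ_n r^a`. -/
def powT (a : ℝ) (n : ℕ) : Test := mulT (rpw a) (rpw_smoothOff a) ⟨chi n, chi_mem n⟩

theorem powT_apply (a : ℝ) (n : ℕ) (z : ℂ) : (powT a n : ℂ → ℂ) z = rpw a z * chi n z := rfl

/-- `hardy` with the weight |χ_n r^{-2}|², which is bounded, so the inequality passes from test
functions to u. The constant does not depend on n. -/
theorem weighted_hardy (hα : ∀ n : ℤ, α ≠ n) : ∃ C : ENNReal, C ≠ ⊤ ∧ ∀ (n : ℕ) (u : D2 α),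
    ‖mulL (powT (-2) n) (incl α u)‖ₑ ^ 2 ≤
      C * (‖mulL (powT (-1) n) (Dz α u)‖ₑ ^ 2 + ‖mulL (powT (-1) n) (Dzb α u)‖ₑ ^ 2) := by
  obtain ⟨C, hC, h⟩ := hardy hα
  refine ⟨C, hC, fun n u => ?_⟩
  have hm : Measurable fun r : ℝ => ‖(powT (-2) n : ℂ → ℂ) r‖ₑ ^ 2 :=
    (((powT (-2) n).2.1.continuous.measurable.comp Complex.measurable_ofReal).enorm).pow_const 2
  have hr : ∀ z : ℂ, (powT (-2) n : ℂ → ℂ) (‖z‖ : ℂ) = (powT (-2) n : ℂ → ℂ) z := fun z => by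
    rw [powT_apply, powT_apply, chi_norm, rpw_norm]
  have key : ∀ φ : Test, ‖mulL (powT (-2) n) (toL2 φ)‖ₑ ^ 2 ≤
      C * (‖mulL (powT (-1) n) (toL2 (tz α φ))‖ₑ ^ 2 +
        ‖mulL (powT (-1) n) (toL2 (tzb α φ))‖ₑ ^ 2) := by
    intro φ
    have h1 := h φ _ hm
    simp only [hr] at h1
    rw [enorm_mulL_toL2_sq, enorm_mulL_toL2_sq, enorm_mulL_toL2_sq]
    simp only [enorm_mul, mul_pow]
    refine h1.trans_eq ?_
    congr 1
    have hme : ∀ ψ : Test, Measurable fun z => ‖(ψ : ℂ → ℂ) z‖ₑ ^ 2 := fun ψ =>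
      ψ.2.1.continuous.measurable.enorm.pow_const 2
    rw [← lintegral_add_left (f := fun z => ‖(powT (-1) n : ℂ → ℂ) z‖ₑ ^ 2 *
      ‖(tz α φ : ℂ → ℂ) z‖ₑ ^ 2) ((hme _).mul (hme _))]
    refine lintegral_congr_ae (ae_ne_zero.mono fun z hz => ?_)
    have e : ‖(powT (-2) n : ℂ → ℂ) z‖ₑ ^ 2 * ‖z‖ₑ ^ 2 = ‖(powT (-1) n : ℂ → ℂ) z‖ₑ ^ 2 := by
      rw [← mul_pow, ← enorm_norm z]
      congr 1
      rw [powT_apply, powT_apply, ← enorm_norm (rpw (-2) z * chi n z), ← enorm_mul, norm_mul,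
        mul_right_comm, norm_rpw _ hz, ← enorm_norm (rpw (-1) z * chi n z), norm_mul, norm_rpw _ hz]
      congr 2
      rw [← Real.rpow_add_one (norm_ne_zero_iff.2 hz)]
      norm_num
    simp only [tz_coe, tzb_coe]
    rw [e, mul_add]
  have hcont : ∀ ψ : Test, Continuous fun v : L2 => ‖mulL ψ v‖ₑ ^ 2 := fun ψ =>
    (ENNReal.continuous_pow 2).comp (continuous_enorm.comp (mulL ψ).continuous)
  refine le_of_tendsto_of_tendsto' (((hcont _).tendsto _).comp (tendsto_approx u))
    (ENNReal.Tendsto.const_mul ((((hcont _).tendsto _).comp (tendsto_tz_approx u)).add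
      (((hcont _).tendsto _).comp (tendsto_tzb_approx u))) (Or.inr hC)) fun n => key _

theorem enorm_powT_neg_one_le (n : ℕ) (g : L2) : ‖mulL (powT (-1) n) g‖ₑ ≤
    eLpNorm (fun z => g z / ‖z‖) 2 (volume : Measure ℂ) := by
  rw [Lp.enorm_def]
  refine eLpNorm_mono_ae ?_
  filter_upwards [mulL_coe (powT (-1) n) g, ae_ne_zero] with z h hz
  rw [h, powT_apply, norm_mul, norm_mul, norm_rpw _ hz, Real.rpow_neg_one, norm_div,
    Complex.norm_real, norm_norm, div_eq_inv_mul]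
  gcongr
  exact mul_le_of_le_one_right (by positivity) (norm_chi_le n z)

theorem memLp_div_sq (hα : ∀ n : ℤ, α ≠ n) {u : D2 α}
    (hg : MemLp (fun z => Dz α u z / ‖z‖) 2 (volume : Measure ℂ))
    (hk : MemLp (fun z => Dzb α u z / ‖z‖) 2 (volume : Measure ℂ)) :
    MemLp (fun z => incl α u z / ‖z‖ / ‖z‖) 2 (volume : Measure ℂ) := by
  obtain ⟨C, hC, h⟩ := weighted_hardy hα
  set K := C * (eLpNorm (fun z => Dz α u z / ‖z‖) 2 (volume : Measure ℂ) ^ 2 +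
    eLpNorm (fun z => Dzb α u z / ‖z‖) 2 (volume : Measure ℂ) ^ 2) with hKd
  have hK : K < ⊤ := ENNReal.mul_lt_top hC.lt_top
    (ENNReal.add_lt_top.2 ⟨ENNReal.pow_lt_top hg.2, ENNReal.pow_lt_top hk.2⟩)
  refine memLp_of_tendsto_ae (F := fun n z => (powT (-2) n : ℂ → ℂ) z * incl α u z)
    (K := max 1 K) (fun n => (memLp_test_mul _ _).1) ?_ (max_lt ENNReal.one_lt_top hK) fun n => ?_
  · filter_upwards [ae_ne_zero] with z hz
    have h1 : Tendsto (fun n => (powT (-2) n : ℂ → ℂ) z * incl α u z) atTop _ :=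
      ((tendsto_chi hz).const_mul (rpw (-2) z)).mul_const (incl α u z)
    have e : rpw (-2) z * 1 * incl α u z = incl α u z / ‖z‖ / ‖z‖ := by
      rw [rpw_eq _ hz, show (-2 : ℝ) = -1 + -1 by norm_num,
        Real.rpow_add (norm_pos_iff.2 hz), Real.rpow_neg_one]
      push_cast
      ring
    rwa [e] at h1
  · rw [← eLpNorm_congr_ae (mulL_coe _ _), ← Lp.enorm_def]
    have h1 : ‖mulL (powT (-2) n) (incl α u)‖ₑ ^ 2 ≤ K := by
      refine (h n u).trans ?_
      rw [hKd]
      gcongr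
      · exact enorm_powT_neg_one_le n _
      · exact enorm_powT_neg_one_le n _
    -- The square of the norm is at most K, and x² ≤ K implies x ≤ max 1 K without a square root.
    by_cases hx : ‖mulL (powT (-2) n) (incl α u)‖ₑ ≤ 1
    · exact hx.trans (le_max_left _ _)
    · refine le_trans ?_ (h1.trans (le_max_right _ _))
      rw [sq]
      exact le_mul_of_one_le_left' (not_le.1 hx).le

/-- χ_n u lies in the closure domain and tends to u in the graph norm: each extra term of P(χ_n u)
is r ∂χ_n times a first derivative of u over r, or r² ∂_z∂_z̄ χ_n times u/r². -/
theorem mem_minDomain_of_div (hα : ∀ n : ℤ, α ≠ n) {u : D2 α}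
    (hg : MemLp (fun z => Dz α u z / ‖z‖) 2 (volume : Measure ℂ))
    (hk : MemLp (fun z => Dzb α u z / ‖z‖) 2 (volume : Measure ℂ)) : u ∈ minDomain α := by
  have hu := memLp_div_sq hα hg hk
  obtain ⟨K, hK⟩ := chi_deriv_bound
  set X : ℕ → Test := fun n => ⟨chi n, chi_mem n⟩
  have t0 : ∀ v : L2, Tendsto (fun n => mulL (X n) v) atTop (𝓝 v) := fun v =>
    tendsto_mul_L2 (m := chi) (m₀ := fun _ => 1) (f := v) (B := 1) (Lp.memLp v)
      (fun n => (chi_mem n).1.continuous.aestronglyMeasurable)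
      (fun n => Filter.Eventually.of_forall fun z => norm_chi_le n z)
      (ae_ne_zero.mono fun z hz => tendsto_chi hz) (fun n => mulL_coe (X n) v) (by simp)
  have t1 : Tendsto (fun n => mulL (dzT (X n)) (Dzb α u)) atTop (𝓝 0) :=
    tendsto_commutator_term (fun n => Test.smoothOff (dzT (X n)).2) (fun n z hz => (hK n z hz).1) hk
      (fun n => mulL_coe _ _)
  have t2 : Tendsto (fun n => mulL (dzbarT (X n)) (Dz α u)) atTop (𝓝 0) :=
    tendsto_commutator_term (fun n => Test.smoothOff (dzbarT (X n)).2)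
      (fun n z hz => (hK n z hz).2.1) hg (fun n => mulL_coe _ _)
  have t3 : Tendsto (fun n => mulL (dzT (dzbarT (X n))) (incl α u)) atTop (𝓝 0) := by
    -- `tendsto_commutator_term` supplies one factor 1/r only; the other is built into f = u/r and
    -- compensated by the factor r in D.
    refine tendsto_commutator_term (D := fun n z => rpw 1 z * dz (dzbar (chi n)) z)
      (K := K) (f := fun z => incl α u z / ‖z‖)
      (fun n => (rpw_smoothOff 1).mul (Test.smoothOff (dzT (dzbarT (X n))).2))
      (fun n z hz => ?_) hu (fun n => ?_)
    · rw [norm_mul, norm_rpw _ hz, Real.rpow_one]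
      exact (by ring : ‖z‖ * ‖dz (dzbar (chi n)) z‖ * ‖z‖ = ‖dz (dzbar (chi n)) z‖ * ‖z‖ ^ 2).trans_le
        (hK n z hz).2.2
    · filter_upwards [mulL_coe (dzT (dzbarT (X n))) (incl α u), ae_ne_zero] with z h hz
      have : (‖z‖ : ℂ) ≠ 0 := by exact_mod_cast norm_ne_zero_iff.2 hz
      rw [h, rpw_eq _ hz, Real.rpow_one]
      change dz (dzbar (chi n)) z * _ = _
      field_simp
  have hlim := (t0 (incl α u)).prodMk_nhds ((t0 (P α u)).add
    (((t1.add t2).add t3).const_smul (-4 : ℂ)))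
  rw [add_zero, add_zero, smul_zero, add_zero] at hlim
  exact mem_closure_of_tendsto (s := ((minGraph α).topologicalClosure : Set (L2 × L2))) hlim
    (Filter.Eventually.of_forall fun n => mul_mem_closure u (X n)) |> fun h => by
      rwa [(minGraph α).isClosed_topologicalClosure.closure_eq] at h

/-! ## The singular functions and the coefficient functionals -/

/-- The cutoff vanishes from r = e on; 3 is a bound for e. -/
theorem sig_eq_zero {z : ℂ} (hz : 3 < ‖z‖) : sig z = 0 := by
  have : 1 ≤ Real.log ‖z‖ := by
    rw [Real.le_log_iff_exp_le (by linarith)]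
    linarith [Real.exp_one_lt_d9]
  rw [sig, stp_of_one_le this, Complex.ofReal_zero]

theorem sig_near_one {z : ℂ} (hz : ‖z‖ < 1) : sig =ᶠ[𝓝 z] fun _ => 1 := by
  filter_upwards [(isOpen_lt continuous_norm continuous_const).mem_nhds hz] with w hw
  exact sig_eq_one (le_of_lt hw)

theorem sig_near_zero {z : ℂ} (hz : 3 < ‖z‖) : sig =ᶠ[𝓝 z] fun _ => 0 := by
  filter_upwards [(isOpen_lt continuous_const continuous_norm).mem_nhds hz] with w hw
  exact sig_eq_zero hw

theorem conj_sig (z : ℂ) : conj (sig z) = sig z := Complex.conj_ofReal _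

theorem dz_sig {z : ℂ} (hz : z ≠ 0) : dz sig z = (deriv stp (Real.log ‖z‖) : ℝ) / (2 * z) :=
  dz_radial hz (stp_contDiff.differentiable (by simp) _)

theorem dzbar_sig {z : ℂ} (hz : z ≠ 0) :
    dzbar sig z = (deriv stp (Real.log ‖z‖) : ℝ) / (2 * conj z) :=
  dzbar_radial hz (stp_contDiff.differentiable (by simp) _)

/-- The test function `(∂_z σ) f`. -/
def dzSig (f : ℂ → ℂ) (hf : SmoothOff f) : Test :=
  ⟨offZero fun z => dz sig z * f z, offZero_mem_Test (sig_smoothOff.dz.mul hf) one_pos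
    (fun z _ hz => by rw [dz_congr (sig_near_one hz), dz_const, zero_mul])
    (fun z _ hz => by rw [dz_congr (sig_near_zero hz), dz_const, zero_mul])⟩

/-- The test function `(∂_z̄ σ) f`. -/
def dzbarSig (f : ℂ → ℂ) (hf : SmoothOff f) : Test :=
  ⟨offZero fun z => dzbar sig z * f z, offZero_mem_Test (sig_smoothOff.dzbar.mul hf) one_pos
    (fun z _ hz => by rw [dzbar_congr (sig_near_one hz), dzbar_const, zero_mul])
    (fun z _ hz => by rw [dzbar_congr (sig_near_zero hz), dzbar_const, zero_mul])⟩

theorem dzSig_apply {f : ℂ → ℂ} (hf : SmoothOff f) {z : ℂ} (hz : z ≠ 0) :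
    (dzSig f hf : ℂ → ℂ) z = dz sig z * f z := offZero_apply (fun z => dz sig z * f z) hz

theorem dzbarSig_apply {f : ℂ → ℂ} (hf : SmoothOff f) {z : ℂ} (hz : z ≠ 0) :
    (dzbarSig f hf : ℂ → ℂ) z = dzbar sig z * f z := offZero_apply (fun z => dzbar sig z * f z) hz

theorem dzSig_ae (f : ℂ → ℂ) (hf : SmoothOff f) :
    toL2 (dzSig f hf) =ᵐ[volume] fun z => dz sig z * f z :=
  (toL2_coe _).trans (offZero_ae _)

theorem dzbarSig_ae (f : ℂ → ℂ) (hf : SmoothOff f) :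
    toL2 (dzbarSig f hf) =ᵐ[volume] fun z => dzbar sig z * f z :=
  (toL2_coe _).trans (offZero_ae _)

/-! ### Square integrability of cut-off powers of r. -/

theorem memLp_of_near {γ B : ℝ} (h0 : 0 < γ) (h1 : γ < 1) {f : ℂ → ℂ} (hf : SmoothOff f)
    (hB : ∀ z, z ≠ 0 → ‖z‖ ≤ 3 → ‖f z‖ ≤ B * ‖z‖ ^ (-γ)) (hz : ∀ z, 3 < ‖z‖ → f z = 0) :
    MemLp f 2 (volume : Measure ℂ) := by
  have hB0 : 0 ≤ B := by
    have := hB 1 one_ne_zero (by norm_num)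
    rw [norm_one, Real.one_rpow, mul_one] at this
    exact (norm_nonneg _).trans this
  -- On |z| ≤ 3 the denominator 1 + |z| is at most 4.
  refine memLp_of_weight (M := 4 * B) h0 h1 hf.aestronglyMeasurable fun z hz0 => ?_
  have hp : 0 ≤ ‖z‖ ^ (-γ) := by positivity
  by_cases h3 : ‖z‖ ≤ 3
  · refine (hB z hz0 h3).trans ?_
    rw [← mul_div_assoc, le_div_iff₀ (by positivity)]
    nlinarith [mul_nonneg hB0 hp]
  · rw [hz z (not_le.1 h3), norm_zero]
    positivity

theorem norm_sig_mul_le (f : ℂ → ℂ) (z : ℂ) : ‖sig z * f z‖ ≤ ‖f z‖ := by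
  rw [norm_mul]
  exact mul_le_of_le_one_left (norm_nonneg _) (norm_sig_le z)

theorem memLp_sig_mul {γ : ℝ} (h0 : 0 < γ) (h1 : γ < 1) {f : ℂ → ℂ} (hf : SmoothOff f)
    (hn : ∀ z, z ≠ 0 → ‖f z‖ = ‖z‖ ^ (-γ)) :
    MemLp (fun z => sig z * f z) 2 (volume : Measure ℂ) :=
  memLp_of_near (B := 1) h0 h1 (sig_smoothOff.mul hf)
    (fun z hz _ => (norm_sig_mul_le f z).trans (by rw [hn z hz, one_mul]))
    (fun z hz => by rw [sig_eq_zero hz, zero_mul])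

theorem memLp_sig_mul' {γ : ℝ} (h0 : 0 < γ) (h1 : γ < 1) {f : ℂ → ℂ} (hf : SmoothOff f)
    (hn : ∀ z, z ≠ 0 → ‖f z‖ = ‖z‖ ^ (1 - γ)) :
    MemLp (fun z => sig z * f z) 2 (volume : Measure ℂ) ∧
      MemLp (fun z => sig z * f z / ‖z‖) 2 (volume : Measure ℂ) := by
  have hn' : ∀ z, z ≠ 0 → ‖f z‖ = ‖z‖ * ‖z‖ ^ (-γ) := fun z hz => by
    rw [hn z hz, sub_eq_add_neg, Real.rpow_add (norm_pos_iff.2 hz), Real.rpow_one]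
  refine ⟨memLp_of_near (B := 3) h0 h1 (sig_smoothOff.mul hf) (fun z hz h3 => ?_)
    (fun z hz => by rw [sig_eq_zero hz, zero_mul]), ?_⟩
  · refine (norm_sig_mul_le f z).trans ?_
    rw [hn' z hz]
    exact mul_le_mul_of_nonneg_right h3 (by positivity)
  · have h := memLp_of_near (B := 1) (f := fun z => sig z * (rpw (-1) z * f z)) h0 h1
      (sig_smoothOff.mul ((rpw_smoothOff (-1)).mul hf))
      (fun z hz _ => (norm_sig_mul_le (fun w => rpw (-1) w * f w) z).trans (by
        rw [norm_mul, norm_rpw _ hz, hn' z hz, Real.rpow_neg_one, ← mul_assoc,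
          inv_mul_cancel₀ (norm_ne_zero_iff.2 hz)]))
      (fun z hz => by rw [sig_eq_zero hz, zero_mul])
    refine (memLp_congr_ae (ae_ne_zero.mono fun z hz => ?_)).1 h
    rw [rpw_eq _ hz, Real.rpow_neg_one]
    push_cast
    ring

/-- The function `r^α / z`, annihilated by `T_z̄`. -/
def sing (α : ℝ) (z : ℂ) : ℂ := rpw α z * z⁻¹

/-- The function `r^{1-α} e^{-iθ} = r^{-α} z̄`, annihilated by `T_z`. -/
def mode (α : ℝ) (z : ℂ) : ℂ := rpw (-α) z * conj z

theorem sing_smoothOff (α : ℝ) : SmoothOff (sing α) :=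
  (rpw_smoothOff α).mul (SmoothOff.id.inv fun _ h => h)

theorem mode_smoothOff (α : ℝ) : SmoothOff (mode α) := (rpw_smoothOff (-α)).mul SmoothOff.id.star

theorem norm_sing {z : ℂ} (hz : z ≠ 0) : ‖sing α z‖ = ‖z‖ ^ (-(1 - α)) := by
  rw [sing, norm_mul, norm_rpw _ hz, norm_inv, ← Real.rpow_neg_one, ← Real.rpow_add
    (norm_pos_iff.2 hz)]
  congr 1; ring

theorem norm_mode {z : ℂ} (hz : z ≠ 0) : ‖mode α z‖ = ‖z‖ ^ (1 - α) := by
  rw [mode, norm_mul, norm_rpw _ hz, Complex.norm_conj, ← Real.rpow_add_one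
    (norm_ne_zero_iff.2 hz)]
  congr 1; ring

/-- T_z̄ kills r^α times any function holomorphic off 0, and T_z kills r^{-α} times any
antiholomorphic one. Here the holomorphic factor is 1/z, the pole of lowest order. -/
theorem Tzb_sing {z : ℂ} (hz : z ≠ 0) : Tzb α (sing α) z = 0 := by
  have hi := SmoothOff.id.inv (fun _ h => h)
  rw [show sing α = fun w => w⁻¹ * rpw α w from funext fun w => mul_comm _ _,
    Tzb_mul α (hi.differentiableAt hz) ((rpw_smoothOff α).differentiableAt hz),
    (hasDerivAt_dz (hasDerivAt_inv hz)).2, Tzb, dzbar_rpw α hz]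
  ring

theorem Tz_rpw_neg {z : ℂ} (hz : z ≠ 0) : Tz α (rpw (-α)) z = 0 := by
  rw [Tz, dz_rpw _ hz]; push_cast; ring

theorem Tzb_rpw {z : ℂ} (hz : z ≠ 0) : Tzb α (rpw α) z = 0 := by
  rw [Tzb, dzbar_rpw _ hz]; ring

theorem Tz_rpw {z : ℂ} (hz : z ≠ 0) : Tz α (rpw α) z = α * sing α z := by
  rw [Tz, dz_rpw _ hz, sing]; ring

theorem dz_conj_id (z : ℂ) : dz (fun w => conj w) z = 0 := by
  rw [dz_conj (f := fun w => w) differentiableAt_id,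
    (hasDerivAt_dz (f := fun w => w) (hasDerivAt_id z)).2, map_zero]

theorem dzbar_conj_id (z : ℂ) : dzbar (fun w => conj w) z = 1 := by
  rw [dzbar_conj (f := fun w => w) differentiableAt_id,
    (hasDerivAt_dz (f := fun w => w) (hasDerivAt_id z)).1, map_one]

theorem Tz_mode {z : ℂ} (hz : z ≠ 0) : Tz α (mode α) z = 0 := by
  rw [show mode α = fun w => conj w * rpw (-α) w from funext fun w => mul_comm _ _,
    Tz_mul α (SmoothOff.id.star.differentiableAt hz) ((rpw_smoothOff _).differentiableAt hz),
    Tz_rpw_neg hz, dz_conj_id]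
  ring

theorem Tzb_mode {z : ℂ} (hz : z ≠ 0) : Tzb α (mode α) z = (1 - α) * rpw (-α) z := by
  have hz' : conj z ≠ 0 := (map_ne_zero _).2 hz
  rw [show mode α = fun w => conj w * rpw (-α) w from funext fun w => mul_comm _ _,
    Tzb_mul α (SmoothOff.id.star.differentiableAt hz) ((rpw_smoothOff _).differentiableAt hz),
    dzbar_conj_id, Tzb, dzbar_rpw _ hz]
  push_cast
  field_simp
  ring

theorem Tz_sig_mul (α : ℝ) {f : ℂ → ℂ} (hf : SmoothOff f) {z : ℂ} (hz : z ≠ 0) :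
    Tz α (fun w => sig w * f w) z = dz sig z * f z + sig z * Tz α f z :=
  Tz_mul α (sig_smoothOff.differentiableAt hz) (hf.differentiableAt hz)

theorem Tzb_sig_mul (α : ℝ) {f : ℂ → ℂ} (hf : SmoothOff f) {z : ℂ} (hz : z ≠ 0) :
    Tzb α (fun w => sig w * f w) z = dzbar sig z * f z + sig z * Tzb α f z :=
  Tzb_mul α (sig_smoothOff.differentiableAt hz) (hf.differentiableAt hz)

/-- `σ r^α / z` as an element of `L²`. -/
def singL (h0 : 0 < α) (h1 : α < 1) : L2 :=
  (memLp_sig_mul (γ := 1 - α) (by linarith) (by linarith) (sing_smoothOff α)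
    fun _ hz => norm_sing hz).toLp

/-- `σ r^{-α}` as an element of `L²`. -/
def powL (h0 : 0 < α) (h1 : α < 1) : L2 :=
  (memLp_sig_mul (γ := α) h0 h1 (rpw_smoothOff (-α)) fun _ hz => norm_rpw _ hz).toLp

section

variable (h0 : 0 < α) (h1 : α < 1)

theorem singL_ae : singL h0 h1 =ᵐ[volume] fun z => sig z * sing α z := MemLp.coeFn_toLp _

theorem powL_ae : powL h0 h1 =ᵐ[volume] fun z => sig z * rpw (-α) z := MemLp.coeFn_toLp _

/-- T_z of σ r^{-α} is just the cutoff term (∂_z σ) r^{-α}, since ψ does not see the origin. The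
same identity with T_z u in place of ψ, for u in the Friedrichs domain, can fail; `bdryZero`
measures the failure. -/
theorem inner_tzb_powL (ψ : Test) :
    ⟪toL2 (tzb α ψ), powL h0 h1⟫_ℂ = -⟪toL2 ψ, toL2 (dzSig _ (rpw_smoothOff (-α)))⟫_ℂ := by
  rw [inner_eq_of_ae _ (powL_ae h0 h1), inner_eq_of_ae _ (dzSig_ae _ _), tzb_coe,
    Tzb_parts α ψ (sig_smoothOff.mul (rpw_smoothOff _))]
  congr 1
  refine integral_congr_ae (ae_ne_zero.mono fun z hz => ?_)
  simp only [Tz_sig_mul α (rpw_smoothOff _) hz, Tz_rpw_neg hz, mul_zero, add_zero]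

theorem inner_tz_singL (ψ : Test) :
    ⟪toL2 (tz α ψ), singL h0 h1⟫_ℂ = -⟪toL2 ψ, toL2 (dzbarSig _ (sing_smoothOff α))⟫_ℂ := by
  rw [inner_eq_of_ae _ (singL_ae h0 h1), inner_eq_of_ae _ (dzbarSig_ae _ _), tz_coe,
    Tz_parts α ψ (sig_smoothOff.mul (sing_smoothOff _))]
  congr 1
  refine integral_congr_ae (ae_ne_zero.mono fun z hz => ?_)
  simp only [Tzb_sig_mul α (sing_smoothOff _) hz, Tzb_sing hz, mul_zero, add_zero]

/-- The boundary pairing that detects `r^α`. -/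
def bdryZero : Dminus2 α :=
  transpose (Dz α) (toL2 (dzSig _ (rpw_smoothOff (-α)))) - (1 / 4 : ℂ) • transpose (P α) (powL h0 h1)

/-- The boundary pairing that detects `r^{1-α} e^{-iθ}`. -/
def bdryOne : Dminus2 α :=
  transpose (Dzb α) (toL2 (dzbarSig _ (sing_smoothOff α))) -
    (1 / 4 : ℂ) • transpose (P α) (singL h0 h1)

/-- This is ⟪T_z(σ r^{-α}), T_z u⟫ + ⟪σ r^{-α}, T_z̄ T_z u⟫, with T_z̄ T_z u = -P u / 4: the defect
of integration by parts at the origin. -/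
theorem pairing_bdryZero (u : D2 α) : pairing (bdryZero h0 h1) u =
    ⟪toL2 (dzSig _ (rpw_smoothOff (-α))), Dz α u⟫_ℂ - 1 / 4 * ⟪powL h0 h1, P α u⟫_ℂ := by
  change conj (⟪Dz α u, _⟫_ℂ - (1 / 4 : ℂ) * ⟪P α u, _⟫_ℂ) = _
  rw [map_sub, map_mul, inner_conj_symm, inner_conj_symm]
  simp [Complex.conj_ofNat]

theorem pairing_bdryOne (u : D2 α) : pairing (bdryOne h0 h1) u =
    ⟪toL2 (dzbarSig _ (sing_smoothOff α)), Dzb α u⟫_ℂ - 1 / 4 * ⟪singL h0 h1, P α u⟫_ℂ := by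
  change conj (⟪Dzb α u, _⟫_ℂ - (1 / 4 : ℂ) * ⟪P α u, _⟫_ℂ) = _
  rw [map_sub, map_mul, inner_conj_symm, inner_conj_symm]
  simp [Complex.conj_ofNat]

theorem continuous_pairing (L : Dminus2 α) : Continuous (pairing L) :=
  Complex.continuous_conj.comp L.continuous

/-- The defect is zero on test functions and continuous in the graph norm. -/
theorem pairing_bdryZero_eq_zero {u : D2 α} (hu : u ∈ minDomain α) :
    pairing (bdryZero h0 h1) u = 0 :=
  eq_zero_of_mem_minDomain (continuous_pairing _) (fun φ => by
    have h := congrArg conj (inner_tzb_powL h0 h1 (tz α φ))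
    rw [map_neg, inner_conj_symm, inner_conj_symm] at h
    rw [pairing_bdryZero, Dz_testD2, P_testD2, ham_eq, map_smul, inner_smul_right, h]
    ring) hu

theorem pairing_bdryOne_eq_zero {u : D2 α} (hu : u ∈ minDomain α) :
    pairing (bdryOne h0 h1) u = 0 :=
  eq_zero_of_mem_minDomain (continuous_pairing _) (fun φ => by
    have h := congrArg conj (inner_tz_singL h0 h1 (tzb α φ))
    rw [map_neg, inner_conj_symm, inner_conj_symm] at h
    rw [pairing_bdryOne, Dzb_testD2, P_testD2, ham_eq', map_smul, inner_smul_right, h]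
    ring) hu

theorem ne_intCast (h0 : 0 < α) (h1 : α < 1) :
    (∀ n : ℤ, α ≠ n) ∧ (∀ n : ℤ, α + 1 ≠ n) ∧ ∀ n : ℤ, -α + 1 ≠ n := by
  have key : ∀ n : ℤ, α ≠ n := fun n h => by
    rw [h] at h0 h1
    have a1 : (0 : ℤ) < n := by exact_mod_cast h0
    have a2 : n < (1 : ℤ) := by exact_mod_cast h1
    omega
  refine ⟨key, fun n h => key (n - 1) ?_, fun n h => key (1 - n) ?_⟩
  · push_cast; linarith
  · push_cast; linarith

/-- The vanishing defects are the boundary hypotheses for T_z u with μ = r^{-α} and for T_z̄ u with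
μ = r^α/z, of sizes r^{-α} and r^{-(1-α)}. Both exponents are strictly between 0 and 1, and the
shifted fluxes 1 - α and 1 + α are not integers. -/
theorem mem_minDomain_of_pairing {u : D2 α} (hu0 : pairing (bdryZero h0 h1) u = 0)
    (hu1 : pairing (bdryOne h0 h1) u = 0) : u ∈ minDomain α := by
  obtain ⟨k1, k2, k3⟩ := ne_intCast h0 h1
  rw [pairing_bdryZero] at hu0
  rw [pairing_bdryOne] at hu1
  refine mem_minDomain_of_div k1 ?_ ?_
  · exact memLp_div_of_weak_Tz (rpw_smoothOff (-α)) (fun z hz => Tz_rpw_neg hz)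
      (fun z hz => norm_rpw _ hz) h0 h1 k3 (powL_ae h0 h1) (dzSig_ae _ _)
      (h := (-(1 / 4) : ℂ) • P α u) (fun φ => by rw [inner_tz_Dz, inner_smul_right]; ring)
      (by rw [inner_smul_right]; linear_combination hu0)
  · exact memLp_div_of_weak_Tzb (sing_smoothOff α) (fun z hz => Tzb_sing hz)
      (fun z hz => norm_sing hz) (by linarith) (by linarith) k2 (singL_ae h0 h1) (dzbarSig_ae _ _)
      (h := (-(1 / 4) : ℂ) • P α u) (fun φ => by rw [inner_tzb_Dzb, inner_smul_right]; ring)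
      (by rw [inner_smul_right]; linear_combination hu1)

end

/-! ## The two model elements -/

theorem hasDerivAt_stp_sq {y : ℝ} (hy : y ≠ 0) : HasDerivAt (fun y => stp (Real.log y) ^ 2 / 2)
    (stp (Real.log y) * deriv stp (Real.log y) / y) y := by
  have h1 := ((stp_contDiff.differentiable (by simp) (Real.log y)).hasDerivAt).comp y
    (Real.hasDerivAt_log hy)
  refine ((h1.pow 2).div_const 2).congr_deriv ?_
  simp only [Function.comp_apply]
  field_simp
  ring

theorem deriv_stp_of_neg {t : ℝ} (h : t < 0) : deriv stp t = 0 := by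
  have : stp =ᶠ[𝓝 t] fun _ => 1 := by
    filter_upwards [isOpen_Iio.mem_nhds h] with s hs using stp_of_nonpos (le_of_lt hs)
  rw [this.deriv_eq, deriv_const]

/-- The integrand is the derivative of s(log y)²/2, where s is the step; this primitive falls from
1/2 to 0. At y = 0 it is 1/2 as well, because the default value of log 0 is 0. -/
theorem integral_stp : ∫ y in Set.Ioi (0 : ℝ), stp (Real.log y) * deriv stp (Real.log y) / y =
    -(1 / 2) := by
  have hz : ∀ y : ℝ, |y| < 1 → stp (Real.log y) * deriv stp (Real.log y) / y = 0 := fun y hy => by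
    by_cases h : y = 0
    · simp [h]
    · rw [← Real.log_abs, deriv_stp_of_neg (Real.log_neg (abs_pos.2 h) hy)]
      simp
  have hl : ∀ y : ℝ, 3 ≤ |y| → stp (Real.log y) = 0 := fun y hy => by
    refine stp_of_one_le ?_
    rw [← Real.log_abs, Real.le_log_iff_exp_le (by linarith)]
    linarith [Real.exp_one_lt_d9]
  have hc : Continuous fun y : ℝ => stp (Real.log y) * deriv stp (Real.log y) / y := by
    refine continuous_iff_continuousAt.2 fun y => ?_
    by_cases h : y = 0
    · subst h
      refine (continuousAt_const (y := (0 : ℝ))).congr ?_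
      filter_upwards [Metric.ball_mem_nhds (0 : ℝ) one_pos] with y hy
      exact (hz y (by simpa using hy)).symm
    · exact ((stp_contDiff.continuous.continuousAt.comp (Real.continuousAt_log h)).mul
        ((contDiff_deriv_of_smooth stp_contDiff).continuous.continuousAt.comp
          (Real.continuousAt_log h))).div continuousAt_id h
  have hi := hc.integrable_of_hasCompactSupport (μ := volume) (HasCompactSupport.intro
    (isCompact_closedBall (0 : ℝ) 3) fun y hy => by
      rw [hl y (by simpa using (not_le.1 (by simpa using hy)).le)]; simp)
  have h0 : ContinuousWithinAt (fun y => stp (Real.log y) ^ 2 / 2) (Set.Ici 0) (0 : ℝ) := by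
    refine ContinuousAt.continuousWithinAt ((continuousAt_const (y := (1 / 2 : ℝ))).congr ?_)
    filter_upwards [Metric.ball_mem_nhds (0 : ℝ) one_pos] with y hy
    rw [stp_of_nonpos]
    · norm_num
    · rw [← Real.log_abs]
      exact Real.log_nonpos (abs_nonneg _) (le_of_lt (by simpa using hy))
  have h := integral_Ioi_of_hasDerivAt_of_tendsto (m := (0 : ℝ)) h0
    (fun y hy => hasDerivAt_stp_sq (ne_of_gt hy)) hi.integrableOn
    (tendsto_const_nhds.congr' (by
      filter_upwards [eventually_ge_atTop 3] with y hy
      rw [hl y (hy.trans (le_abs_self y))]; norm_num))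
  rw [h, Real.log_zero, stp_of_nonpos le_rfl]
  norm_num

theorem integral_sig_dz_sig :
    ∫ z : ℂ, ((stp (Real.log ‖z‖) * deriv stp (Real.log ‖z‖) / ‖z‖ ^ 2 : ℝ) : ℂ) = -Real.pi := by
  rw [integral_complex_ofReal]
  have h := integral_fun_norm_addHaar (volume : Measure ℂ)
    (fun r : ℝ => stp (Real.log r) * deriv stp (Real.log r) / r ^ 2)
  rw [h]
  have e : ∫ y in Set.Ioi (0 : ℝ), y ^ (Module.finrank ℝ ℂ - 1) •
      (stp (Real.log y) * deriv stp (Real.log y) / y ^ 2) = -(1 / 2) := by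
    rw [← integral_stp]
    refine setIntegral_congr_fun measurableSet_Ioi fun y hy => ?_
    have : y ≠ 0 := ne_of_gt hy
    simp only [Complex.finrank_real_complex, smul_eq_mul]
    field_simp
    ring
  rw [e, Measure.real, Complex.volume_ball]
  simp [Complex.finrank_real_complex]
  ring

theorem Tzb_sig_rpw {z : ℂ} (hz : z ≠ 0) :
    Tzb α (fun w => sig w * rpw α w) z = dzbar sig z * rpw α z := by
  rw [Tzb_sig_mul α (rpw_smoothOff α) hz, Tzb_rpw hz, mul_zero, add_zero]

theorem Tz_sig_mode {z : ℂ} (hz : z ≠ 0) :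
    Tz α (fun w => sig w * mode α w) z = dz sig z * mode α z := by
  rw [Tz_sig_mul α (mode_smoothOff α) hz, Tz_mode hz, mul_zero, add_zero]

theorem eventuallyEq_of_ne {f g : ℂ → ℂ} (h : ∀ z, z ≠ 0 → f z = g z) {z : ℂ} (hz : z ≠ 0) :
    f =ᶠ[𝓝 z] g := by
  filter_upwards [isOpen_ne.mem_nhds hz] with w hw using h w hw

/-- T_z̄ kills r^α, so T_z̄ M₀ is a test function, while T_z M₀ contains α σ r^α/z, in L² but too
singular for the form domain. This asymmetry makes one side of `crossForm` vanish and gives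
`bdryOne` on the other. For M₁ the roles of T_z and T_z̄ are exchanged and σ r^{-α} appears. -/
theorem exists_modelZero (h0 : 0 < α) (h1 : α < 1) : ∃ M : D2 α,
    incl α M =ᵐ[volume] (fun z => sig z * rpw α z) ∧
    Dz α M = toL2 (dzSig _ (rpw_smoothOff α)) + (α : ℂ) • singL h0 h1 ∧
    Dzb α M = toL2 (dzbarSig _ (rpw_smoothOff α)) ∧
    P α M = (-4 : ℂ) • toL2 (tz α (dzbarSig _ (rpw_smoothOff α))) := by
  obtain ⟨m1, m2⟩ := memLp_sig_mul' (γ := 1 - α) (by linarith) (by linarith) (rpw_smoothOff α)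
    (fun z hz => by rw [norm_rpw _ hz]; congr 1; ring)
  have hs : SmoothOff fun z => sig z * rpw α z := sig_smoothOff.mul (rpw_smoothOff α)
  have hDz : (toL2 (dzSig _ (rpw_smoothOff α)) + (α : ℂ) • singL h0 h1 : L2) =ᵐ[volume]
      Tz α fun z => sig z * rpw α z := by
    filter_upwards [Lp.coeFn_add (toL2 (dzSig _ (rpw_smoothOff α))) ((α : ℂ) • singL h0 h1),
      Lp.coeFn_smul (α : ℂ) (singL h0 h1), dzSig_ae _ (rpw_smoothOff α), singL_ae h0 h1, ae_ne_zero]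
      with z e1 e2 e3 e4 hz
    rw [e1, Pi.add_apply, e2, Pi.smul_apply, e3, e4, Tz_sig_mul α (rpw_smoothOff α) hz, Tz_rpw hz,
      smul_eq_mul]
    ring
  have hDzb : toL2 (dzbarSig _ (rpw_smoothOff α)) =ᵐ[volume] Tzb α fun z => sig z * rpw α z := by
    filter_upwards [dzbarSig_ae _ (rpw_smoothOff α), ae_ne_zero] with z e1 hz
    rw [e1, Tzb_sig_rpw hz]
  obtain ⟨M, hM, hP⟩ := exists_D2_of_smoothOff (α := α) hs m2 m1.coeFn_toLp hDz
    (w := (-4 : ℂ) • toL2 (tz α (dzbarSig _ (rpw_smoothOff α)))) (by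
      filter_upwards [Lp.coeFn_smul (-4 : ℂ) (toL2 (tz α (dzbarSig _ (rpw_smoothOff α)))),
        toL2_coe (tz α (dzbarSig _ (rpw_smoothOff α))), ae_ne_zero] with z e1 e2 hz
      rw [e1, Pi.smul_apply, e2, tz_coe, smul_eq_mul]
      congr 1
      exact Tz_congr α (eventuallyEq_of_ne (fun w hw => by
        rw [Tzb_sig_rpw hw, dzbarSig_apply _ hw]) hz))
  have hM' : incl α M =ᵐ[volume] fun z => sig z * rpw α z := by rw [hM]; exact m1.coeFn_toLp
  exact ⟨M, hM', Dz_eq_of_smoothOff hs hM' hDz, Dzb_eq_of_smoothOff hs hM' hDzb, hP⟩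

theorem exists_modelOne (h0 : 0 < α) (h1 : α < 1) : ∃ M : D2 α,
    incl α M =ᵐ[volume] (fun z => sig z * mode α z) ∧
    Dz α M = toL2 (dzSig _ (mode_smoothOff α)) ∧
    Dzb α M = toL2 (dzbarSig _ (mode_smoothOff α)) + (1 - α : ℂ) • powL h0 h1 ∧
    P α M = (-4 : ℂ) • toL2 (tzb α (dzSig _ (mode_smoothOff α))) := by
  obtain ⟨m1, m2⟩ := memLp_sig_mul' (γ := α) h0 h1 (mode_smoothOff α) (fun z hz => norm_mode hz)
  have hs : SmoothOff fun z => sig z * mode α z := sig_smoothOff.mul (mode_smoothOff α)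
  have hDzb : (toL2 (dzbarSig _ (mode_smoothOff α)) + (1 - α : ℂ) • powL h0 h1 : L2) =ᵐ[volume]
      Tzb α fun z => sig z * mode α z := by
    filter_upwards [Lp.coeFn_add (toL2 (dzbarSig _ (mode_smoothOff α))) ((1 - α : ℂ) • powL h0 h1),
      Lp.coeFn_smul (1 - α : ℂ) (powL h0 h1), dzbarSig_ae _ (mode_smoothOff α), powL_ae h0 h1,
      ae_ne_zero] with z e1 e2 e3 e4 hz
    rw [e1, Pi.add_apply, e2, Pi.smul_apply, e3, e4, Tzb_sig_mul α (mode_smoothOff α) hz,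
      Tzb_mode hz, smul_eq_mul]
    ring
  have hDz : toL2 (dzSig _ (mode_smoothOff α)) =ᵐ[volume] Tz α fun z => sig z * mode α z := by
    filter_upwards [dzSig_ae _ (mode_smoothOff α), ae_ne_zero] with z e1 hz
    rw [e1, Tz_sig_mode hz]
  obtain ⟨M, hM, hP⟩ := exists_D2_of_smoothOff (α := α) hs m2 m1.coeFn_toLp hDz
    (w := (-4 : ℂ) • toL2 (tzb α (dzSig _ (mode_smoothOff α)))) (by
      filter_upwards [Lp.coeFn_smul (-4 : ℂ) (toL2 (tzb α (dzSig _ (mode_smoothOff α)))),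
        toL2_coe (tzb α (dzSig _ (mode_smoothOff α))), ae_ne_zero] with z e1 e2 hz
      rw [e1, Pi.smul_apply, e2, tzb_coe, smul_eq_mul, Tz_Tzb_comm α hs hz]
      congr 1
      exact Tzb_congr α (eventuallyEq_of_ne (fun w hw => by
        rw [Tz_sig_mode hw, dzSig_apply _ hw]) hz))
  have hM' : incl α M =ᵐ[volume] fun z => sig z * mode α z := by rw [hM]; exact m1.coeFn_toLp
  exact ⟨M, hM', Dz_eq_of_smoothOff hs hM' hDz, Dzb_eq_of_smoothOff hs hM' hDzb, hP⟩

/-- The element `σ r^α` of the Friedrichs domain. -/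
def modelZero (h0 : 0 < α) (h1 : α < 1) : D2 α := (exists_modelZero h0 h1).choose

/-- The element `σ r^{1-α} e^{-iθ}` of the Friedrichs domain. -/
def modelOne (h0 : 0 < α) (h1 : α < 1) : D2 α := (exists_modelOne h0 h1).choose

/-- The sesquilinear form that the commutator with `T_z` defines, up to sign. -/
def crossForm (v u : D2 α) : ℂ := ⟪Dzb α v, P α u⟫_ℂ + ⟪P α v, Dz α u⟫_ℂ

theorem inner_P_test (v : D2 α) (φ : Test) :
    ⟪P α v, toL2 φ⟫_ℂ = 4 * ⟪Dz α v, toL2 (tz α φ)⟫_ℂ ∧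
      ⟪P α v, toL2 φ⟫_ℂ = 4 * ⟪Dzb α v, toL2 (tzb α φ)⟫_ℂ := by
  have e1 := congrArg conj (inner_tz_Dz v φ)
  have e2 := congrArg conj (inner_tzb_Dzb v φ)
  rw [map_mul, inner_conj_symm, inner_conj_symm] at e1 e2
  rw [e1, e2]
  simp [Complex.conj_ofNat]

section

variable (h0 : 0 < α) (h1 : α < 1)

/-- Split T_z M₀ into a test function and α σ r^α/z. The test part cancels in B by integration by
parts against v; the singular part leaves the defect of T_z̄ v. -/
theorem crossForm_modelZero_right (v : D2 α) :
    crossForm v (modelZero h0 h1) = -4 * α * conj (pairing (bdryOne h0 h1) v) := by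
  obtain ⟨hM, hDz, hDzb, hP⟩ := (exists_modelZero h0 h1).choose_spec
  change P α (modelZero h0 h1) = _ at hP
  change Dz α (modelZero h0 h1) = _ at hDz
  change incl α (modelZero h0 h1) =ᵐ[volume] _ at hM
  -- The given formula for P M₀ uses -4 T_z T_z̄. The other factorization, -4 T_z̄ T_z, is needed
  -- here to isolate the cutoff term (∂_z̄ σ) r^α/z of `bdryOne`.
  have hP' : P α (modelZero h0 h1) = (-4 : ℂ) • ((α : ℂ) • toL2 (dzbarSig _ (sing_smoothOff α)) +
      toL2 (tzb α (dzSig _ (rpw_smoothOff α)))) := by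
    refine L2_ext fun φ => ?_
    have a1 := inner_tz_Dz (modelZero h0 h1) φ
    have a2 := inner_tz_singL h0 h1 φ
    have a3 := inner_tz α φ (dzSig _ (rpw_smoothOff α))
    rw [hDz, inner_add_right, inner_smul_right, a2, a3] at a1
    rw [inner_smul_right, inner_add_right, inner_smul_right]
    linear_combination (-4 : ℂ) * a1
  rw [crossForm, hP', hDz, pairing_bdryOne, map_sub, map_mul, inner_conj_symm, inner_conj_symm,
    inner_smul_right, inner_add_right, inner_smul_right, inner_add_right, inner_smul_right,
    (inner_P_test v _).2]
  simp [Complex.conj_ofNat]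
  ring

/-- T_z̄ M₀ is a test function E and P M₀ = -4 T_z E, so the two terms cancel by the weak equation
for u. -/
theorem crossForm_modelZero_left (u : D2 α) : crossForm (modelZero h0 h1) u = 0 := by
  obtain ⟨hM, hDz, hDzb, hP⟩ := (exists_modelZero h0 h1).choose_spec
  change P α (modelZero h0 h1) = _ at hP
  change Dzb α (modelZero h0 h1) = _ at hDzb
  rw [crossForm, hP, hDzb, inner_smul_left, inner_tz_Dz]
  simp [Complex.conj_ofNat]

theorem crossForm_modelOne_right (v : D2 α) : crossForm v (modelOne h0 h1) = 0 := by
  obtain ⟨hM, hDz, hDzb, hP⟩ := (exists_modelOne h0 h1).choose_spec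
  change P α (modelOne h0 h1) = _ at hP
  change Dz α (modelOne h0 h1) = _ at hDz
  rw [crossForm, hP, hDz, inner_smul_right, (inner_P_test v _).2]
  ring

theorem crossForm_modelOne_left (u : D2 α) :
    crossForm (modelOne h0 h1) u = -4 * (1 - α) * pairing (bdryZero h0 h1) u := by
  obtain ⟨hM, hDz, hDzb, hP⟩ := (exists_modelOne h0 h1).choose_spec
  change P α (modelOne h0 h1) = _ at hP
  change Dzb α (modelOne h0 h1) = _ at hDzb
  have hP' : P α (modelOne h0 h1) = (-4 : ℂ) • ((1 - α : ℂ) • toL2 (dzSig _ (rpw_smoothOff (-α))) +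
      toL2 (tz α (dzbarSig _ (mode_smoothOff α)))) := by
    refine L2_ext fun φ => ?_
    have a1 := inner_tzb_Dzb (modelOne h0 h1) φ
    have a2 := inner_tzb_powL h0 h1 φ
    have a3 := inner_tzb α φ (dzbarSig _ (mode_smoothOff α))
    rw [hDzb, inner_add_right, inner_smul_right, a2, a3] at a1
    rw [inner_smul_right, inner_add_right, inner_smul_right]
    linear_combination (-4 : ℂ) * a1
  rw [crossForm, hP', hDzb, pairing_bdryZero, inner_smul_left, inner_add_left, inner_smul_left,
    inner_add_left, inner_smul_left, inner_tz_Dz]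
  simp [Complex.conj_ofNat]
  ring

/-- Evaluate B(M₁, M₁) by both formulas. -/
theorem pairing_bdryZero_modelOne : pairing (bdryZero h0 h1) (modelOne h0 h1) = 0 := by
  have h := crossForm_modelOne_left h0 h1 (modelOne h0 h1)
  rw [crossForm_modelOne_right] at h
  have : (1 - α : ℂ) ≠ 0 := by exact_mod_cast (sub_pos.2 h1).ne'
  simpa [this] using h

theorem pairing_bdryOne_modelZero : pairing (bdryOne h0 h1) (modelZero h0 h1) = 0 := by
  have h := crossForm_modelZero_right h0 h1 (modelZero h0 h1)
  rw [crossForm_modelZero_left] at h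
  have : (α : ℂ) ≠ 0 := by exact_mod_cast h0.ne'
  simpa [this] using h

/-- The one value that is computed. The powers r^α and r^{-α} cancel, and so do the terms |∂_z σ|²;
what remains is α times the integral of `integral_sig_dz_sig`, independent of the shape of the
cutoff. -/
theorem pairing_bdryZero_modelZero :
    pairing (bdryZero h0 h1) (modelZero h0 h1) = -(Real.pi * α) := by
  obtain ⟨hM, hDz, hDzb, hP⟩ := (exists_modelZero h0 h1).choose_spec
  change P α (modelZero h0 h1) = _ at hP
  change Dz α (modelZero h0 h1) = _ at hDz
  set D := dzSig _ (rpw_smoothOff (-α)) with hD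
  set E := dzbarSig _ (rpw_smoothOff α) with hE
  have hs1 : SmoothOff fun z => dz sig z * rpw α z + sig z * (α * sing α z) :=
    (sig_smoothOff.dz.mul (rpw_smoothOff α)).add
      (sig_smoothOff.mul ((SmoothOff.const _).mul (sing_smoothOff α)))
  have hs2 : SmoothOff fun z => sig z * rpw (-α) z := sig_smoothOff.mul (rpw_smoothOff (-α))
  have e1 : ⟪toL2 D, Dz α (modelZero h0 h1)⟫_ℂ = ∫ z, conj ((D : ℂ → ℂ) z) *
      (dz sig z * rpw α z + sig z * (α * sing α z)) := by
    refine inner_eq_of_ae _ ?_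
    rw [hDz]
    filter_upwards [Lp.coeFn_add (toL2 (dzSig _ (rpw_smoothOff α))) ((α : ℂ) • singL h0 h1),
      Lp.coeFn_smul (α : ℂ) (singL h0 h1), dzSig_ae _ (rpw_smoothOff α), singL_ae h0 h1]
      with z a1 a2 a3 a4
    rw [a1, Pi.add_apply, a2, Pi.smul_apply, a3, a4, smul_eq_mul]
    ring
  have e2 : ⟪powL h0 h1, toL2 (tz α E)⟫_ℂ =
      -∫ z, conj (conj ((E : ℂ → ℂ) z) * Tzb α (fun w => sig w * rpw (-α) w) z) := by
    rw [integral_conj, ← inner_conj_symm, inner_eq_of_ae _ (powL_ae h0 h1), tz_coe,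
      Tz_parts α E hs2, map_neg]
  have i1 := integrable_test (Test.conj_mul_smooth D.2 hs1)
  have i2 := integrable_test (Test.conj (Test.conj_mul_smooth E.2 (hs2.Tzb α)))
  rw [pairing_bdryZero, hP, inner_smul_right, ← hD, e1, e2]
  have e3 : ∀ x y : ℂ, x - 1 / 4 * (-4 * -y) = x - y := fun x y => by ring
  rw [e3, ← integral_sub i1 i2]
  have e4 : (-(Real.pi * α) : ℂ) = ∫ z : ℂ, (α : ℂ) *
      ((stp (Real.log ‖z‖) * deriv stp (Real.log ‖z‖) / ‖z‖ ^ 2 : ℝ) : ℂ) := by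
    rw [integral_const_mul, integral_sig_dz_sig]; ring
  rw [e4]
  refine integral_congr_ae (ae_ne_zero.mono fun z hz => ?_)
  have d1 : (D : ℂ → ℂ) z = dz sig z * rpw (-α) z := dzSig_apply _ hz
  have d2 : (E : ℂ → ℂ) z = dzbar sig z * rpw α z := dzbarSig_apply _ hz
  have d3 : Tzb α (rpw (-α)) z = -(α / conj z) * rpw (-α) z := by
    rw [Tzb, dzbar_rpw _ hz]; push_cast; ring
  have hz' : conj z ≠ 0 := (map_ne_zero _).2 hz
  have hr : rpw α z * rpw (-α) z = 1 := by rw [← rpw_add, add_neg_cancel, rpw_zero]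
  have hn : ((‖z‖ ^ 2 : ℝ) : ℂ) = z * conj z := by
    rw [Complex.mul_conj, Complex.normSq_eq_norm_sq]
  simp only [d1, d2, Tzb_sig_mul α (rpw_smoothOff (-α)) hz, d3, map_mul, map_add, map_neg, map_div₀,
    Complex.conj_conj, conj_sig, conj_rpw, dz_sig hz, dzbar_sig hz, Complex.conj_ofReal, map_ofNat]
  rw [Complex.ofReal_div, hn]
  simp only [sing, sig]
  push_cast
  have hr' : rpw (-α) z = (rpw α z)⁻¹ := eq_inv_of_mul_eq_one_right hr
  rw [hr']
  have hr0 := rpw_ne_zero α z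
  field_simp
  ring

/-- Evaluate B(M₁, M₀) by both formulas, using the known value of `bdryZero` at M₀. -/
theorem pairing_bdryOne_modelOne :
    pairing (bdryOne h0 h1) (modelOne h0 h1) = -(Real.pi * (1 - α)) := by
  have h := crossForm_modelOne_left h0 h1 (modelZero h0 h1)
  rw [crossForm_modelZero_right, pairing_bdryZero_modelZero] at h
  have ha : (α : ℂ) ≠ 0 := by exact_mod_cast h0.ne'
  have h2 : conj (pairing (bdryOne h0 h1) (modelOne h0 h1)) = -(Real.pi * (1 - α)) := by
    have : (-4 * α : ℂ) ≠ 0 := by simpa using ha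
    apply mul_left_cancel₀ this
    rw [h]; ring
  have h3 := congrArg conj h2
  rw [Complex.conj_conj] at h3
  rw [h3]
  simp

end

/-! ## The coefficients -/

theorem pairing_sub (L : Dminus2 α) (u v : D2 α) : pairing L (u - v) = pairing L u - pairing L v := by
  rw [pairing, map_sub, map_sub]; rfl

theorem pairing_smul (L : Dminus2 α) (c : ℂ) (u : D2 α) : pairing L (c • u) = c * pairing L u := by
  rw [pairing, map_smulₛₗ, smul_eq_mul, map_mul, Complex.conj_conj]; rfl

/-- Two cutoffs agree near 0 and far away, so the choice only changes the expansion by a test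
function, which the closure domain absorbs. -/
theorem exists_cutoff_sub_sig {ρ : ℝ → ℝ} (hρ : IsCutoff ρ) {f : ℂ → ℂ} (hf : SmoothOff f) :
    ∃ φ : Test, ∀ z, z ≠ 0 → (φ : ℂ → ℂ) z = ((ρ ‖z‖ : ℂ) - sig z) * f z := by
  obtain ⟨h1, h2, R, h3⟩ := hρ
  have hs : SmoothOff fun z => (ρ ‖z‖ : ℂ) := fun z hz =>
    Complex.ofRealCLM.contDiff.contDiffAt.comp z
      (h1.contDiffAt.comp z (contDiffAt_norm ℝ hz))
  refine ⟨⟨offZero fun z => ((ρ ‖z‖ : ℂ) - sig z) * f z, offZero_mem_Test (ε := 1) (R := max R 3)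
    ((hs.sub sig_smoothOff).mul hf) one_pos (fun z _ hz => ?_) (fun z _ hz => ?_)⟩, fun z hz => ?_⟩
  · rw [h2 _ hz.le, sig_eq_one hz.le]; simp
  · rw [h3 _ ((le_max_left _ _).trans hz.le), sig_eq_zero ((le_max_right _ _).trans_lt hz)]; simp
  · exact offZero_apply (fun z => ((ρ ‖z‖ : ℂ) - sig z) * f z) hz

theorem mode_eq {z : ℂ} (hz : z ≠ 0) :
    ((‖z‖ ^ (1 - α) : ℝ) : ℂ) * Complex.exp (-(Complex.I * z.arg)) = mode α z := by
  have h1 : conj z = ‖z‖ * Complex.exp (-(Complex.I * z.arg)) := by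
    conv_lhs => rw [← Complex.norm_mul_exp_arg_mul_I z]
    rw [map_mul, Complex.conj_ofReal, ← Complex.exp_conj, map_mul, Complex.conj_ofReal,
      Complex.conj_I]
    congr 2; ring
  rw [mode, h1, rpw_eq _ hz, sub_eq_neg_add, Real.rpow_add_one (norm_ne_zero_iff.2 hz)]
  push_cast
  ring

theorem ofReal_ne (h0 : 0 < α) (h1 : α < 1) :
    (Real.pi * α : ℂ) ≠ 0 ∧ (Real.pi * (1 - α) : ℂ) ≠ 0 := by
  have a1 : (Real.pi * α : ℝ) ≠ 0 := (mul_pos Real.pi_pos h0).ne'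
  have a2 : (Real.pi * (1 - α) : ℝ) ≠ 0 := (mul_pos Real.pi_pos (sub_pos.2 h1)).ne'
  constructor
  · exact_mod_cast a1
  · exact_mod_cast a2

section

variable (h0 : 0 < α) (h1 : α < 1)

theorem hasExpansion_iff {ρ : ℝ → ℝ} (hρ : IsCutoff ρ) (u : D2 α) (c₀ c₁ : ℂ) :
    HasExpansion α ρ u c₀ c₁ ↔
      u - c₀ • modelZero h0 h1 - c₁ • modelOne h0 h1 ∈ minDomain α := by
  obtain ⟨hM0, -⟩ := (exists_modelZero h0 h1).choose_spec
  change incl α (modelZero h0 h1) =ᵐ[volume] _ at hM0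
  obtain ⟨hM1, -⟩ := (exists_modelOne h0 h1).choose_spec
  change incl α (modelOne h0 h1) =ᵐ[volume] _ at hM1
  obtain ⟨φ, hφ⟩ := exists_cutoff_sub_sig hρ (f := fun z => c₁ * mode α z + c₀ * rpw α z)
    (((SmoothOff.const _).mul (mode_smoothOff α)).add ((SmoothOff.const _).mul (rpw_smoothOff α)))
  set d : D2 α := u - c₀ • modelZero h0 h1 - c₁ • modelOne h0 h1 - testD2 α φ with hd
  have hd' : d ∈ minDomain α ↔ u - c₀ • modelZero h0 h1 - c₁ • modelOne h0 h1 ∈ minDomain α :=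
    Submodule.sub_mem_iff_left _ (testD2_mem φ)
  have hdc : incl α d =ᵐ[volume] fun z => incl α u z -
      (c₁ * (‖z‖ ^ (1 - α) : ℝ) * Complex.exp (-(Complex.I * z.arg)) + c₀ * (‖z‖ ^ α : ℝ)) *
        ρ ‖z‖ := by
    have e : incl α d = incl α u - c₀ • incl α (modelZero h0 h1) - c₁ • incl α (modelOne h0 h1) -
        toL2 φ := by rw [hd, map_sub, map_sub, map_sub, map_smul, map_smul, incl_testD2]
    rw [e]
    filter_upwards [Lp.coeFn_sub (incl α u - c₀ • incl α (modelZero h0 h1) -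
        c₁ • incl α (modelOne h0 h1)) (toL2 φ), Lp.coeFn_sub (incl α u -
        c₀ • incl α (modelZero h0 h1)) (c₁ • incl α (modelOne h0 h1)),
      Lp.coeFn_sub (incl α u) (c₀ • incl α (modelZero h0 h1)),
      Lp.coeFn_smul c₀ (incl α (modelZero h0 h1)), Lp.coeFn_smul c₁ (incl α (modelOne h0 h1)),
      hM0, hM1, toL2_coe φ, ae_ne_zero] with z a1 a2 a3 a4 a5 a6 a7 a8 hz
    rw [a1, Pi.sub_apply, a2, Pi.sub_apply, a3, Pi.sub_apply, a4, Pi.smul_apply, a5, Pi.smul_apply,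
      a6, a7, a8, hφ z hz, mul_assoc c₁, mode_eq hz, ← rpw_eq α hz, smul_eq_mul, smul_eq_mul]
    ring
  rw [← hd', mem_minDomain_iff]
  constructor
  · rintro ⟨v, hv, huv⟩
    have : incl α d = v := Lp.ext (by
      filter_upwards [hdc, huv] with z e1 e2
      rw [e1, e2]; ring)
    rwa [this]
  · intro h
    refine ⟨incl α d, h, ?_⟩
    filter_upwards [hdc] with z e1
    rw [e1]; ring

/-- The functional that extracts the coefficient of `r^α`. -/
def coeffZero : Dminus2 α := (-(Real.pi * α)⁻¹ : ℂ) • bdryZero h0 h1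

/-- The functional that extracts the coefficient of `r^{1-α} e^{-iθ}`. -/
def coeffOne : Dminus2 α := (-(Real.pi * (1 - α))⁻¹ : ℂ) • bdryOne h0 h1

theorem pairing_coeffZero (u : D2 α) :
    pairing (coeffZero h0 h1) u = -(Real.pi * α : ℂ)⁻¹ * pairing (bdryZero h0 h1) u := by
  change conj (_ * (bdryZero h0 h1) u) = _
  rw [map_mul, pairing]
  simp

theorem pairing_coeffOne (u : D2 α) :
    pairing (coeffOne h0 h1) u = -(Real.pi * (1 - α) : ℂ)⁻¹ * pairing (bdryOne h0 h1) u := by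
  change conj (_ * (bdryOne h0 h1) u) = _
  rw [map_mul, pairing]
  simp

/-- The matrix of the two boundary functionals on the two models is diagonal with entries -πα and
-π(1-α), and their common kernel is the closure domain. -/
theorem sub_models_mem_iff (u : D2 α) (c₀ c₁ : ℂ) :
    u - c₀ • modelZero h0 h1 - c₁ • modelOne h0 h1 ∈ minDomain α ↔
      c₀ = pairing (coeffZero h0 h1) u ∧ c₁ = pairing (coeffOne h0 h1) u := by
  obtain ⟨a1, a2⟩ := ofReal_ne h0 h1
  have e1 : pairing (bdryZero h0 h1) (u - c₀ • modelZero h0 h1 - c₁ • modelOne h0 h1) =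
      pairing (bdryZero h0 h1) u + Real.pi * α * c₀ := by
    rw [pairing_sub, pairing_sub, pairing_smul, pairing_smul, pairing_bdryZero_modelZero,
      pairing_bdryZero_modelOne]
    ring
  have e2 : pairing (bdryOne h0 h1) (u - c₀ • modelZero h0 h1 - c₁ • modelOne h0 h1) =
      pairing (bdryOne h0 h1) u + Real.pi * (1 - α) * c₁ := by
    rw [pairing_sub, pairing_sub, pairing_smul, pairing_smul, pairing_bdryOne_modelZero,
      pairing_bdryOne_modelOne]
    ring
  rw [pairing_coeffZero, pairing_coeffOne]
  constructor
  · intro h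
    have b1 := pairing_bdryZero_eq_zero h0 h1 h
    have b2 := pairing_bdryOne_eq_zero h0 h1 h
    rw [e1] at b1
    rw [e2] at b2
    constructor
    · rw [neg_mul, eq_neg_iff_add_eq_zero, ← mul_right_inj' a1, mul_add, mul_inv_cancel_left₀ a1]
      linear_combination b1
    · rw [neg_mul, eq_neg_iff_add_eq_zero, ← mul_right_inj' a2, mul_add, mul_inv_cancel_left₀ a2]
      linear_combination b2
  · rintro ⟨rfl, rfl⟩
    refine mem_minDomain_of_pairing h0 h1 ?_ ?_
    · rw [e1, neg_mul, mul_neg, mul_inv_cancel_left₀ a1, add_neg_cancel]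
    · rw [e2, neg_mul, mul_neg, mul_inv_cancel_left₀ a2, add_neg_cancel]

theorem areCoefficients : AreCoefficients α (coeffZero h0 h1) (coeffOne h0 h1) :=
  fun _ hρ u c₀ c₁ => (hasExpansion_iff h0 h1 hρ u c₀ c₁).trans (sub_models_mem_iff h0 h1 u c₀ c₁)

/-! ## The commutator -/

theorem crossForm_eq_zero_right (v : D2 α) {u : D2 α} (hu : u ∈ minDomain α) : crossForm v u = 0 := by
  refine eq_zero_of_mem_minDomain (B := crossForm v) ?_ (fun φ => ?_) hu
  · exact (continuous_const.inner (P α).continuous).add (continuous_const.inner (Dz α).continuous)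
  · rw [crossForm, P_testD2, Dz_testD2, (inner_P_test v _).2, ham_eq, map_smul, inner_smul_right]
    ring

/-- Modulo the closure domain u is c₀ M₀ + c₁ M₁, and B(v, ·) kills M₁. The factor -4α from M₀ meets
-π(1-α) from the normalization of `coeffOne`. -/
theorem crossForm_eq (v u : D2 α) : crossForm v u = 4 * Real.pi * α * (1 - α) *
    (pairing (coeffZero h0 h1) u * coeffOne h0 h1 v) := by
  obtain ⟨a1, a2⟩ := ofReal_ne h0 h1
  set c₀ := pairing (coeffZero h0 h1) u
  set c₁ := pairing (coeffOne h0 h1) u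
  have h := crossForm_eq_zero_right v ((sub_models_mem_iff h0 h1 u c₀ c₁).2 ⟨rfl, rfl⟩)
  have e : crossForm v (u - c₀ • modelZero h0 h1 - c₁ • modelOne h0 h1) =
      crossForm v u - c₀ * crossForm v (modelZero h0 h1) - c₁ * crossForm v (modelOne h0 h1) := by
    simp only [crossForm, map_sub, map_smul, inner_sub_right, inner_smul_right]
    ring
  rw [e, crossForm_modelZero_right, crossForm_modelOne_right, pairing, Complex.conj_conj] at h
  have e2 : coeffOne h0 h1 v = -(Real.pi * (1 - α) : ℂ)⁻¹ * bdryOne h0 h1 v := by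
    simp [coeffOne]
  rw [e2]
  linear_combination h + 4 * α * c₀ * bdryOne h0 h1 v * mul_inv_cancel₀ a2

/-- The coefficient of T_z̄ is the conjugate of that of T_z, so the T_z̄ part is the Hermitian
transpose of the T_z part. -/
theorem commutator_twistOp_apply (a b : ℝ) (u v : D2 α) : commutator (twistOp α a b) u v =
    -((a + b * Complex.I) * crossForm v u) - (a - b * Complex.I) * conj (crossForm u v) := by
  change -⟪twistOp α a b v, P α u⟫_ℂ - ⟪P α v, twistOp α a b u⟫_ℂ = _
  simp only [twistOp, _root_.add_apply, _root_.smul_apply, inner_add_left, inner_add_right,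
    inner_smul_left, inner_smul_right, crossForm, map_add, inner_conj_symm, map_sub, map_mul,
    Complex.conj_ofReal, Complex.conj_I]
  ring

theorem commutator_twistOp (a b : ℝ) (u : D2 α) : commutator (twistOp α a b) u =
    (-4 * Real.pi * α * (1 - α) : ℂ) •
      (((a + b * Complex.I) * pairing (coeffZero h0 h1) u) • coeffOne h0 h1 +
        ((a - b * Complex.I) * pairing (coeffOne h0 h1) u) • coeffZero h0 h1) := by
  ext v
  have e : conj (crossForm u v) = 4 * Real.pi * α * (1 - α) *
      (coeffZero h0 h1 v * pairing (coeffOne h0 h1) u) := by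
    rw [crossForm_eq h0 h1]
    simp only [pairing, map_mul, map_sub, map_one, Complex.conj_conj, Complex.conj_ofReal,
      Complex.conj_ofNat]
  rw [commutator_twistOp_apply, crossForm_eq h0 h1, e]
  simp only [_root_.add_apply, _root_.smul_apply, smul_eq_mul]
  ring

theorem apply_eq_zero_of_mem {v : D2 α} (hv : v ∈ minDomain α) :
    coeffZero h0 h1 v = 0 ∧ coeffOne h0 h1 v = 0 := by
  have b1 := pairing_bdryZero_eq_zero h0 h1 hv
  have b2 := pairing_bdryOne_eq_zero h0 h1 hv
  rw [pairing, map_eq_zero] at b1 b2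
  exact ⟨(congrArg (_ * ·) b1).trans (mul_zero _), (congrArg (_ * ·) b2).trans (mul_zero _)⟩

end

/-- The product φu is in the closure domain, where both coefficient functionals vanish. -/
theorem supportedAtZero (h0 : 0 < α) (h1 : α < 1) (a b : ℝ) (u : D2 α) :
    SupportedAtZero (commutator (twistOp α a b) u) := by
  intro w φ hφ
  obtain ⟨b1, b2⟩ := apply_eq_zero_of_mem h0 h1 (prodD2_mem w ⟨φ, hφ⟩)
  refine ⟨prodD2 w ⟨φ, hφ⟩, mulL_coe ⟨φ, hφ⟩ (incl α w), ?_⟩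
  rw [commutator_twistOp h0 h1]
  simp only [_root_.add_apply, _root_.smul_apply, smul_eq_mul, b1, b2]
  ring

/-! ## The complex form of the twisted translations -/

/-- Near z, e^{iαθ} is a constant times (w/z)^α |w|^{-α}: a holomorphic factor times a radial power,
both easy to differentiate. Only continuity of ϑ is used. -/
theorem exp_angle_eq {ϑ : ℂ → ℝ} {z : ℂ} (hz : z ≠ 0) (h : IsAngleNear ϑ z) (α : ℝ) :
    (fun w => Complex.exp (Complex.I * α * ϑ w)) =ᶠ[𝓝 z] fun w =>
      Complex.exp (Complex.I * α * ϑ z) * rpw α z *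
        (Complex.exp (α * Complex.log (w / z)) * rpw (-α) w) := by
  have hz1 := h.self_of_nhds
  -- Close to z the angle moves by less than π, so the principal logarithm of w/z has imaginary part
  -- ϑ(w) - ϑ(z).
  have hc : ∀ᶠ w in 𝓝 z, |ϑ w - ϑ z| < 1 := by
    have := hz1.1.eventually (Metric.ball_mem_nhds (ϑ z) one_pos)
    simpa [Real.dist_eq] using this
  filter_upwards [h, hc, isOpen_ne.mem_nhds hz] with w hw hw1 hw0
  have el : ∀ x : ℂ, x ≠ 0 → Complex.exp (Real.log ‖x‖ : ℝ) = ‖x‖ := fun x hx => by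
    rw [← Complex.ofReal_exp, Real.exp_log (norm_pos_iff.2 hx)]
  have e1 : w / z = Complex.exp ((Real.log ‖w‖ : ℝ) - (Real.log ‖z‖ : ℝ) +
      Complex.I * ((ϑ w - ϑ z : ℝ) : ℂ)) := by
    rw [Complex.exp_add, Complex.exp_sub, el w hw0, el z hz, Complex.ofReal_sub, mul_sub,
      Complex.exp_sub]
    conv_lhs => rw [hw.2, hz1.2]
    field_simp
  have hpi := Real.pi_gt_three
  rw [abs_lt] at hw1
  have e2 : Complex.log (w / z) = (Real.log ‖w‖ : ℝ) - (Real.log ‖z‖ : ℝ) +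
      Complex.I * ((ϑ w - ϑ z : ℝ) : ℂ) := by
    rw [e1, Complex.log_exp]
    · simp; linarith
    · simp; linarith
  simp only [e2, rpw]
  push_cast
  simp only [← Complex.exp_add]
  congr 1
  ring

theorem differentiableAt_exp_angle {ϑ : ℂ → ℝ} {z : ℂ} (hz : z ≠ 0) (h : IsAngleNear ϑ z) (α : ℝ) :
    DifferentiableAt ℝ (fun w => Complex.exp (Complex.I * α * ϑ w)) z ∧
      dz (fun w => Complex.exp (Complex.I * α * ϑ w)) z =
        α / (2 * z) * Complex.exp (Complex.I * α * ϑ z) ∧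
      dzbar (fun w => Complex.exp (Complex.I * α * ϑ w)) z =
        -(α / (2 * conj z)) * Complex.exp (Complex.I * α * ϑ z) := by
  have he := exp_angle_eq hz h α
  have hH : HasDerivAt (fun w => Complex.exp (α * Complex.log (w / z))) (α / z) z := by
    have h1 : HasDerivAt (fun w => w / z) (1 / z) z := (hasDerivAt_id z).div_const z
    have h2 := (h1.clog (by rw [div_self hz]; exact Complex.one_mem_slitPlane)).const_mul (α : ℂ)
    refine h2.cexp.congr_deriv ?_
    rw [div_self hz]
    simp [div_eq_mul_inv]
  have hHd : DifferentiableAt ℝ (fun w => Complex.exp (α * Complex.log (w / z))) z :=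
    hH.differentiableAt.restrictScalars ℝ
  have hr := (rpw_smoothOff (-α)).differentiableAt hz
  have hd : DifferentiableAt ℝ
      (fun w => Complex.exp (α * Complex.log (w / z)) * rpw (-α) w) z := hHd.mul hr
  obtain ⟨d1, d2⟩ := hasDerivAt_dz hH
  have hr0 : rpw α z * rpw (-α) z = 1 := by rw [← rpw_add, add_neg_cancel, rpw_zero]
  have hHz : Complex.exp (α * Complex.log (z / z)) = 1 := by simp [div_self hz]
  refine ⟨(hd.const_mul _).congr_of_eventuallyEq he, ?_, ?_⟩
  · rw [dz_congr he, dz_const_mul _ hd, dz_mul hHd hr, d1, hHz, dz_rpw _ hz]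
    push_cast
    linear_combination (Complex.exp (Complex.I * α * ϑ z) * (α / (2 * z))) * hr0
  · rw [dzbar_congr he, dzbar_const_mul _ hd, dzbar_mul hHd hr, d2, hHz, dzbar_rpw _ hz]
    push_cast
    linear_combination (-Complex.exp (Complex.I * α * ϑ z) * (α / (2 * conj z))) * hr0

theorem hasComplexForm (α a b : ℝ) :
    HasComplexForm α a b (a + b * Complex.I) (a - b * Complex.I) := by
  intro f z ϑ hz hf hϑ
  obtain ⟨hd, d1, d2⟩ := differentiableAt_exp_angle hz hϑ α
  rw [twist_eq α a b f hz, dz_mul hd hf, dzbar_mul hd hf, d1, d2, Tz, Tzb, Complex.exp_neg]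
  have hE := Complex.exp_ne_zero (Complex.I * α * ϑ z)
  field_simp
  ring

/-! ### Uniqueness of the coefficients X_z and X_z̄. -/

theorem isAngleNear_arg : IsAngleNear Complex.arg 1 := by
  filter_upwards [Complex.isOpen_slitPlane.mem_nhds Complex.one_mem_slitPlane] with w hw
  refine ⟨Complex.continuousAt_arg hw, ?_⟩
  rw [mul_comm Complex.I, Complex.norm_mul_exp_arg_mul_I]

/-- Apply the form at the point 1 to e^{-iαθ} z and e^{-iαθ} z̄, where each of ∂_z and ∂_z̄ is
isolated. -/
theorem HasComplexForm.eq {a b : ℝ} {Xz Xzbar : ℂ} (h : HasComplexForm α a b Xz Xzbar) :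
    Xz = a + b * Complex.I ∧ Xzbar = a - b * Complex.I := by
  obtain ⟨hd, -⟩ := differentiableAt_exp_angle one_ne_zero isAngleNear_arg α
  have key : ∀ g : ℂ → ℂ, DifferentiableAt ℝ g 1 → Xz * dz g 1 + Xzbar * dzbar g 1 =
      (a + b * Complex.I) * dz g 1 + (a - b * Complex.I) * dzbar g 1 := fun g hg => by
    have hf : DifferentiableAt ℝ (fun w => (Complex.exp (Complex.I * α * w.arg))⁻¹ * g w) 1 :=
      (hd.inv (Complex.exp_ne_zero _)).mul hg
    have e : (fun w : ℂ => Complex.exp (Complex.I * α * w.arg) *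
        ((Complex.exp (Complex.I * α * w.arg))⁻¹ * g w)) = g :=
      funext fun w => mul_inv_cancel_left₀ (Complex.exp_ne_zero _) _
    have e1 := h _ 1 Complex.arg one_ne_zero hf isAngleNear_arg
    have e2 := hasComplexForm α a b _ 1 Complex.arg one_ne_zero hf isAngleNear_arg
    rw [e1, e] at e2
    exact mul_left_cancel₀ (Complex.exp_ne_zero _) e2
  have k1 := key (fun w => w) differentiableAt_id
  have k2 := key (fun w => conj w) (differentiableAt_conj differentiableAt_id)
  obtain ⟨d1, d2⟩ := hasDerivAt_dz (f := fun w : ℂ => w) (hasDerivAt_id (1 : ℂ))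
  rw [d1, d2] at k1
  rw [dz_conj_id, dzbar_conj_id] at k2
  exact ⟨by simpa using k1, by simpa using k2⟩

end AharonovBohm

end

theorem mainTheorem2 (α : ℝ) (hα₀ : 0 < α) (hα₁ : α < 1) :
    ∃ L₀ Lneg₁ : AharonovBohm.Dminus2 α, AharonovBohm.AreCoefficients α L₀ Lneg₁ ∧
      ∀ a b : ℝ,
        (∃ Xz Xzbar : ℂ, AharonovBohm.HasComplexForm α a b Xz Xzbar) ∧
        ∃ Q : AharonovBohm.D2 α →L[ℂ] AharonovBohm.L2, AharonovBohm.IsTwist α a b Q ∧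
          ∀ Xz Xzbar : ℂ, AharonovBohm.HasComplexForm α a b Xz Xzbar →
            ∀ u : AharonovBohm.D2 α,
              AharonovBohm.SupportedAtZero (AharonovBohm.commutator Q u) ∧
              AharonovBohm.commutator Q u =
                (-4 * Real.pi * α * (1 - α) : ℂ) •
                  ((Xz * AharonovBohm.pairing L₀ u) • Lneg₁ +
                    (Xzbar * AharonovBohm.pairing Lneg₁ u) • L₀) := by
  refine ⟨AharonovBohm.coeffZero hα₀ hα₁, AharonovBohm.coeffOne hα₀ hα₁,
    AharonovBohm.areCoefficients hα₀ hα₁, fun a b => ⟨⟨_, _, AharonovBohm.hasComplexForm α a b⟩,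
      AharonovBohm.twistOp α a b, AharonovBohm.isTwist_twistOp a b, fun Xz Xzbar hX u => ?_⟩⟩
  obtain ⟨rfl, rfl⟩ := hX.eq
  exact ⟨AharonovBohm.supportedAtZero hα₀ hα₁ a b u,
    AharonovBohm.commutator_twistOp hα₀ hα₁ a b u⟩
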